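/- Let $\mathbb K$ be an algebraically closed field of characteristic zero and let $a\in\mathbb K\setminus\{0,-1\}$. Let $\mathfrak g=\mathfrak g_0\oplus\mathfrak g_1=D(2,1;a)$ be the contragredient Lie superalgebra over $\mathbb K$ with Cartan matrix $$(a_{ij})=\begin{pmatrix}0&1&a\\-1&2&0\\-1&0&2\end{pmatrix},$$ that is, the Lie superalgebra generated by $h_i,e_i,f_i$ ($i=1,2,3$), with $e_1,f_1$ odd and the other generators even, with the relations $[h_i,h_j]=0$, $[h_i,e_j]=a_{ij}e_j$, $[h_i,f_j]=-a_{ij}f_j$, $[e_i,f_j]=\delta_{ij}h_i$, $[e_1,e_1]=[f_1,f_1]=0$, in which $h_1,h_2,h_3$ are linearly independent and which has no non-zero ideal meeting $\mathfrak h=\sum_i\mathbb K h_i$ trivially. Let $\Delta=\Delta_0\sqcup\Delta_1\subset\mathfrak h^*$ be the set of (even and odd) roots of $\mathfrak g$ with respect to $\mathfrak h$; explicitly $\Delta_0=\{\pm2\varepsilon_1,\pm2\varepsilon_2,\pm2\varepsilon_3\}$ and $\Delta_1=\{\pm\varepsilon_1\pm\varepsilon_2\pm\varepsilon_3\}$,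 where $\varepsilon_1-\varepsilon_2-\varepsilon_3$, $2\varepsilon_2$, $2\varepsilon_3$ are the weights of $e_1,e_2,e_3$. On $\mathfrak h^*$ let $(\ ,\ )$ be the bilinear form for which the $\varepsilon_i$ are orthogonal with $(\varepsilon_1,\varepsilon_1)=-(1+a)/2$, $(\varepsilon_2,\varepsilon_2)=1/2$, $(\varepsilon_3,\varepsilon_3)=a/2$. The positive roots are $2\varepsilon_i$ ($i=1,2,3$) and $\varepsilon_1\pm\varepsilon_2\pm\varepsilon_3$; their coroots are $H_{2\varepsilon_1}=(1+a)^{-1}(2h_1-h_2-ah_3)$, $H_{2\varepsilon_2}=h_2$, $H_{2\varepsilon_3}=h_3$, $H_{\varepsilon_1-\varepsilon_2-\varepsilon_3}=h_1$, $H_{\varepsilon_1+\varepsilon_2-\varepsilon_3}=h_1-h_2$, $H_{\varepsilon_1-\varepsilon_2+\varepsilon_3}=h_1-ah_3$, $H_{\varepsilon_1+\varepsilon_2+\varepsilon_3}=h_1-h_2-ah_3$, and $H_{-\alpha}=-H_\alpha$. Let $\mathbb Z[a]$ be the subring of $\mathbb K$ generated by $a$. A Chevalley basis of $\mathfrak g$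 is a homogeneous $\mathbb K$-basis $\{H_1,H_2,H_3\}\sqcup\{X_\alpha\}_{\alpha\in\Delta}$ such that: (a) $\{H_1,H_2,H_3\}$ is a $\mathbb K$-basis of $\mathfrak h$, and $\mathfrak h_{\mathbb Z[a]}:=\sum_i\mathbb Z[a]H_i$ is the $\mathbb Z[a]$-span of all the $H_\alpha$, $\alpha\in\Delta$; (b) $[H_i,H_j]=0$ and $[H_i,X_\alpha]=\alpha(H_i)X_\alpha$; (c) $[X_\alpha,X_{-\alpha}]=\sigma_\alpha H_\alpha$, where $\sigma_\alpha=-1$ if $\alpha$ is an odd negative root and $\sigma_\alpha=1$ otherwise; (d) for $\alpha,\beta\in\Delta$ with $\alpha+\beta\ne0$: $[X_\alpha,X_\beta]=0$ if $\alpha+\beta\notin\Delta$, while $[X_\alpha,X_\beta]=c_{\alpha,\beta}X_{\alpha+\beta}$ if $\alpha+\beta\in\Delta$, where $c_{\alpha,\beta}=\pm(r+1)$ if $(\alpha,\alpha)\neq0$ or $(\beta,\beta)\ne0$ and $(\beta+\mathbb Z\alpha)\cap(\Delta\cup\{0\})=\{\beta-r\alpha,\dots,\beta+q\alpha\}$,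 and $c_{\alpha,\beta}=\pm\beta(H_\alpha)$ if $(\alpha,\alpha)=0=(\beta,\beta)$. Fix a Chevalley basis. For $y$ in a $\mathbb K$-algebra and $n\in\mathbb N$ put $\binom yn=y(y-1)\cdots(y-n+1)/n!$ and $y^{(n)}=y^n/n!$. Let $\mathbb Z_a$ be the subring of $\mathbb K$ generated by all $\binom pn$ with $p\in\mathbb Z[a]$, $n\in\mathbb N$. Let $U(\mathfrak g)$ be the universal enveloping superalgebra of $\mathfrak g$, and let the Kostant superalgebra $K_{\mathbb Z_a}(\mathfrak g)$ be the unital $\mathbb Z_a$-subalgebra of $U(\mathfrak g)$ generated by $X_\alpha^{(n)}$, $X_\gamma$ and $\binom Hn$ for $\alpha\in\Delta_0$, $\gamma\in\Delta_1$, $H\in\mathfrak h_{\mathbb Z[a]}$, $n\in\mathbb N$. Theorem. $K_{\mathbb Z_a}(\mathfrak g)$ is a free $\mathbb Z_a$-module. Moreover, for every total order $\preceq$ on $\Delta\sqcup\{1,2,3\}$, a $\mathbb Z_a$-basis of $K_{\mathbb Z_a}(\mathfrak g)$ is formed by the ordered monomials, i.e. by all products of the factors $X_\alpha^{(n_\alpha)}$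 ($\alpha\in\Delta_0$), $\binom{H_i}{n_i}$ ($i=1,2,3$) and $X_\gamma^{n_\gamma}$ ($\gamma\in\Delta_1$), each index occurring once and the factors being taken in the order $\preceq$, where $n_\alpha,n_i\in\mathbb N$ and $n_\gamma\in\{0,1\}$ are arbitrary (distinct families of exponents giving distinct basis elements). -/

import Mathlib

set_option linter.unusedSimpArgs false
set_option linter.unnecessarySeqFocus false

noncomputable section

/-! ### Lie superalgebras and their universal enveloping superalgebras -/

/-- A Lie superalgebra over `K`: a `ℤ/2`-graded module `L = part 0 ⊕ part 1` with a bilinear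
even bracket that satisfies super antisymmetry and the super Jacobi identity. -/
class LieSuperalgebra (K L : Type*) [CommRing K] [AddCommGroup L] [Module K L] where
  part : ZMod 2 → Submodule K L
  isCompl : IsCompl (part 0) (part 1)
  bracket : L →ₗ[K] L →ₗ[K] L
  bracket_mem : ∀ {i j : ZMod 2} {x y : L}, x ∈ part i → y ∈ part j → bracket x y ∈ part (i + j)
  skew : ∀ {i j : ZMod 2} {x y : L}, x ∈ part i → y ∈ part j →
    bracket x y + (-1 : K) ^ (i.val * j.val) • bracket y x = 0
  jacobi : ∀ {i j k : ZMod 2} {x y z : L}, x ∈ part i → y ∈ part j → z ∈ part k →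
    (-1 : K) ^ (i.val * k.val) • bracket x (bracket y z) +
    (-1 : K) ^ (j.val * i.val) • bracket y (bracket z x) +
    (-1 : K) ^ (k.val * j.val) • bracket z (bracket x y) = 0

/-- The relations `x y - (-1)^{|x||y|} y x = [x, y]`, for `x`, `y` homogeneous. -/
inductive SuperEnvelopingRel (K L : Type*) [CommRing K] [AddCommGroup L] [Module K L]
    [LieSuperalgebra K L] : TensorAlgebra K L → TensorAlgebra K L → Prop
  | mk {i j : ZMod 2} {x y : L} (hx : x ∈ LieSuperalgebra.part (K := K) (L := L) i)
      (hy : y ∈ LieSuperalgebra.part (K := K) (L := L) j) :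
      SuperEnvelopingRel K L
        (TensorAlgebra.ι K x * TensorAlgebra.ι K y -
          (-1 : K) ^ (i.val * j.val) • (TensorAlgebra.ι K y * TensorAlgebra.ι K x))
        (TensorAlgebra.ι K (LieSuperalgebra.bracket (K := K) x y))

/-- The universal enveloping superalgebra of a Lie superalgebra. -/
def SuperEnveloping (K L : Type*) [CommRing K] [AddCommGroup L] [Module K L]
    [LieSuperalgebra K L] : Type _ :=
  RingQuot (SuperEnvelopingRel K L)

namespace SuperEnveloping

variable (K L : Type*) [CommRing K] [AddCommGroup L] [Module K L] [LieSuperalgebra K L]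

instance : Ring (SuperEnveloping K L) := inferInstanceAs (Ring (RingQuot (SuperEnvelopingRel K L)))
instance : Algebra K (SuperEnveloping K L) := inferInstanceAs (Algebra K (RingQuot (SuperEnvelopingRel K L)))

/-- The quotient map from the tensor algebra. -/
def mkAlgHom : TensorAlgebra K L →ₐ[K] SuperEnveloping K L := RingQuot.mkAlgHom K (SuperEnvelopingRel K L)

/-- The canonical map of a Lie superalgebra to its universal enveloping superalgebra. -/
def ι : L →ₗ[K] SuperEnveloping K L := (mkAlgHom K L).toLinearMap ∘ₗ TensorAlgebra.ι K

end SuperEnveloping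

/-! ### Divided powers and binomial coefficients -/

/-- The divided power `y ^ n / n!`. -/
def dividedPow (K : Type*) {A : Type*} [Field K] [Ring A] [Algebra K A] (y : A) (n : ℕ) : A :=
  (n.factorial : K)⁻¹ • y ^ n

/-- The binomial coefficient `y (y - 1) ⋯ (y - n + 1) / n!`. -/
def binom (K : Type*) {A : Type*} [Field K] [Ring A] [Algebra K A] (y : A) (n : ℕ) : A :=
  (n.factorial : K)⁻¹ • Polynomial.aeval y (descPochhammer K n)

/-! ### The Lie superalgebra `D(2,1;a)` -/

/-- The underlying space of `D(2,1;a)`.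

The even part is `sl₂ ⊕ sl₂ ⊕ sl₂`: the coordinates `even s 0`, `even s 1`, `even s 2` belong to
the standard basis `E`, `F`, `H` of the copy of `sl₂` with number `s`.  The odd part is `V ⊗ V ⊗ V`,
where `V` is the standard module of `sl₂` with basis `x₀`, `x₁` (of weight `1` and `-1`): the
coordinate `odd i j k` belongs to `xᵢ ⊗ xⱼ ⊗ xₖ`. -/
@[ext] structure D21 {K : Type*} [Field K] (a : K) where
  even : Fin 3 → Fin 3 → K
  odd : Fin 2 → Fin 2 → Fin 2 → K

namespace D21

variable {K : Type*} [Field K]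

/-- The scalars `-(1 + a) / 2`, `1 / 2`, `a / 2` (with sum zero). -/
def sigma (a : K) : Fin 3 → K := ![-(1 + a) / 2, 1 / 2, a / 2]

/-- The bracket of `sl₂`: `[H, E] = 2 E`, `[H, F] = -2 F`, `[E, F] = H`. -/
def sl2Bracket (A B : Fin 3 → K) : Fin 3 → K :=
  ![2 * (A 2 * B 0 - A 0 * B 2), 2 * (A 1 * B 2 - A 2 * B 1), A 0 * B 1 - A 1 * B 0]

/-- The action of `sl₂` on its standard module `V`. -/
def sl2Act (A : Fin 3 → K) (x : Fin 2 → K) : Fin 2 → K :=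
  ![A 2 * x 0 + A 0 * x 1, A 1 * x 0 - A 2 * x 1]

/-- The invariant alternating form `ψ` of `V`, on basis vectors. -/
def psi : Fin 2 → Fin 2 → K := ![![0, 1], ![-1, 0]]

/-- The symmetric equivariant map `V × V → sl₂`, `(x, y) ↦ (z ↦ ψ(y, z) x + ψ(x, z) y)`. -/
def symPair (x y : Fin 2 → K) : Fin 3 → K :=
  ![2 * x 0 * y 0, -2 * x 1 * y 1, -(x 0 * y 1 + x 1 * y 0)]

/-- The componentwise bracket of `sl₂ ⊕ sl₂ ⊕ sl₂`. -/
def evenBracket (A B : Fin 3 → Fin 3 → K) : Fin 3 → Fin 3 → K := fun s => sl2Bracket (A s) (B s)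

/-- The action of `sl₂ ⊕ sl₂ ⊕ sl₂` on `V ⊗ V ⊗ V`. -/
def oddAct (A : Fin 3 → Fin 3 → K) (v : Fin 2 → Fin 2 → Fin 2 → K) : Fin 2 → Fin 2 → Fin 2 → K :=
  fun i j k => sl2Act (A 0) (fun l => v l j k) i + sl2Act (A 1) (fun l => v i l k) j +
    sl2Act (A 2) (fun l => v i j l) k

/-- The bracket of two odd elements.  For decomposable tensors, the component of
`[v₀ ⊗ v₁ ⊗ v₂, w₀ ⊗ w₁ ⊗ w₂]` in copy `s` is `σ s · (∏_{t ≠ s} ψ(v_t, w_t)) · symPair v_s w_s`. -/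
def oddBracket (a : K) (v w : Fin 2 → Fin 2 → Fin 2 → K) : Fin 3 → Fin 3 → K :=
  ![sigma a 0 • ∑ j, ∑ j', ∑ k, ∑ k', (psi j j' * psi k k' : K) •
      symPair (fun l => v l j k) (fun l => w l j' k'),
    sigma a 1 • ∑ i, ∑ i', ∑ k, ∑ k', (psi i i' * psi k k' : K) •
      symPair (fun l => v i l k) (fun l => w i' l k'),
    sigma a 2 • ∑ i, ∑ i', ∑ j, ∑ j', (psi i i' * psi j j' : K) •
      symPair (fun l => v i j l) (fun l => w i' j' l)]

variable (a : K)

/-- `D(2,1;a)` as a product. -/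
def equivProd : D21 a ≃ (Fin 3 → Fin 3 → K) × (Fin 2 → Fin 2 → Fin 2 → K) where
  toFun x := (x.even, x.odd)
  invFun p := ⟨p.1, p.2⟩
  left_inv _ := rfl
  right_inv _ := rfl

instance : AddCommGroup (D21 a) := (equivProd a).addCommGroup
instance : Module K (D21 a) := (equivProd a).module K

@[simp] lemma add_even (x y : D21 a) : (x + y).even = x.even + y.even := rfl
@[simp] lemma add_odd (x y : D21 a) : (x + y).odd = x.odd + y.odd := rfl
@[simp] lemma sub_even (x y : D21 a) : (x - y).even = x.even - y.even := rfl
@[simp] lemma sub_odd (x y : D21 a) : (x - y).odd = x.odd - y.odd := rfl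
@[simp] lemma neg_even (x : D21 a) : (-x).even = -x.even := rfl
@[simp] lemma neg_odd (x : D21 a) : (-x).odd = -x.odd := rfl
@[simp] lemma smul_even (c : K) (x : D21 a) : (c • x).even = c • x.even := rfl
@[simp] lemma smul_odd (c : K) (x : D21 a) : (c • x).odd = c • x.odd := rfl
@[simp] lemma zero_even : (0 : D21 a).even = 0 := rfl
@[simp] lemma zero_odd : (0 : D21 a).odd = 0 := rfl

/-- The bracket of `D(2,1;a)`. -/
def bracketFun (x y : D21 a) : D21 a :=
  ⟨evenBracket x.even y.even + oddBracket a x.odd y.odd, oddAct x.even y.odd - oddAct y.even x.odd⟩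

lemma bracketFun_even (x y : D21 a) : (bracketFun a x y).even =
    evenBracket x.even y.even + oddBracket a x.odd y.odd := rfl
lemma bracketFun_odd (x y : D21 a) : (bracketFun a x y).odd =
    oddAct x.even y.odd - oddAct y.even x.odd := rfl

lemma funext3 {α : Type*} {f g : Fin 3 → α} (h0 : f 0 = g 0) (h1 : f 1 = g 1) (h2 : f 2 = g 2) :
    f = g := by
  funext i; fin_cases i <;> assumption

lemma funext2 {α : Type*} {f g : Fin 2 → α} (h0 : f 0 = g 0) (h1 : f 1 = g 1) : f = g := by
  funext i; fin_cases i <;> assumption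

lemma sl2Bracket_0 (A B : Fin 3 → K) : sl2Bracket A B 0 = 2 * (A 2 * B 0 - A 0 * B 2) := rfl
lemma sl2Bracket_1 (A B : Fin 3 → K) : sl2Bracket A B 1 = 2 * (A 1 * B 2 - A 2 * B 1) := rfl
lemma sl2Bracket_2 (A B : Fin 3 → K) : sl2Bracket A B 2 = A 0 * B 1 - A 1 * B 0 := rfl
lemma sl2Act_0 (A : Fin 3 → K) (x : Fin 2 → K) : sl2Act A x 0 = A 2 * x 0 + A 0 * x 1 := rfl
lemma sl2Act_1 (A : Fin 3 → K) (x : Fin 2 → K) : sl2Act A x 1 = A 1 * x 0 - A 2 * x 1 := rfl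
lemma symPair_0 (x y : Fin 2 → K) : symPair x y 0 = 2 * x 0 * y 0 := rfl
lemma symPair_1 (x y : Fin 2 → K) : symPair x y 1 = -2 * x 1 * y 1 := rfl
lemma symPair_2 (x y : Fin 2 → K) : symPair x y 2 = -(x 0 * y 1 + x 1 * y 0) := rfl

lemma oddBracket_0 (v w) (t : Fin 3) : oddBracket a v w 0 t = sigma a 0 *
    (symPair (v · 0 0) (w · 1 1) t - symPair (v · 0 1) (w · 1 0) t
    - symPair (v · 1 0) (w · 0 1) t + symPair (v · 1 1) (w · 0 0) t) := by
  simp [oddBracket, Fin.sum_univ_two, psi]; ring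
lemma oddBracket_1 (v w) (t : Fin 3) : oddBracket a v w 1 t = sigma a 1 *
    (symPair (v 0 · 0) (w 1 · 1) t - symPair (v 0 · 1) (w 1 · 0) t
    - symPair (v 1 · 0) (w 0 · 1) t + symPair (v 1 · 1) (w 0 · 0) t) := by
  simp [oddBracket, Fin.sum_univ_two, psi]; ring
lemma oddBracket_2 (v w) (t : Fin 3) : oddBracket a v w 2 t = sigma a 2 *
    (symPair (v 0 0 ·) (w 1 1 ·) t - symPair (v 0 1 ·) (w 1 0 ·) t
    - symPair (v 1 0 ·) (w 0 1 ·) t + symPair (v 1 1 ·) (w 0 0 ·) t) := by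
  simp [oddBracket, Fin.sum_univ_two, psi]; ring

lemma oddBracket_comm (v w) : oddBracket a v w = oddBracket a w v := by
  apply funext3 <;> apply funext3 <;>
    simp only [oddBracket_0, oddBracket_1, oddBracket_2, symPair_0, symPair_1, symPair_2,
      Pi.add_apply, Pi.sub_apply, Pi.neg_apply, Pi.smul_apply, Pi.zero_apply, smul_eq_mul] <;> ring
lemma oddBracket_add_left (v v' w) :
    oddBracket a (v + v') w = oddBracket a v w + oddBracket a v' w := by
  apply funext3 <;> apply funext3 <;>
    simp only [oddBracket_0, oddBracket_1, oddBracket_2, symPair_0, symPair_1, symPair_2,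
      Pi.add_apply, Pi.sub_apply, Pi.neg_apply, Pi.smul_apply, Pi.zero_apply, smul_eq_mul] <;> ring
lemma oddBracket_smul_left (c : K) (v w) :
    oddBracket a (c • v) w = c • oddBracket a v w := by
  apply funext3 <;> apply funext3 <;>
    simp only [oddBracket_0, oddBracket_1, oddBracket_2, symPair_0, symPair_1, symPair_2,
      Pi.add_apply, Pi.sub_apply, Pi.neg_apply, Pi.smul_apply, Pi.zero_apply, smul_eq_mul] <;> ring
lemma oddBracket_add_right (v v' w) :
    oddBracket a w (v + v') = oddBracket a w v + oddBracket a w v' := by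
  simp only [oddBracket_comm a w, oddBracket_add_left]
lemma oddBracket_smul_right (c : K) (v w) :
    oddBracket a w (c • v) = c • oddBracket a w v := by
  simp only [oddBracket_comm a w, oddBracket_smul_left]
lemma evenBracket_skew (A B : Fin 3 → Fin 3 → K) : evenBracket A B = -evenBracket B A := by
  apply funext3 <;> apply funext3 <;>
    simp only [evenBracket, sl2Bracket_0, sl2Bracket_1, sl2Bracket_2,
      Pi.add_apply, Pi.sub_apply, Pi.neg_apply, Pi.smul_apply, Pi.zero_apply, smul_eq_mul] <;> ring
lemma evenBracket_add_left (A A' B : Fin 3 → Fin 3 → K) :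
    evenBracket (A + A') B = evenBracket A B + evenBracket A' B := by
  apply funext3 <;> apply funext3 <;>
    simp only [evenBracket, sl2Bracket_0, sl2Bracket_1, sl2Bracket_2,
      Pi.add_apply, Pi.sub_apply, Pi.neg_apply, Pi.smul_apply, Pi.zero_apply, smul_eq_mul] <;> ring
lemma evenBracket_smul_left (c : K) (A B : Fin 3 → Fin 3 → K) :
    evenBracket (c • A) B = c • evenBracket A B := by
  apply funext3 <;> apply funext3 <;>
    simp only [evenBracket, sl2Bracket_0, sl2Bracket_1, sl2Bracket_2,
      Pi.add_apply, Pi.sub_apply, Pi.neg_apply, Pi.smul_apply, Pi.zero_apply, smul_eq_mul] <;> ring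
lemma evenBracket_add_right (A A' B : Fin 3 → Fin 3 → K) :
    evenBracket B (A + A') = evenBracket B A + evenBracket B A' := by
  rw [evenBracket_skew, evenBracket_add_left, evenBracket_skew B A, evenBracket_skew B A', neg_add]
lemma evenBracket_smul_right (c : K) (A B : Fin 3 → Fin 3 → K) :
    evenBracket B (c • A) = c • evenBracket B A := by
  rw [evenBracket_skew, evenBracket_smul_left, evenBracket_skew B A, smul_neg]
lemma oddAct_add_left (A B : Fin 3 → Fin 3 → K) (v) :
    oddAct (A + B) v = oddAct A v + oddAct B v := by
  apply funext2 <;> apply funext2 <;> apply funext2 <;>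
    simp only [oddAct, sl2Act_0, sl2Act_1,
      Pi.add_apply, Pi.sub_apply, Pi.neg_apply, Pi.smul_apply, Pi.zero_apply, smul_eq_mul] <;> ring
lemma oddAct_add_right (A : Fin 3 → Fin 3 → K) (v w) :
    oddAct A (v + w) = oddAct A v + oddAct A w := by
  apply funext2 <;> apply funext2 <;> apply funext2 <;>
    simp only [oddAct, sl2Act_0, sl2Act_1,
      Pi.add_apply, Pi.sub_apply, Pi.neg_apply, Pi.smul_apply, Pi.zero_apply, smul_eq_mul] <;> ring
lemma oddAct_smul_left (c : K) (A : Fin 3 → Fin 3 → K) (v) :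
    oddAct (c • A) v = c • oddAct A v := by
  apply funext2 <;> apply funext2 <;> apply funext2 <;>
    simp only [oddAct, sl2Act_0, sl2Act_1,
      Pi.add_apply, Pi.sub_apply, Pi.neg_apply, Pi.smul_apply, Pi.zero_apply, smul_eq_mul] <;> ring
lemma oddAct_smul_right (c : K) (A : Fin 3 → Fin 3 → K) (v) :
    oddAct A (c • v) = c • oddAct A v := by
  apply funext2 <;> apply funext2 <;> apply funext2 <;>
    simp only [oddAct, sl2Act_0, sl2Act_1,
      Pi.add_apply, Pi.sub_apply, Pi.neg_apply, Pi.smul_apply, Pi.zero_apply, smul_eq_mul] <;> ring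

lemma bracketFun_add_left (x y z : D21 a) :
    bracketFun a (x + y) z = bracketFun a x z + bracketFun a y z := by
  apply D21.ext
  · simp only [bracketFun_even, add_even, add_odd, evenBracket_add_left, oddBracket_add_left]; abel
  · simp only [bracketFun_odd, add_even, add_odd, oddAct_add_left, oddAct_add_right]; abel
lemma bracketFun_smul_left (c : K) (x z : D21 a) :
    bracketFun a (c • x) z = c • bracketFun a x z := by
  apply D21.ext
  · simp [bracketFun_even, evenBracket_smul_left, oddBracket_smul_left]
  · simp [bracketFun_odd, oddAct_smul_left, oddAct_smul_right, smul_sub]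
lemma bracketFun_add_right (x y z : D21 a) :
    bracketFun a z (x + y) = bracketFun a z x + bracketFun a z y := by
  apply D21.ext
  · simp only [bracketFun_even, add_even, add_odd, evenBracket_add_right, oddBracket_add_right]; abel
  · simp only [bracketFun_odd, add_even, add_odd, oddAct_add_left, oddAct_add_right]; abel
lemma bracketFun_smul_right (c : K) (x z : D21 a) :
    bracketFun a z (c • x) = c • bracketFun a z x := by
  apply D21.ext
  · simp [bracketFun_even, evenBracket_smul_right, oddBracket_smul_right]
  · simp [bracketFun_odd, oddAct_smul_left, oddAct_smul_right, smul_sub]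

/-- The bracket of `D(2,1;a)` as a bilinear map. -/
def bracket : D21 a →ₗ[K] D21 a →ₗ[K] D21 a :=
  LinearMap.mk₂ K (bracketFun a) (bracketFun_add_left a) (bracketFun_smul_left a)
    (fun x y z => bracketFun_add_right a y z x) (fun c x y => bracketFun_smul_right a c y x)

lemma bracket_even (x y : D21 a) : (bracket a x y).even =
    evenBracket x.even y.even + oddBracket a x.odd y.odd := rfl
lemma bracket_odd (x y : D21 a) : (bracket a x y).odd =
    oddAct x.even y.odd - oddAct y.even x.odd := rfl

lemma even_jacobi (A B C : Fin 3 → Fin 3 → K) : evenBracket A (evenBracket B C) +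
    evenBracket B (evenBracket C A) + evenBracket C (evenBracket A B) = 0 := by
  apply funext3 <;> apply funext3 <;>
    simp only [evenBracket, sl2Bracket_0, sl2Bracket_1, sl2Bracket_2,
      Pi.add_apply, Pi.sub_apply, Pi.neg_apply, Pi.smul_apply, Pi.zero_apply, smul_eq_mul] <;> ring
lemma oddAct_evenBracket (A B : Fin 3 → Fin 3 → K) (v) :
    oddAct (evenBracket A B) v = oddAct A (oddAct B v) - oddAct B (oddAct A v) := by
  apply funext2 <;> apply funext2 <;> apply funext2 <;>
    simp only [oddAct, sl2Act_0, sl2Act_1, evenBracket, sl2Bracket_0, sl2Bracket_1, sl2Bracket_2,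
      Pi.add_apply, Pi.sub_apply, Pi.neg_apply, Pi.smul_apply, Pi.zero_apply, smul_eq_mul] <;> ring
lemma evenBracket_oddBracket (A : Fin 3 → Fin 3 → K) (v w) :
    evenBracket A (oddBracket a v w) =
      oddBracket a (oddAct A v) w + oddBracket a v (oddAct A w) := by
  apply funext3 <;> apply funext3 <;>
    simp only [oddAct, sl2Act_0, sl2Act_1, evenBracket, sl2Bracket_0, sl2Bracket_1, sl2Bracket_2,
      oddBracket_0, oddBracket_1, oddBracket_2, symPair_0, symPair_1, symPair_2,
      Pi.add_apply, Pi.sub_apply, Pi.neg_apply, Pi.smul_apply, Pi.zero_apply, smul_eq_mul] <;> ring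
lemma odd_jacobi (u v w) : oddAct (oddBracket a u v) w +
    oddAct (oddBracket a v w) u + oddAct (oddBracket a w u) v = 0 := by
  have hs : sigma a 0 = -(sigma a 1 + sigma a 2) := by simp [sigma]; ring
  apply funext2 <;> apply funext2 <;> apply funext2 <;>
    simp only [oddAct, sl2Act_0, sl2Act_1, hs,
      oddBracket_0, oddBracket_1, oddBracket_2, symPair_0, symPair_1, symPair_2,
      Pi.add_apply, Pi.sub_apply, Pi.neg_apply, Pi.smul_apply, Pi.zero_apply, smul_eq_mul] <;> ring

lemma evenBracket_zero_right (A : Fin 3 → Fin 3 → K) : evenBracket A 0 = 0 := by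
  simpa using evenBracket_smul_right 0 0 A
lemma evenBracket_zero_left (A : Fin 3 → Fin 3 → K) : evenBracket 0 A = 0 := by
  simpa using evenBracket_smul_left 0 0 A
lemma oddBracket_zero_right (v) : oddBracket a v 0 = 0 := by
  simpa using oddBracket_smul_right a 0 0 v
lemma oddBracket_zero_left (v) : oddBracket a 0 v = 0 := by
  simpa using oddBracket_smul_left a 0 0 v
lemma oddAct_zero_right (A : Fin 3 → Fin 3 → K) : oddAct A 0 = 0 := by
  simpa using oddAct_smul_right 0 A 0
lemma oddAct_zero_left (v : Fin 2 → Fin 2 → Fin 2 → K) : oddAct 0 v = 0 := by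
  simpa using oddAct_smul_left 0 0 v
lemma oddAct_neg_right (A : Fin 3 → Fin 3 → K) (v) : oddAct A (-v) = -oddAct A v := by
  simpa using oddAct_smul_right (-1) A v
lemma oddBracket_neg_right (v w) : oddBracket a v (-w) = -oddBracket a v w := by
  simpa using oddBracket_smul_right a (-1) w v

/-- The even and the odd part of `D(2,1;a)`. -/
def part (i : ZMod 2) : Submodule K (D21 a) where
  carrier := {x | if i = 0 then x.odd = 0 else x.even = 0}
  add_mem' {x y} hx hy := by
    by_cases h : i = 0 <;> simp_all
  zero_mem' := by by_cases h : i = 0 <;> simp_all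
  smul_mem' c x hx := by
    by_cases h : i = 0 <;> simp_all

lemma mem_part_zero (x : D21 a) : x ∈ part a 0 ↔ x.odd = 0 := Iff.rfl
lemma mem_part_one (x : D21 a) : x ∈ part a 1 ↔ x.even = 0 := Iff.rfl

lemma parity_cases (i : ZMod 2) : i = 0 ∨ i = 1 := by
  fin_cases i
  · exact Or.inl rfl
  · exact Or.inr rfl

lemma bracket_mem {i j : ZMod 2} {x y : D21 a} (hx : x ∈ part a i) (hy : y ∈ part a j) :
    bracket a x y ∈ part a (i + j) := by
  have h11 : (1 + 1 : ZMod 2) = 0 := rfl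
  rcases parity_cases i with rfl | rfl <;> rcases parity_cases j with rfl | rfl <;>
    simp only [h11, zero_add, add_zero, mem_part_zero, mem_part_one, bracket_even,
      bracket_odd] at * <;>
    simp [hx, hy, oddAct_zero_right, oddAct_zero_left, oddBracket_zero_right,
      oddBracket_zero_left, evenBracket_zero_right, evenBracket_zero_left]

lemma bracket_skew {i j : ZMod 2} {x y : D21 a} (hx : x ∈ part a i) (hy : y ∈ part a j) :
    bracket a x y + (-1 : K) ^ (i.val * j.val) • bracket a y x = 0 := by
  have h1 : (1 : ZMod 2).val = 1 := rfl
  rcases parity_cases i with rfl | rfl <;> rcases parity_cases j with rfl | rfl <;>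
    simp only [mem_part_zero, mem_part_one] at * <;>
    apply D21.ext <;>
    simp [bracket_even, bracket_odd, hx, hy, h1, oddAct_zero_right, oddAct_zero_left,
      oddBracket_zero_right, oddBracket_zero_left, evenBracket_zero_right, evenBracket_zero_left]
  · simp [evenBracket_skew x.even y.even]
  · simp [oddBracket_comm a x.odd y.odd]

lemma bracket_jacobi {i j k : ZMod 2} {x y z : D21 a} (hx : x ∈ part a i) (hy : y ∈ part a j)
    (hz : z ∈ part a k) :
    (-1 : K) ^ (i.val * k.val) • bracket a x (bracket a y z) +
    (-1 : K) ^ (j.val * i.val) • bracket a y (bracket a z x) +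
    (-1 : K) ^ (k.val * j.val) • bracket a z (bracket a x y) = 0 := by
  have h1 : (1 : ZMod 2).val = 1 := rfl
  have he := even_jacobi x.even y.even z.even
  have ho := odd_jacobi a x.odd y.odd z.odd
  rcases parity_cases i with rfl | rfl <;> rcases parity_cases j with rfl | rfl <;>
    rcases parity_cases k with rfl | rfl <;>
    simp only [mem_part_zero, mem_part_one] at * <;>
    apply D21.ext <;>
    simp only [bracket_even, bracket_odd, hx, hy, hz, h1, oddAct_zero_right, oddAct_zero_left,
      oddBracket_zero_right, oddBracket_zero_left, evenBracket_zero_right, evenBracket_zero_left,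
      oddAct_neg_right, oddBracket_neg_right, evenBracket_oddBracket, oddAct_evenBracket,
      add_zero, zero_add, sub_zero, zero_sub, mul_zero, zero_mul, mul_one, pow_zero, pow_one,
      one_smul, neg_smul, ZMod.val_zero, add_even, add_odd, smul_even, smul_odd, zero_even,
      zero_odd, neg_even, neg_odd, smul_zero, neg_zero, he]
  · abel
  · abel
  · rw [oddBracket_comm a z.odd]; abel
  · abel
  · rw [oddBracket_comm a x.odd, oddBracket_comm a z.odd (oddAct _ _)]; abel
  · rw [oddBracket_comm a y.odd (oddAct _ _)]; abel
  · rw [← ho]; abel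

instance : LieSuperalgebra K (D21 a) where
  part := part a
  isCompl := by
    constructor
    · rw [Submodule.disjoint_def]
      intro x hx hy
      exact D21.ext hy hx
    · rw [codisjoint_iff, eq_top_iff]
      intro x _
      exact Submodule.mem_sup.2 ⟨⟨x.even, 0⟩, rfl, ⟨0, x.odd⟩, rfl,
        D21.ext (by simp) (by simp)⟩
  bracket := bracket a
  bracket_mem := bracket_mem a
  skew := bracket_skew a
  jacobi := bracket_jacobi a

/-- The element `E`, `F` or `H` (for `t = 0, 1, 2`) of the copy of `sl₂` with number `s`. -/
def evenVec (s t : Fin 3) : D21 a := ⟨Pi.single s (Pi.single t 1), 0⟩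

/-- The element `x_p ⊗ x_q ⊗ x_r` of the odd part. -/
def oddVec (p q r : Fin 2) : D21 a := ⟨0, Pi.single p (Pi.single q (Pi.single r 1))⟩

/-- The Chevalley generators `e₁, e₂, e₃` (with indices `0, 1, 2`). -/
def genE : Fin 3 → D21 a := ![oddVec a 0 1 1, evenVec a 1 0, evenVec a 2 0]

/-- The Chevalley generators `f₁, f₂, f₃`. -/
def genF : Fin 3 → D21 a := ![oddVec a 1 0 0, evenVec a 1 1, evenVec a 2 1]

/-- The Cartan generators `h₁ = [e₁, f₁]`, `h₂ = [e₂, f₂]`, `h₃ = [e₃, f₃]`. -/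
def genH (i : Fin 3) : D21 a := bracket a (genE a i) (genF a i)

/-- The Cartan matrix of `D(2,1;a)`. -/
def cartanMatrix : Matrix (Fin 3) (Fin 3) K := !![0, 1, a; -1, 2, 0; -1, 0, 2]

/-- The Cartan subalgebra `𝔥`; it is the span of `h₁, h₂, h₃` by `cartan_eq_span_genH`. -/
def cartan : Submodule K (D21 a) := Submodule.span K (Set.range fun s => evenVec a s 2)

/-- The element `H` of the copy of `sl₂` with number `s`, as an element of `𝔥`. -/
def cartanVec (s : Fin 3) : cartan a := ⟨evenVec a s 2, Submodule.subset_span ⟨s, rfl⟩⟩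

/-- The basis `ε₁, ε₂, ε₃` of `𝔥*`, dual to `cartanVec`. -/
def eps (s : Fin 3) : Module.Dual K (cartan a) where
  toFun x := (x : D21 a).even s 2
  map_add' _ _ := rfl
  map_smul' _ _ := rfl

/-- The set `Δ₀` of even roots. -/
def evenRoots : Set (Module.Dual K (cartan a)) :=
  {α | α ≠ 0 ∧ ∃ x ∈ part a 0, x ≠ 0 ∧ ∀ h : cartan a, bracket a h x = α h • x}

/-- The set `Δ₁` of odd roots. -/
def oddRoots : Set (Module.Dual K (cartan a)) :=
  {α | ∃ x ∈ part a 1, x ≠ 0 ∧ ∀ h : cartan a, bracket a h x = α h • x}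

/-- The set `Δ` of roots. -/
def roots : Set (Module.Dual K (cartan a)) := evenRoots a ∪ oddRoots a

/-- The set `Δ⁺` of positive roots. -/
def posRoots : Set (Module.Dual K (cartan a)) :=
  {2 • eps a 0, 2 • eps a 1, 2 • eps a 2,
    eps a 0 - eps a 1 - eps a 2, eps a 0 + eps a 1 - eps a 2,
    eps a 0 - eps a 1 + eps a 2, eps a 0 + eps a 1 + eps a 2}

/-- The bilinear form on `𝔥*`: the `ε`s are orthogonal, `(ε₁, ε₁) = -(1 + a) / 2`,
`(ε₂, ε₂) = 1 / 2`, `(ε₃, ε₃) = a / 2`. -/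
def form (α β : Module.Dual K (cartan a)) : K :=
  ∑ s, sigma a s * α (cartanVec a s) * β (cartanVec a s)

/-- The element of `𝔥` that represents `α` with respect to `form`. -/
def dualVec (α : Module.Dual K (cartan a)) : cartan a :=
  ∑ s, (sigma a s * α (cartanVec a s)) • cartanVec a s

open Classical in
/-- The coroot `H_α`: the multiple of `dualVec α` that is normalized by `α(H_α) = 2` when
`(α, α) ≠ 0`, and `H_α = -dualVec α` for isotropic `α` (so that `H_{α₁} = h₁`). -/
def coroot (α : Module.Dual K (cartan a)) : cartan a :=
  if form a α α = 0 then -dualVec a α else (2 / form a α α) • dualVec a α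

open Classical in
/-- The sign `σ_α`: it is `-1` if `α` is an odd negative root and `1` otherwise. -/
def rootSign (α : Module.Dual K (cartan a)) : K :=
  if α ∈ oddRoots a ∧ -α ∈ posRoots a then -1 else 1

/-! ### Checks: the generators, the roots and the coroots are the standard ones -/

lemma oddVec_apply (p q r i j k : Fin 2) :
    (oddVec a p q r).odd i j k = if i = p ∧ j = q ∧ k = r then 1 else 0 := by
  by_cases hi : i = p <;> by_cases hj : j = q <;> by_cases hk : k = r <;>
    simp [oddVec, hi, hj, hk]
lemma evenVec_apply (s t i j : Fin 3) :
    (evenVec a s t).even i j = if i = s ∧ j = t then 1 else 0 := by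
  by_cases hi : i = s <;> by_cases hj : j = t <;> simp [evenVec, hi, hj]

lemma genH_zero [NeZero (2 : K)] : genH a 0 = (2⁻¹ : K) •
    ((1 + a) • evenVec a 0 2 + evenVec a 1 2 + a • evenVec a 2 2) := by
  apply D21.ext
  · apply funext3 <;> apply funext3 <;>
      simp [genH, genE, genF, bracket_even, evenBracket, sl2Bracket_0, sl2Bracket_1, sl2Bracket_2,
        oddBracket_0, oddBracket_1, oddBracket_2, symPair_0, symPair_1, symPair_2, oddVec_apply,
        evenVec_apply, sigma] <;> simp [oddVec] <;> ring
  · simp [genH, genE, genF, bracket_odd, oddVec, evenVec, oddAct_zero_left]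
lemma genH_one : genH a 1 = evenVec a 1 2 := by
  apply D21.ext
  · apply funext3 <;> apply funext3 <;>
      simp [genH, genE, genF, bracket_even, evenBracket, sl2Bracket_0, sl2Bracket_1, sl2Bracket_2,
        evenVec_apply] <;> simp [evenVec, oddBracket_zero_left]
  · simp [genH, genE, genF, bracket_odd, oddVec, evenVec, oddAct_zero_right]
lemma genH_two : genH a 2 = evenVec a 2 2 := by
  apply D21.ext
  · apply funext3 <;> apply funext3 <;>
      simp [genH, genE, genF, bracket_even, evenBracket, sl2Bracket_0, sl2Bracket_1, sl2Bracket_2,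
        evenVec_apply] <;> simp [evenVec, oddBracket_zero_left]
  · simp [genH, genE, genF, bracket_odd, oddVec, evenVec, oddAct_zero_right]

lemma mem_cartan_iff (x : D21 a) : x ∈ cartan a ↔
    x.odd = 0 ∧ ∀ s, x.even s 0 = 0 ∧ x.even s 1 = 0 := by
  constructor
  · intro hx
    induction hx using Submodule.span_induction with
    | mem x h =>
      obtain ⟨s, rfl⟩ := h
      exact ⟨rfl, fun t => by simp [evenVec_apply]⟩
    | zero => simp
    | add x y _ _ hx hy => simp_all
    | smul c x _ hx => simp_all
  · rintro ⟨h0, h1⟩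
    have : x = ∑ s, x.even s 2 • evenVec a s 2 := by
      apply D21.ext
      · apply funext3 <;> apply funext3 <;> simp [Fin.sum_univ_three, evenVec_apply, h1]
      · simp [Fin.sum_univ_three, evenVec, h0]
    rw [this]
    exact Submodule.sum_mem _ fun s _ => Submodule.smul_mem _ _ (Submodule.subset_span ⟨s, rfl⟩)

lemma fin3_cases (i : Fin 3) : i = 0 ∨ i = 1 ∨ i = 2 := by
  fin_cases i <;> simp
lemma fin2_cases (i : Fin 2) : i = 0 ∨ i = 1 := by
  fin_cases i <;> simp

lemma bracket_cartan_even {h : D21 a} (hh : h ∈ cartan a) (x : D21 a) (s t : Fin 3) :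
    (bracket a h x).even s t = ![2, -2, 0] t * h.even s 2 * x.even s t := by
  obtain ⟨h0, h1⟩ := (mem_cartan_iff a h).1 hh
  rcases fin3_cases t with rfl | rfl | rfl <;>
    simp [bracket_even, h0, oddBracket_zero_left, evenBracket, sl2Bracket_0, sl2Bracket_1,
      sl2Bracket_2, h1] <;> ring

lemma bracket_cartan_odd {h : D21 a} (hh : h ∈ cartan a) (x : D21 a) (i j k : Fin 2) :
    (bracket a h x).odd i j k = (![1, -1] i * h.even 0 2 + ![1, -1] j * h.even 1 2 +
      ![1, -1] k * h.even 2 2) * x.odd i j k := by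
  obtain ⟨h0, h1⟩ := (mem_cartan_iff a h).1 hh
  rcases fin2_cases i with rfl | rfl <;> rcases fin2_cases j with rfl | rfl <;>
    rcases fin2_cases k with rfl | rfl <;>
    simp [bracket_odd, h0, oddAct_zero_right, oddAct, sl2Act_0, sl2Act_1, h1] <;> ring

lemma genH_mem [NeZero (2 : K)] (i : Fin 3) : genH a i ∈ cartan a := by
  have m (s : Fin 3) : evenVec a s 2 ∈ cartan a := Submodule.subset_span ⟨s, rfl⟩
  rcases fin3_cases i with rfl | rfl | rfl
  · rw [genH_zero]
    exact Submodule.smul_mem _ _ (Submodule.add_mem _ (Submodule.add_mem _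
      (Submodule.smul_mem _ _ (m 0)) (m 1)) (Submodule.smul_mem _ _ (m 2)))
  · exact genH_one a ▸ m 1
  · exact genH_two a ▸ m 2

lemma genH_apply [NeZero (2 : K)] (i s : Fin 3) : (genH a i).even s 2 =
    ![![(1 + a) / 2, 1 / 2, a / 2], ![0, 1, 0], ![0, 0, 1]] i s := by
  rcases fin3_cases i with rfl | rfl | rfl <;> rcases fin3_cases s with rfl | rfl | rfl <;>
    simp [genH_zero, genH_one, genH_two, evenVec_apply] <;> ring

lemma bracket_cartan_cartan {h h' : D21 a} (hh : h ∈ cartan a) (hh' : h' ∈ cartan a) :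
    bracket a h h' = 0 := by
  obtain ⟨h0, h1⟩ := (mem_cartan_iff a h').1 hh'
  apply D21.ext
  · funext s t
    rw [bracket_cartan_even a hh]
    rcases fin3_cases t with rfl | rfl | rfl <;> simp [h1]
  · funext i j k
    rw [bracket_cartan_odd a hh]
    simp [h0]

lemma bracket_cartan_evenVec {h : D21 a} (hh : h ∈ cartan a) (s t : Fin 3) :
    bracket a h (evenVec a s t) = (![2, -2, 0] t * h.even s 2) • evenVec a s t := by
  apply D21.ext
  · funext s' t'
    rw [bracket_cartan_even a hh]
    by_cases hs : s' = s <;> by_cases ht : t' = t <;> simp [evenVec_apply, hs, ht]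
  · funext i j k
    rw [bracket_cartan_odd a hh]
    simp [evenVec]

lemma bracket_cartan_oddVec {h : D21 a} (hh : h ∈ cartan a) (p q r : Fin 2) :
    bracket a h (oddVec a p q r) = (![1, -1] p * h.even 0 2 + ![1, -1] q * h.even 1 2 +
      ![1, -1] r * h.even 2 2 : K) • oddVec a p q r := by
  apply D21.ext
  · funext s' t'
    rw [bracket_cartan_even a hh]
    simp [oddVec]
  · funext i j k
    rw [bracket_cartan_odd a hh]
    by_cases hp : i = p <;> by_cases hq : j = q <;> by_cases hr : k = r <;>
      simp [oddVec_apply, hp, hq, hr]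

/-- The generators satisfy the relations of the contragredient Lie superalgebra with the given
Cartan matrix. -/
theorem contragredient_relations [NeZero (2 : K)] :
    (∀ i, genH a i ∈ part a 0) ∧ genE a 0 ∈ part a 1 ∧ genE a 1 ∈ part a 0 ∧ genE a 2 ∈ part a 0 ∧
    genF a 0 ∈ part a 1 ∧ genF a 1 ∈ part a 0 ∧ genF a 2 ∈ part a 0 ∧
    (∀ i j, bracket a (genH a i) (genH a j) = 0) ∧
    bracket a (genE a 0) (genE a 0) = 0 ∧ bracket a (genF a 0) (genF a 0) = 0 ∧
    (∀ i j, bracket a (genH a i) (genE a j) = cartanMatrix a i j • genE a j) ∧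
    (∀ i j, bracket a (genH a i) (genF a j) = -cartanMatrix a i j • genF a j) ∧
    (∀ i j, bracket a (genE a i) (genF a j) = if i = j then genH a i else 0) := by
  have h2 : (2 : K) ≠ 0 := NeZero.ne 2
  refine ⟨fun i => ((mem_cartan_iff a _).1 (genH_mem a i)).1, rfl, rfl, rfl, rfl, rfl, rfl,
    fun i j => bracket_cartan_cartan a (genH_mem a i) (genH_mem a j), ?_, ?_, ?_, ?_, ?_⟩
  · apply D21.ext
    · apply funext3 <;> apply funext3 <;> simp [genE, bracket_even, evenBracket, sl2Bracket,
        oddBracket_0, oddBracket_1, oddBracket_2, symPair_0, symPair_1, symPair_2, oddVec]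
    · simp [bracket_odd]
  · apply D21.ext
    · apply funext3 <;> apply funext3 <;> simp [genF, bracket_even, evenBracket, sl2Bracket,
        oddBracket_0, oddBracket_1, oddBracket_2, symPair_0, symPair_1, symPair_2, oddVec]
    · simp [bracket_odd]
  · intro i j
    rcases fin3_cases j with rfl | rfl | rfl <;>
      simp only [genE, Matrix.cons_val, bracket_cartan_evenVec a (genH_mem a i),
        bracket_cartan_oddVec a (genH_mem a i), genH_apply] <;>
      rcases fin3_cases i with rfl | rfl | rfl <;> congr 1 <;> simp [cartanMatrix] <;>
      field_simp <;> ring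
  · intro i j
    rcases fin3_cases j with rfl | rfl | rfl <;>
      simp only [genF, Matrix.cons_val, bracket_cartan_evenVec a (genH_mem a i),
        bracket_cartan_oddVec a (genH_mem a i), genH_apply] <;>
      rcases fin3_cases i with rfl | rfl | rfl <;> congr 1 <;> simp [cartanMatrix] <;>
      field_simp <;> ring
  · intro i j
    by_cases hij : i = j
    · subst hij; simp [genH]
    · rw [if_neg hij]
      revert hij
      rcases fin3_cases i with rfl | rfl | rfl <;> rcases fin3_cases j with rfl | rfl | rfl <;>
        intro hij <;> first
        | exact absurd rfl hij
        | apply D21.ext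
          · apply funext3 <;> apply funext3 <;> simp [genE, genF, bracket_even, evenBracket,
              sl2Bracket, oddVec, evenVec, oddBracket_zero_left, oddBracket_zero_right]
          · apply funext2 <;> apply funext2 <;> apply funext2 <;> simp [genE, genF, bracket_odd,
              oddAct, sl2Act, oddVec, evenVec]

theorem cartan_eq_span_genH [NeZero (2 : K)] (ha : a ≠ -1) :
    cartan a = Submodule.span K (Set.range (genH a)) := by
  have h2 : (2 : K) ≠ 0 := NeZero.ne 2
  have ha' : 1 + a ≠ 0 := fun h => ha (by linear_combination h)
  apply le_antisymm
  · rw [cartan, Submodule.span_le]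
    have m (i : Fin 3) : genH a i ∈ Submodule.span K (Set.range (genH a)) :=
      Submodule.subset_span ⟨i, rfl⟩
    rintro _ ⟨s, rfl⟩
    rcases fin3_cases s with rfl | rfl | rfl
    · have : evenVec a 0 2 = (1 + a)⁻¹ • ((2 : K) • genH a 0 - genH a 1 - a • genH a 2) := by
        rw [genH_zero, genH_one, genH_two, smul_smul, mul_inv_cancel₀ h2, one_smul]
        have : (1 + a) • evenVec a 0 2 + evenVec a 1 2 + a • evenVec a 2 2 - evenVec a 1 2 -
          a • evenVec a 2 2 = (1 + a) • evenVec a 0 2 := by abel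
        rw [this, smul_smul, inv_mul_cancel₀ ha', one_smul]
      simp only [SetLike.mem_coe, this]
      exact Submodule.smul_mem _ _ (Submodule.sub_mem _ (Submodule.sub_mem _
        (Submodule.smul_mem _ _ (m 0)) (m 1)) (Submodule.smul_mem _ _ (m 2)))
    · simpa only [SetLike.mem_coe, ← genH_one] using m 1
    · simpa only [SetLike.mem_coe, ← genH_two] using m 2
  · rw [Submodule.span_le]
    rintro _ ⟨s, rfl⟩
    exact genH_mem a s

lemma bracket_evenVec (s t : Fin 3) (x : D21 a) : bracket a (evenVec a s t) x =
    ⟨evenBracket (evenVec a s t).even x.even, oddAct (evenVec a s t).even x.odd⟩ := by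
  apply D21.ext
  · simp [bracket_even, evenVec, oddBracket_zero_left]
  · simp [bracket_odd, evenVec, oddAct_zero_right]

lemma eq_sum (x : D21 a) : x = ∑ s, ∑ t, x.even s t • evenVec a s t +
    ∑ i, ∑ j, ∑ k, x.odd i j k • oddVec a i j k := by
  apply D21.ext
  · apply funext3 <;> apply funext3 <;>
      simp [Fin.sum_univ_three, Fin.sum_univ_two, evenVec, oddVec]
  · apply funext2 <;> apply funext2 <;> apply funext2 <;>
      simp [Fin.sum_univ_three, Fin.sum_univ_two, evenVec, oddVec]

lemma bracket_E_even (s : Fin 3) (x : D21 a) : (bracket a (evenVec a s 0) x).even =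
    Pi.single s ![-2 * x.even s 2, 0, x.even s 1] := by
  rw [bracket_evenVec]
  funext s'
  by_cases h : s' = s
  · subst h
    apply funext3 <;> simp [evenBracket, sl2Bracket_0, sl2Bracket_1, sl2Bracket_2, evenVec]
  · apply funext3 <;> simp [evenBracket, sl2Bracket_0, sl2Bracket_1, sl2Bracket_2, evenVec, h]
lemma bracket_F_even (s : Fin 3) (x : D21 a) : (bracket a (evenVec a s 1) x).even =
    Pi.single s ![0, 2 * x.even s 2, -x.even s 0] := by
  rw [bracket_evenVec]
  funext s'
  by_cases h : s' = s
  · subst h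
    apply funext3 <;> simp [evenBracket, sl2Bracket_0, sl2Bracket_1, sl2Bracket_2, evenVec]
  · apply funext3 <;> simp [evenBracket, sl2Bracket_0, sl2Bracket_1, sl2Bracket_2, evenVec, h]
lemma sl2Act_zero (x : Fin 2 → K) : sl2Act 0 x = 0 := by
  apply funext2 <;> simp [sl2Act]
lemma oddAct_sq (s : Fin 3) (A : Fin 3 → K) (hA : ∀ x, sl2Act A (sl2Act A x) = 0) (v) :
    oddAct (Pi.single s A) (oddAct (Pi.single s A) v) = 0 := by
  funext i j k
  rcases fin3_cases s with rfl | rfl | rfl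
  · simpa [oddAct, sl2Act_zero] using congrFun (hA fun l => v l j k) i
  · simpa [oddAct, sl2Act_zero] using congrFun (hA fun l => v i l k) j
  · simpa [oddAct, sl2Act_zero] using congrFun (hA fun l => v i j l) k
lemma bracket_evenVec_sq_odd (s u : Fin 3) (hu : u = 0 ∨ u = 1) (x : D21 a) :
    (bracket a (evenVec a s u) (bracket a (evenVec a s u) x)).odd = 0 := by
  simp only [bracket_evenVec]
  refine oddAct_sq s _ (fun y => ?_) _
  rcases hu with rfl | rfl <;> apply funext2 <;> simp [sl2Act]
lemma bracket_E_F (s : Fin 3) : bracket a (evenVec a s 0) (evenVec a s 1) = evenVec a s 2 := by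
  apply D21.ext
  · rw [bracket_E_even]
    simp only [evenVec]
    congr 1
    apply funext3 <;> simp
  · simp [bracket_odd, evenVec, oddAct_zero_right]
lemma bracket_F_E (s : Fin 3) : bracket a (evenVec a s 1) (evenVec a s 0) = -evenVec a s 2 := by
  have := bracket_skew a (x := evenVec a s 0) (y := evenVec a s 1) (i := 0) (j := 0) rfl rfl
  rw [bracket_E_F] at this
  simpa using eq_neg_of_add_eq_zero_right (by simpa using this)

/-- The generators generate `D(2,1;a)` as a Lie superalgebra. -/
theorem generators_generate [NeZero (2 : K)] (ha : a ≠ -1) (S : Submodule K (D21 a))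
    (hS : ∀ x ∈ S, ∀ y ∈ S, bracket a x y ∈ S) (hE : ∀ i, genE a i ∈ S) (hF : ∀ i, genF a i ∈ S) :
    S = ⊤ := by
  have h2 : (2 : K) ≠ 0 := NeZero.ne 2
  have ha' : 1 + a ≠ 0 := fun h => ha (by linear_combination h)
  have E1 : evenVec a 1 0 ∈ S := hE 1
  have E2 : evenVec a 2 0 ∈ S := hE 2
  have F1 : evenVec a 1 1 ∈ S := hF 1
  have F2 : evenVec a 2 1 ∈ S := hF 2
  have o011 : oddVec a 0 1 1 ∈ S := hE 0
  have o100 : oddVec a 1 0 0 ∈ S := hF 0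
  have act {s t : Fin 3} {p q r p' q' r' : Fin 2} (h : evenVec a s t ∈ S)
      (h' : oddVec a p q r ∈ S) (e : oddAct (evenVec a s t).even (oddVec a p q r).odd =
        (oddVec a p' q' r').odd) : oddVec a p' q' r' ∈ S := by
    have : bracket a (evenVec a s t) (oddVec a p q r) = oddVec a p' q' r' := by
      apply D21.ext
      · simp [bracket_even, evenVec, oddVec, oddBracket_zero_left, evenBracket_zero_right]
      · rw [bracket_odd, e]; simp [evenVec, oddVec, oddAct_zero_left]
    exact this ▸ hS _ h _ h'
  have o001 : oddVec a 0 0 1 ∈ S := act E1 o011 (by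
    apply funext2 <;> apply funext2 <;> apply funext2 <;> simp [oddAct, sl2Act, evenVec, oddVec])
  have o010 : oddVec a 0 1 0 ∈ S := act E2 o011 (by
    apply funext2 <;> apply funext2 <;> apply funext2 <;> simp [oddAct, sl2Act, evenVec, oddVec])
  have o000 : oddVec a 0 0 0 ∈ S := act E2 o001 (by
    apply funext2 <;> apply funext2 <;> apply funext2 <;> simp [oddAct, sl2Act, evenVec, oddVec])
  have o110 : oddVec a 1 1 0 ∈ S := act F1 o100 (by
    apply funext2 <;> apply funext2 <;> apply funext2 <;> simp [oddAct, sl2Act, evenVec, oddVec])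
  have o101 : oddVec a 1 0 1 ∈ S := act F2 o100 (by
    apply funext2 <;> apply funext2 <;> apply funext2 <;> simp [oddAct, sl2Act, evenVec, oddVec])
  have o111 : oddVec a 1 1 1 ∈ S := act F2 o110 (by
    apply funext2 <;> apply funext2 <;> apply funext2 <;> simp [oddAct, sl2Act, evenVec, oddVec])
  have E0 : evenVec a 0 0 ∈ S := by
    have : bracket a (oddVec a 0 0 0) (oddVec a 0 1 1) = (-(1 + a)) • evenVec a 0 0 := by
      apply D21.ext
      · apply funext3 <;> apply funext3 <;> simp [bracket_even, evenBracket, sl2Bracket,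
          oddBracket_0, oddBracket_1, oddBracket_2, symPair, oddVec, evenVec, sigma]
        field_simp
      · simp [bracket_odd, oddVec, evenVec, oddAct_zero_left]
    have h := hS _ o000 _ o011
    rw [this] at h
    exact (Submodule.smul_mem_iff _ (neg_ne_zero.2 ha')).1 h
  have F0 : evenVec a 0 1 ∈ S := by
    have : bracket a (oddVec a 1 0 0) (oddVec a 1 1 1) = (1 + a) • evenVec a 0 1 := by
      apply D21.ext
      · apply funext3 <;> apply funext3 <;> simp [bracket_even, evenBracket, sl2Bracket,
          oddBracket_0, oddBracket_1, oddBracket_2, symPair, oddVec, evenVec, sigma]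
        field_simp; ring
      · simp [bracket_odd, oddVec, evenVec, oddAct_zero_left]
    have h := hS _ o100 _ o111
    rw [this] at h
    exact (Submodule.smul_mem_iff _ ha').1 h
  have HH {s : Fin 3} (h : evenVec a s 0 ∈ S) (h' : evenVec a s 1 ∈ S) : evenVec a s 2 ∈ S := by
    rw [← bracket_E_F]; exact hS _ h _ h'
  have H0 := HH E0 F0
  have H1 := HH E1 F1
  have H2 := HH E2 F2
  rw [eq_top_iff]
  intro x _
  rw [eq_sum a x]
  refine Submodule.add_mem _ (Submodule.sum_mem _ fun s _ => Submodule.sum_mem _ fun t _ =>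
    Submodule.smul_mem _ _ ?_) (Submodule.sum_mem _ fun i _ => Submodule.sum_mem _ fun j _ =>
    Submodule.sum_mem _ fun k _ => Submodule.smul_mem _ _ ?_)
  · rcases fin3_cases s with rfl | rfl | rfl <;> rcases fin3_cases t with rfl | rfl | rfl <;>
      assumption
  · rcases fin2_cases i with rfl | rfl <;> rcases fin2_cases j with rfl | rfl <;>
      rcases fin2_cases k with rfl | rfl <;> assumption

/-- `D(2,1;a)` has no non-zero ideal that meets `𝔥` trivially. -/
theorem ideal_eq_bot [NeZero (2 : K)] (I : Submodule K (D21 a))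
    (hI : ∀ x, ∀ y ∈ I, bracket a x y ∈ I) (h : I ⊓ cartan a = ⊥) : I = ⊥ := by
  have h2 : (2 : K) ≠ 0 := NeZero.ne 2
  have hc {x : D21 a} (hx : x ∈ I) (hx' : x ∈ cartan a) : x = 0 := by
    have : x ∈ I ⊓ cartan a := ⟨hx, hx'⟩
    rwa [h, Submodule.mem_bot] at this
  have m (s : Fin 3) : evenVec a s 2 ∈ cartan a := Submodule.subset_span ⟨s, rfl⟩
  have key0 (s : Fin 3) (x : D21 a) (hx : x ∈ I) : x.even s 0 = 0 := by
    have h1 := hI (evenVec a s 1) _ (hI (evenVec a s 1) x hx)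
    have e : bracket a (evenVec a s 1) (bracket a (evenVec a s 1) x) =
        (-2 * x.even s 0) • evenVec a s 1 := by
      apply D21.ext
      · rw [bracket_F_even, bracket_F_even, smul_even, evenVec, ← Pi.single_smul]
        congr 1
        apply funext3 <;> simp
      · rw [bracket_evenVec_sq_odd a s 1 (Or.inr rfl)]; simp [evenVec]
    have h3 := hI (evenVec a s 0) _ h1
    rw [e, map_smul, bracket_E_F] at h3
    have := congrFun (congrFun (congrArg D21.even
      (hc h3 (Submodule.smul_mem _ _ (m s)))) s) 2
    simpa [evenVec_apply, h2] using this
  have key1 (s : Fin 3) (x : D21 a) (hx : x ∈ I) : x.even s 1 = 0 := by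
    have h1 := hI (evenVec a s 0) _ (hI (evenVec a s 0) x hx)
    have e : bracket a (evenVec a s 0) (bracket a (evenVec a s 0) x) =
        (-2 * x.even s 1) • evenVec a s 0 := by
      apply D21.ext
      · rw [bracket_E_even, bracket_E_even, smul_even, evenVec, ← Pi.single_smul]
        congr 1
        apply funext3 <;> simp
      · rw [bracket_evenVec_sq_odd a s 0 (Or.inl rfl)]; simp [evenVec]
    have h3 := hI (evenVec a s 1) _ h1
    rw [e, map_smul, bracket_F_E] at h3
    have := congrFun (congrFun (congrArg D21.even
      (hc h3 (Submodule.smul_mem _ _ (Submodule.neg_mem _ (m s))))) s) 2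
    simpa [evenVec_apply, h2] using this
  have even_zero (x : D21 a) (hx : x ∈ I) : x.even = 0 := by
    funext s t
    rcases fin3_cases t with rfl | rfl | rfl
    · exact key0 s x hx
    · exact key1 s x hx
    · have := key0 s _ (hI (evenVec a s 0) x hx)
      simpa [bracket_even, evenVec, oddBracket_zero_left, evenBracket, sl2Bracket_0, h2] using this
  rw [eq_bot_iff]
  intro x hx
  rw [Submodule.mem_bot]
  apply D21.ext (even_zero x hx)
  funext i j k
  have m := even_zero _ (hI (oddVec a (1 - i) (1 - j) (1 - k)) x hx)
  have m := congrFun (congrFun m 1) 2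
  rcases fin2_cases i with rfl | rfl <;> rcases fin2_cases j with rfl | rfl <;>
    rcases fin2_cases k with rfl | rfl <;>
    simpa [bracket_even, evenBracket, sl2Bracket_2, oddVec, oddBracket_1, symPair_2, sigma, h2]
      using m

lemma eps_apply (s : Fin 3) (x : cartan a) : eps a s x = (x : D21 a).even s 2 := rfl

lemma cartanVec_coe (s : Fin 3) : (cartanVec a s : D21 a) = evenVec a s 2 := rfl

lemma cartanVec_even (s t : Fin 3) : ((cartanVec a s : cartan a) : D21 a).even t 2 =
    if t = s then 1 else 0 := by
  simp [cartanVec, evenVec_apply]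

lemma eps_cartanVec (s t : Fin 3) : eps a s (cartanVec a t) = if s = t then 1 else 0 :=
  cartanVec_even a t s

lemma dual_ext {α β : Module.Dual K (cartan a)} (h : ∀ s, α (cartanVec a s) = β (cartanVec a s)) :
    α = β := by
  ext ⟨x, hx⟩
  induction hx using Submodule.span_induction with
  | mem x h' => obtain ⟨s, rfl⟩ := h'; exact h s
  | zero => exact (map_zero α).trans (map_zero β).symm
  | add x y hx hy ihx ihy =>
    have := congrArg₂ (· + ·) ihx ihy
    exact (map_add α ⟨x, hx⟩ ⟨y, hy⟩).trans (this.trans (map_add β ⟨x, hx⟩ ⟨y, hy⟩).symm)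
  | smul c x hx ihx =>
    have := congrArg (c • ·) ihx
    exact (map_smul α c ⟨x, hx⟩).trans (this.trans (map_smul β c ⟨x, hx⟩).symm)

/-- The even roots are `±2 ε₁`, `±2 ε₂`, `±2 ε₃`. -/
theorem mem_evenRoots_iff [CharZero K] (α : Module.Dual K (cartan a)) :
    α ∈ evenRoots a ↔ ∃ s, α = 2 • eps a s ∨ α = -(2 • eps a s) := by
  constructor
  · rintro ⟨hα, x, hx, hx0, hw⟩
    have hw' (u s t : Fin 3) : (![2, -2, 0] t * if s = u then 1 else 0) * x.even s t =
        α (cartanVec a u) * x.even s t := by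
      have := congrFun (congrFun (congrArg D21.even (hw (cartanVec a u))) s) t
      rwa [bracket_cartan_even a (cartanVec a u).2, cartanVec_even] at this
    have : ∃ s t, x.even s t ≠ 0 := by
      by_contra! hcon
      exact hx0 (D21.ext (by funext s t; exact hcon s t) hx)
    obtain ⟨s, t, hst⟩ := this
    have hw'' (u : Fin 3) := mul_right_cancel₀ hst (hw' u s t)
    refine ⟨s, ?_⟩
    rcases fin3_cases t with rfl | rfl | rfl
    · left
      apply dual_ext
      intro u
      rw [← hw'' u]; simp [eps_cartanVec]
    · right
      apply dual_ext
      intro u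
      rw [← hw'' u]; by_cases hsu : s = u <;> simp [eps_cartanVec, hsu]
    · exact absurd (dual_ext a fun u => by rw [← hw'' u]; simp) hα
  · rintro ⟨s, rfl | rfl⟩
    · refine ⟨fun h => ?_, evenVec a s 0, rfl, fun h => ?_, fun h => ?_⟩
      · have := DFunLike.congr_fun h (cartanVec a s)
        simp [eps_cartanVec] at this
      · have := congrFun (congrFun (congrArg D21.even h) s) 0
        simp [evenVec_apply] at this
      · rw [bracket_cartan_evenVec a h.2]; simp [eps_apply]
    · refine ⟨fun h => ?_, evenVec a s 1, rfl, fun h => ?_, fun h => ?_⟩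
      · have := DFunLike.congr_fun h (cartanVec a s)
        simp [eps_cartanVec] at this
      · have := congrFun (congrFun (congrArg D21.even h) s) 1
        simp [evenVec_apply] at this
      · rw [bracket_cartan_evenVec a h.2]; simp [eps_apply]

/-- The odd roots are `±ε₁ ± ε₂ ± ε₃`. -/
theorem mem_oddRoots_iff (α : Module.Dual K (cartan a)) : α ∈ oddRoots a ↔
    ∃ i j k : Fin 2, α = (![1, -1] i : K) • eps a 0 + (![1, -1] j : K) • eps a 1 +
      (![1, -1] k : K) • eps a 2 := by
  constructor
  · rintro ⟨x, hx, hx0, hw⟩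
    have : ∃ i j k, x.odd i j k ≠ 0 := by
      by_contra! hcon
      exact hx0 (D21.ext hx (by funext i j k; exact hcon i j k))
    obtain ⟨i, j, k, hijk⟩ := this
    refine ⟨i, j, k, dual_ext a fun u => ?_⟩
    have := congrFun (congrFun (congrFun (congrArg D21.odd (hw (cartanVec a u))) i) j) k
    rw [bracket_cartan_odd a (cartanVec a u).2] at this
    have := mul_right_cancel₀ hijk this
    rw [← this]; rfl
  · rintro ⟨i, j, k, rfl⟩
    refine ⟨oddVec a i j k, rfl, fun h => ?_, fun h => ?_⟩
    · have := congrFun (congrFun (congrFun (congrArg D21.odd h) i) j) k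
      simp [oddVec_apply] at this
    · rw [bracket_cartan_oddVec a h.2]; rfl

lemma coroot_two_eps [CharZero K] (s : Fin 3) (hs : sigma a s ≠ 0) :
    coroot a (2 • eps a s) = cartanVec a s := by
  have h1 : form a (2 • eps a s) (2 • eps a s) = 4 * sigma a s := by
    simp [form, eps_cartanVec]; ring
  have h2 : dualVec a (2 • eps a s) = (2 * sigma a s) • cartanVec a s := by
    simp [dualVec, eps_cartanVec, mul_comm]
  rw [coroot, h1, h2, if_neg (mul_ne_zero (by norm_num) hs), smul_smul]
  have : 2 / (4 * sigma a s) * (2 * sigma a s) = 1 := by field_simp; norm_num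
  rw [this, one_smul]

/-- The coroots of the positive even roots. -/
theorem coroot_even [CharZero K] (ha0 : a ≠ 0) (ha1 : a ≠ -1) :
    (coroot a (2 • eps a 0) : D21 a) =
      (1 + a)⁻¹ • ((2 : K) • genH a 0 - genH a 1 - a • genH a 2) ∧
    (coroot a (2 • eps a 1) : D21 a) = genH a 1 ∧ (coroot a (2 • eps a 2) : D21 a) = genH a 2 := by
  have ha' : 1 + a ≠ 0 := fun h => ha1 (by linear_combination h)
  rw [coroot_two_eps a 0 (by simp [sigma, ← neg_add_rev, add_comm a, ha']),
    coroot_two_eps a 1 (by simp [sigma]), coroot_two_eps a 2 (by simp [sigma, ha0]),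
    genH_zero, genH_one, genH_two]
  refine ⟨?_, rfl, rfl⟩
  rw [cartanVec_coe, smul_smul, mul_inv_cancel₀ two_ne_zero, eq_inv_smul_iff₀ ha']
  module

lemma coroot_odd_aux [CharZero K] (α : Module.Dual K (cartan a)) (c d : K)
    (hα : ∀ s, α (cartanVec a s) = ![1, c, d] s) (hc : c = 1 ∨ c = -1) (hd : d = 1 ∨ d = -1) :
    (coroot a α : D21 a) =
      (2⁻¹ : K) • ((1 + a) • evenVec a 0 2 - c • evenVec a 1 2 - (d * a) • evenVec a 2 2) := by
  rw [coroot, if_pos]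
  · simp only [dualVec, Fin.sum_univ_three, hα, Submodule.coe_neg, Submodule.coe_add,
      Submodule.coe_smul, cartanVec_coe, sigma, Matrix.cons_val]
    module
  · rcases hc with rfl | rfl <;> rcases hd with rfl | rfl <;>
      simp [form, Fin.sum_univ_three, hα, sigma] <;> ring

/-- The coroots of the positive odd roots. -/
theorem coroot_odd [CharZero K] :
    (coroot a (eps a 0 - eps a 1 - eps a 2) : D21 a) = genH a 0 ∧
    (coroot a (eps a 0 + eps a 1 - eps a 2) : D21 a) = genH a 0 - genH a 1 ∧
    (coroot a (eps a 0 - eps a 1 + eps a 2) : D21 a) = genH a 0 - a • genH a 2 ∧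
    (coroot a (eps a 0 + eps a 1 + eps a 2) : D21 a) = genH a 0 - genH a 1 - a • genH a 2 := by
  rw [coroot_odd_aux a (eps a 0 - eps a 1 - eps a 2) (-1) (-1) ?_ (Or.inr rfl) (Or.inr rfl),
    coroot_odd_aux a (eps a 0 + eps a 1 - eps a 2) 1 (-1) ?_ (Or.inl rfl) (Or.inr rfl),
    coroot_odd_aux a (eps a 0 - eps a 1 + eps a 2) (-1) 1 ?_ (Or.inr rfl) (Or.inl rfl),
    coroot_odd_aux a (eps a 0 + eps a 1 + eps a 2) 1 1 ?_ (Or.inl rfl) (Or.inl rfl),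
    genH_zero, genH_one, genH_two]
  · refine ⟨?_, ?_, ?_, ?_⟩ <;> module
  all_goals
    intro s
    rcases fin3_cases s with rfl | rfl | rfl <;> simp [eps_cartanVec]

lemma coroot_neg (α : Module.Dual K (cartan a)) : coroot a (-α) = -coroot a α := by
  have h1 : form a (-α) (-α) = form a α α := by simp [form]
  have h2 : dualVec a (-α) = -dualVec a α := by simp [dualVec]
  rw [coroot, coroot, h1, h2]
  split_ifs <;> simp

/-! ### Chevalley bases -/

/-- The ring `ℤ[a]`. -/
def intRing : Subring K := Subring.closure {a}

/-- The ring `ℤ_a`, generated by the binomial coefficients of the elements of `ℤ[a]`. -/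
def binomRing : Subring K := Subring.closure {z | ∃ p ∈ intRing a, ∃ n : ℕ, z = binom K p n}

/-- The `α`-string through `β` is `{β - r α, …, β + q α}`. -/
def IsString (α β : Module.Dual K (cartan a)) (r q : ℕ) : Prop :=
  {γ | γ ∈ roots a ∪ {0} ∧ ∃ k : ℤ, γ = β + k • α} =
    {γ | ∃ k : ℤ, -(r : ℤ) ≤ k ∧ k ≤ q ∧ γ = β + k • α}

/-- The family `H₁, H₂, H₃, X_α` (`α ∈ Δ`) is a Chevalley basis of `D(2,1;a)`. -/
structure IsChevalleyBasis (H : Fin 3 → cartan a) (X : roots a → D21 a) : Prop where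
  linearIndependent : LinearIndependent K (Sum.elim (fun i => (H i : D21 a)) X)
  span_eq_top : Submodule.span K (Set.range (Sum.elim (fun i => (H i : D21 a)) X)) = ⊤
  homogeneous : ∀ α, X α ∈ part a 0 ∨ X α ∈ part a 1
  linearIndependent_H : LinearIndependent K H
  span_H : Submodule.span K (Set.range H) = ⊤
  span_coroot : Submodule.span (intRing a) (Set.range H) =
    Submodule.span (intRing a) (coroot a '' roots a)
  bracket_H_H : ∀ i j, bracket a (H i) (H j) = 0
  bracket_H_X : ∀ i (α : roots a), bracket a (H i) (X α) = α.1 (H i) • X α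
  bracket_neg : ∀ α β : roots a, β.1 = -α.1 →
    bracket a (X α) (X β) = rootSign a α.1 • (coroot a α.1 : D21 a)
  bracket_of_not_root : ∀ α β : roots a, α.1 + β.1 ≠ 0 → α.1 + β.1 ∉ roots a →
    bracket a (X α) (X β) = 0
  bracket_of_string : ∀ α β δ : roots a, δ.1 = α.1 + β.1 →
    (form a α.1 α.1 ≠ 0 ∨ form a β.1 β.1 ≠ 0) → ∀ r q : ℕ, IsString a α.1 β.1 r q →
    ∃ c : K, (c = r + 1 ∨ c = -(r + 1)) ∧ bracket a (X α) (X β) = c • X δ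
  bracket_of_isotropic : ∀ α β δ : roots a, δ.1 = α.1 + β.1 →
    form a α.1 α.1 = 0 → form a β.1 β.1 = 0 →
    ∃ c : K, (c = β.1 (coroot a α.1) ∨ c = -β.1 (coroot a α.1)) ∧
      bracket a (X α) (X β) = c • X δ

/-! ### The Kostant superalgebra and the ordered monomials -/

/-- The universal enveloping superalgebra `U(𝔤)`. -/
abbrev U : Type _ := SuperEnveloping K (D21 a)

/-- The canonical map `𝔤 → U(𝔤)`. -/
abbrev toU : D21 a →ₗ[K] U a := SuperEnveloping.ι K (D21 a)

/-- The Kostant superalgebra: the `ℤ_a`-subalgebra of `U(𝔤)` generated by the divided powers of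
the even root vectors, the odd root vectors, and the binomial coefficients of the elements of the
`ℤ[a]`-span of `H₁, H₂, H₃`. -/
def kostant (H : Fin 3 → cartan a) (X : roots a → D21 a) : Subalgebra (binomRing a) (U a) :=
  Algebra.adjoin (binomRing a)
    ({u | ∃ α : roots a, α.1 ∈ evenRoots a ∧ ∃ n : ℕ, u = dividedPow K (toU a (X α)) n} ∪
     {u | ∃ γ : roots a, γ.1 ∈ oddRoots a ∧ u = toU a (X γ)} ∪
     {u | ∃ h ∈ Submodule.span (intRing a) (Set.range H), ∃ n : ℕ,
        u = binom K (toU a (h : D21 a)) n})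

/-- The exponents of the ordered monomials: a natural number for each even root and each of
`H₁, H₂, H₃`, and `0` or `1` for each odd root. -/
def Exponent : Type _ :=
  {n : (roots a ⊕ Fin 3) →₀ ℕ // ∀ γ : roots a, γ.1 ∈ oddRoots a → n (Sum.inl γ) ≤ 1}

/-- The factor `X_α^{(n)}` or `binom(H_i, n)`.  For an odd root `γ` and `n = 0, 1` it is `1`
or `X_γ`. -/
def factor (H : Fin 3 → cartan a) (X : roots a → D21 a) (s : roots a ⊕ Fin 3) (n : ℕ) : U a :=
  Sum.elim (fun α => dividedPow K (toU a (X α)) n) (fun i => binom K (toU a (H i : D21 a)) n) s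

open Classical in
/-- The product of the factors with non-zero exponent, in the order of their indices with respect
to the total order `r`. -/
def monomial (H : Fin 3 → cartan a) (X : roots a → D21 a)
    (r : roots a ⊕ Fin 3 → roots a ⊕ Fin 3 → Prop) [IsLinearOrder (roots a ⊕ Fin 3) r]
    (n : Exponent a) : U a :=
  ((n.1.support.sort r).map fun s => factor a H X s (n.1 s)).prod

end D21

end

/-! ### Divided powers and binomial coefficients in an algebra -/

section DividedPowers

open Finset.HasAntidiagonal (antidiagonal mem_antidiagonal)

variable {K A B : Type*} [Field K] [Ring A] [Algebra K A] [Ring B] [Algebra K B]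

/-! The claim splits into spanning over `ℤ_a` and independence over `K`.

Spanning is a straightening argument. A word in the factors has as degree the sum of its exponents.
Modulo `ℤ_a`-combinations of words of smaller degree, two factors with different indices commute up
to a sign (`exists_swap`), and two factors with the same index merge into a multiple of one factor
(`exists_merge`). Induction on the degree then orders every word (`wordSpan_le_span_orderedProd`).
The point is that the error terms have coefficients in `ℤ_a`. For opposite even roots this is
Kostant's formula in `U(𝔰𝔩₂)`. For an even and an odd root the structure constant is `±1`. For two
odd roots it is `±β(H_α)`, which lies in `ℤ[a]`. Moving a root vector past `binom(H_i, n)` shifts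
`H_i` by an element `c` of `ℤ[a]`, and Vandermonde's identity produces the coefficients `binom(c,
k)`, which are the generators of `ℤ_a`. The generators `binom(h, n)`, for `h` in the `ℤ[a]`-span of
the `H_i`, are reduced by Newton interpolation: `t ↦ binom(ct, n)` has values in `ℤ_a` on `ℕ`, hence
is a `ℤ_a`-combination of the `binom(t, k)`. Odd root vectors square to zero, which bounds their
exponents.

Independence is the corresponding half of the Poincaré–Birkhoff–Witt theorem, proved with the
coproduct. `U(𝔤)` acts on `U(𝔤) ⊗ U(𝔤)` by the signed Leibniz rule (`tensorRep`), and the coproduct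
of `u` is `u · (1 ⊗ 1)`. On an ordered product with exponent `m` it is the sum of all `M_p ⊗ M_q`
with `p + q = m`, with non-zero coefficients, since divided powers and binomials absorb the
multinomial coefficients. In degree one, the adjoint representation is faithful because the centre
is trivial, so functionals dual to the Chevalley basis exist on `U(𝔤)`. Convolving them along the
coproduct separates an ordered product from all others of at most the same degree
(`exists_separating_form`). -/

@[simp] lemma dividedPow_zero (y : A) : dividedPow K y 0 = 1 := by simp [dividedPow]

@[simp] lemma dividedPow_one (y : A) : dividedPow K y 1 = y := by simp [dividedPow]

@[simp] lemma binom_zero (y : A) : binom K y 0 = 1 := by simp [binom]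

@[simp] lemma binom_one (y : A) : binom K y 1 = y := by simp [binom]

lemma map_dividedPow (φ : A →ₐ[K] B) (y : A) (n : ℕ) :
    φ (dividedPow K y n) = dividedPow K (φ y) n := by
  simp [dividedPow]

lemma map_binom (φ : A →ₐ[K] B) (y : A) (n : ℕ) : φ (binom K y n) = binom K (φ y) n := by
  simp [binom, Polynomial.aeval_algHom_apply]

lemma aeval_binom_X (y : A) (n : ℕ) :
    Polynomial.aeval y (binom K (Polynomial.X : Polynomial K) n) = binom K y n := by
  rw [map_binom, Polynomial.aeval_X]

/-- Scalars are central, so a commutation rule for `y` passes to all polynomials in `y`. In this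
form `binom` is moved past elements that shift its argument. -/
lemma SemiconjBy.polynomial_aeval {x y z : A} (h : SemiconjBy x y z) (p : Polynomial K) :
    SemiconjBy x (Polynomial.aeval y p) (Polynomial.aeval z p) := by
  induction p using Polynomial.induction_on' with
  | add p q hp hq => simpa using hp.add_right hq
  | monomial n c =>
    simp only [Polynomial.aeval_monomial]
    exact SemiconjBy.mul_right (Algebra.commutes c x).symm (h.pow_right n)

lemma SemiconjBy.binom {x y z : A} (h : SemiconjBy x y z) (n : ℕ) :
    SemiconjBy x (binom K y n) (binom K z n) := by
  rw [← aeval_binom_X y, ← aeval_binom_X z]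
  exact h.polynomial_aeval _

lemma Commute.dividedPow_right {x y : A} (h : Commute x y) (n : ℕ) :
    Commute x (dividedPow K y n) := (h.pow_right n).smul_right _

lemma Commute.dividedPow_left {x y : A} (h : Commute x y) (n : ℕ) :
    Commute (dividedPow K x n) y := (h.symm.dividedPow_right n).symm

lemma Commute.binom_right {x y : A} (h : Commute x y) (n : ℕ) :
    Commute x (_root_.binom K y n) := SemiconjBy.binom h n

lemma Commute.binom_left {x y : A} (h : Commute x y) (n : ℕ) :
    Commute (_root_.binom K x n) y := (h.symm.binom_right n).symm

/-- Integer coefficients are the setting of the Vandermonde and Pascal identities for elements of an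
arbitrary ring. -/
lemma aeval_descPochhammer_eq_smeval (y : A) (n : ℕ) :
    Polynomial.aeval y (descPochhammer K n) = (descPochhammer ℤ n).smeval y := by
  rw [← descPochhammer_map (algebraMap ℤ K), Polynomial.aeval_map_algebraMap,
    Polynomial.aeval_eq_smeval]

/-! ### Identities for divided powers and binomial coefficients in characteristic zero -/

variable [CharZero K]

lemma mul_dividedPow (y : A) (n : ℕ) :
    y * dividedPow K y n = (n + 1 : K) • dividedPow K y (n + 1) := by
  have h : (n + 1 : K) ≠ 0 := by exact_mod_cast n.succ_ne_zero
  rw [dividedPow, dividedPow, smul_smul, Nat.factorial_succ, mul_smul_comm, pow_succ']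
  congr 1
  push_cast
  rw [mul_inv, mul_inv_cancel_left₀ h]

lemma dividedPow_mul_dividedPow (y : A) (m n : ℕ) :
    dividedPow K y m * dividedPow K y n = ((m + n).choose m : K) • dividedPow K y (m + n) := by
  rw [dividedPow, dividedPow, dividedPow, smul_mul_smul_comm, ← pow_add, smul_smul,
    Nat.cast_add_choose]
  congr 1
  have := Nat.cast_ne_zero (R := K).2 (m + n).factorial_ne_zero
  field_simp

lemma binom_mul_sub (y : A) (n : ℕ) :
    binom K y n * (y - n) = (n + 1 : K) • binom K y (n + 1) := by
  have h : (n + 1 : K) ≠ 0 := by exact_mod_cast n.succ_ne_zero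
  rw [binom, binom, smul_smul, Nat.factorial_succ, smul_mul_assoc, descPochhammer_succ_right]
  simp only [map_mul, map_sub, Polynomial.aeval_X, map_natCast]
  congr 1
  push_cast
  rw [mul_inv, mul_inv_cancel_left₀ h]

lemma Commute.dividedPow_add {x y : A} (h : Commute x y) (n : ℕ) :
    dividedPow K (x + y) n =
      ∑ p ∈ antidiagonal n, dividedPow K x p.1 * dividedPow K y p.2 := by
  rw [dividedPow, h.add_pow', Finset.smul_sum]
  refine Finset.sum_congr rfl fun p hp => ?_
  rw [mem_antidiagonal] at hp
  subst hp
  rw [dividedPow, dividedPow, smul_mul_smul_comm, ← Nat.cast_smul_eq_nsmul K, smul_smul,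
    Nat.cast_add_choose]
  congr 1
  have := Nat.cast_ne_zero (R := K).2 (p.1 + p.2).factorial_ne_zero
  field_simp

/-- The Chu–Vandermonde identity for descending factorials, divided by `n!`. -/
lemma Commute.binom_add {x y : A} (h : Commute x y) (n : ℕ) :
    _root_.binom K (x + y) n =
      ∑ p ∈ antidiagonal n, _root_.binom K x p.1 * _root_.binom K y p.2 := by
  rw [_root_.binom, aeval_descPochhammer_eq_smeval, Ring.descPochhammer_smeval_add n h,
    Finset.smul_sum]
  refine Finset.sum_congr rfl fun p hp => ?_
  rw [mem_antidiagonal] at hp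
  subst hp
  rw [_root_.binom, _root_.binom, aeval_descPochhammer_eq_smeval, aeval_descPochhammer_eq_smeval,
    smul_mul_smul_comm, ← nsmul_eq_mul, ← Nat.cast_smul_eq_nsmul K, smul_smul, Nat.cast_add_choose]
  congr 1
  have := Nat.cast_ne_zero (R := K).2 (p.1 + p.2).factorial_ne_zero
  field_simp

lemma binom_add_one (y : A) (n : ℕ) :
    binom K (y + 1) (n + 1) = binom K y (n + 1) + binom K y n := by
  have h0 : (n + 1 : K) ≠ 0 := by exact_mod_cast n.succ_ne_zero
  rw [binom, binom, binom, aeval_descPochhammer_eq_smeval, Ring.descPochhammer_succ_succ_smeval,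
    aeval_descPochhammer_eq_smeval, aeval_descPochhammer_eq_smeval, smul_add, add_comm,
    ← Nat.cast_smul_eq_nsmul K, smul_smul, Nat.factorial_succ]
  congr 2
  push_cast
  field_simp

lemma binom_natCast (j n : ℕ) : binom K (j : K) n = (j.choose n : K) := by
  rw [binom, Polynomial.coe_aeval_eq_eval, descPochhammer_eval_eq_descFactorial,
    Nat.descFactorial_eq_factorial_mul_choose, Nat.cast_mul, smul_eq_mul,
    inv_mul_cancel_left₀ (Nat.cast_ne_zero.2 n.factorial_ne_zero)]

/-- Newton interpolation: a polynomial of degree at most `d` whose values at the natural numbers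
lie in a subring `R` is an `R`-linear combination of binomial coefficients. -/
lemma exists_aeval_eq_sum_binom (R : Subring K) {p : Polynomial K} {d : ℕ} (hp : p.natDegree ≤ d)
    (hR : ∀ j : ℕ, p.eval (j : K) ∈ R) :
    ∃ c : ℕ → R, ∀ y : A,
      Polynomial.aeval y p = ∑ k ∈ Finset.range (d + 1), (c k : K) • binom K y k := by
  -- An iterated difference at `0` is an integral combination of values at natural numbers, so it
  -- stays in `R`.
  have hc (k : ℕ) : (fwdDiff 1)^[k] (fun x => p.eval x) (0 : K) ∈ R := by
    rw [fwdDiff_iter_eq_sum_shift]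
    refine sum_mem fun i _ => zsmul_mem ?_ _
    simpa using hR i
  refine ⟨fun k => ⟨_, hc k⟩, fun y => ?_⟩
  have key : p = ∑ k ∈ Finset.range (d + 1), (fwdDiff 1)^[k] (fun x => p.eval x) (0 : K) •
      binom K (Polynomial.X : Polynomial K) k := by
    -- By the Gregory–Newton formula both sides agree at all natural numbers, which form an infinite
    -- subset of `K`.
    refine Polynomial.eq_of_infinite_eval_eq _ _
      ((Set.infinite_range_of_injective (Nat.cast_injective (R := K))).mono ?_)
    rintro _ ⟨j, rfl⟩
    have h := shift_eq_sum_fwdDiff_iter (1 : K) (fun x => p.eval x) j 0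
    have e (k : ℕ) : (binom K (Polynomial.X : Polynomial K) k).eval (j : K) = (j.choose k : K) := by
      rw [← Polynomial.coe_aeval_eq_eval, aeval_binom_X, binom_natCast]
    simp only [zero_add, nsmul_eq_mul, mul_one] at h
    simp only [Set.mem_ofPred_eq, Polynomial.eval_finsetSum, Polynomial.eval_smul, smul_eq_mul, e]
    rw [h]
    -- The formula at `j` runs up to `j`, the claim up to `d`. Terms beyond `j` vanish through the
    -- binomial coefficient and terms beyond `d` through the degree of `p`, so both sums equal the
    -- one up to `max j d`.
    have hl : ∀ N, j ≤ N → d ≤ N → ∑ k ∈ Finset.range (j + 1),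
        (j.choose k : K) * (fwdDiff 1)^[k] (fun x => p.eval x) (0 : K) =
        ∑ k ∈ Finset.range (N + 1),
        (j.choose k : K) * (fwdDiff 1)^[k] (fun x => p.eval x) (0 : K) := fun N hN _ => by
      refine Finset.sum_subset (Finset.range_mono (by omega)) fun k _ hk => ?_
      rw [Nat.choose_eq_zero_of_lt (by simpa using hk)]; simp
    rw [hl (max j d) (le_max_left _ _) (le_max_right _ _)]
    refine (Finset.sum_subset (Finset.range_mono (by omega)) fun k _ hk => ?_).symm.trans
      (Finset.sum_congr rfl fun k _ => mul_comm _ _)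
    have : p.natDegree < k := by simp at hk; omega
    have h0 := Polynomial.fwdDiff_iter_eq_zero_of_degree_lt this
    simp [h0]
  conv_lhs => rw [key]
  simp [aeval_binom_X]

/-- The commutation formula for divided powers in `U(𝔰𝔩₂)`. -/
lemma mul_dividedPow_of_sl2 {E F H : A} (hEF : E * F - F * E = H) (hHF : H * F - F * H = -2 * F)
    (n : ℕ) : E * dividedPow K F (n + 1) =
      dividedPow K F (n + 1) * E + dividedPow K F n * (H - n) := by
  have key (n : ℕ) : E * F ^ (n + 1) = F ^ (n + 1) * E + (n + 1 : A) * (F ^ n * (H - n)) := by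
    have hE : E * F = F * E + H := by rw [← hEF]; abel
    have hH : H * F = F * H - 2 * F := by rw [sub_eq_iff_eq_add] at hHF; rw [hHF]; noncomm_ring
    induction n with
    | zero => simp [hE]
    | succ n ih =>
      have h1 : (H - n) * F = F * (H - n - 2) := by
        rw [sub_mul, hH, Nat.cast_comm]; noncomm_ring
      rw [pow_succ, ← mul_assoc, ih, add_mul, mul_assoc, hE, mul_assoc, mul_assoc, h1,
        ← mul_assoc (F ^ n), ← pow_succ, mul_add, ← mul_assoc, ← pow_succ, add_assoc]
      congr 1
      push_cast
      have h2 : ((n : A) + 1) * (F ^ (n + 1) * (H - n - 2)) =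
        F ^ (n + 1) * (((n : A) + 1) * (H - n - 2)) := by
        rw [← mul_assoc, ← mul_assoc]; congr 1
        exact_mod_cast (Nat.cast_commute (n + 1) (F ^ (n + 1))).eq
      have h3 : ((n : A) + 1 + 1) * (F ^ (n + 1) * (H - (n + 1))) =
        F ^ (n + 1) * (((n : A) + 1 + 1) * (H - (n + 1))) := by
        rw [← mul_assoc, ← mul_assoc]; congr 1
        exact_mod_cast (Nat.cast_commute (n + 2) (F ^ (n + 1))).eq
      rw [h2, h3, ← mul_add]
      congr 1
      noncomm_ring
  have hn := Nat.cast_ne_zero (R := K).2 n.factorial_ne_zero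
  have h : (n + 1 : K) ≠ 0 := by exact_mod_cast n.succ_ne_zero
  rw [dividedPow, mul_smul_comm, key, smul_add, ← smul_mul_assoc, ← dividedPow]
  congr 1
  rw [dividedPow, smul_mul_assoc, ← Nat.cast_succ, ← nsmul_eq_mul, ← Nat.cast_smul_eq_nsmul K,
    smul_smul, Nat.factorial_succ]
  congr 1
  push_cast
  field_simp

/-- Kostant's formula, by induction on `m`. Multiplying the sum for `m` by `E` must give `m + 1`
times the sum for `m + 1`; after a shift of the index this is Pascal's rule. -/
lemma dividedPow_mul_dividedPow_of_sl2 {E F H : A} (hEF : E * F - F * E = H)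
    (hHE : H * E - E * H = 2 * E) (hHF : H * F - F * H = -2 * F) (m n : ℕ) :
    dividedPow K E m * dividedPow K F n = ∑ k ∈ Finset.range (m + 1),
      (if k ≤ n then dividedPow K F (n - k) else 0) *
        binom K (H - m - n + 2 * k) k * dividedPow K E (m - k) := by
  -- The value `0` for `k > n` replaces truncated subtraction and makes `hEg` valid for every `k`;
  -- at `k = n` it reads `E = E`.
  set g : ℕ → A := fun k => if k ≤ n then dividedPow K F (n - k) else 0 with hg
  have hEg (k : ℕ) : E * g k = g k * E + g (k + 1) * (H - n + k + 1) := by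
    rcases lt_trichotomy k n with h | h | h
    · obtain ⟨j, rfl⟩ : ∃ j, n = k + j + 1 := ⟨n - k - 1, by omega⟩
      simp only [hg, if_pos h.le, if_pos (Nat.succ_le_of_lt h)]
      rw [show k + j + 1 - k = j + 1 by omega, show k + j + 1 - (k + 1) = j by omega,
        mul_dividedPow_of_sl2 hEF hHF]
      congr 2
      push_cast; abel
    · subst h; simp [g]
    · simp [hg, h.not_ge, show ¬ k + 1 ≤ n by omega]
  have hcomm (y : A) (j : ℕ) (hy : y * E - E * y = 2 * E) :
      E * binom K y j = binom K (y - 2) j * E := by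
    refine SemiconjBy.binom ?_ j
    rw [SemiconjBy, sub_mul, ← hy]; abel
  induction m with
  | zero => simp
  | succ m ih =>
    have h0 : (m + 1 : K) ≠ 0 := by exact_mod_cast m.succ_ne_zero
    rw [← smul_right_inj h0, ← smul_mul_assoc, ← mul_dividedPow, mul_assoc, ih, Finset.mul_sum]
    -- In `a k` the factor `E` has passed all of the `k`-th summand; in `b (k + 1)` it has lowered
    -- the power of `F`. Since `b 0 = 0` and `a (m + 1) = 0`, the sum of `a k + b (k + 1)` over `k ≤
    -- m` equals the sum of `a k + b k` over `k ≤ m + 1`.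
    let a : ℕ → A := fun k =>
      ((m + 1 : K) - k) • (g k * binom K (H - m - n + 2 * k - 2) k * dividedPow K E (m + 1 - k))
    let b : ℕ → A := fun k => Nat.casesOn k 0 fun k =>
      g (k + 1) * (H - n + k + 1) * binom K (H - m - n + 2 * k) k * dividedPow K E (m - k)
    have hl : ∀ k ∈ Finset.range (m + 1),
        E * (g k * binom K (H - m - n + 2 * k) k * dividedPow K E (m - k)) = a k + b (k + 1) := by
      intro k hk
      have hk : k ≤ m := Nat.lt_succ_iff.1 (Finset.mem_range.1 hk)
      have hb := hcomm (H - m - n + 2 * k) k (by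
        have h1 := (Nat.cast_commute m E).eq
        have h2 := (Nat.cast_commute n E).eq
        have h3 := (Nat.cast_commute (2 * k) E).eq
        push_cast at h3
        rw [add_mul, sub_mul, sub_mul, mul_add, mul_sub, mul_sub, h1, h2, h3, ← hHE]
        abel)
      rw [← mul_assoc, ← mul_assoc, hEg, add_mul, add_mul, mul_assoc (g k), hb, ← mul_assoc,
        mul_assoc _ E, mul_dividedPow, mul_smul_comm]
      simp only [a, b]
      rw [Nat.sub_add_comm hk, Nat.cast_sub hk]
      congr 2
      ring
    have hr : ∀ k ∈ Finset.range (m + 1 + 1),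
        (m + 1 : K) • (g k * binom K (H - (m + 1 : ℕ) - n + 2 * k) k *
          dividedPow K E (m + 1 - k)) = a k + b k := by
      intro k _
      cases k with
      | zero => simp [a, b]
      | succ j =>
        simp only [a, b]
        have hy : H - (m + 1 : ℕ) - n + 2 * (j + 1 : ℕ) = (H - m - n + 2 * j) + 1 := by
          push_cast; noncomm_ring
        have hy' : H - m - n + 2 * (j + 1 : ℕ) - 2 = H - m - n + 2 * j := by
          push_cast; rw [mul_add, mul_one]; abel
        rw [hy, hy', binom_add_one, Nat.add_sub_add_right]
        set y := H - m - n + 2 * j with hyd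
        -- The part `y - j` turns `binom y j` into `(j + 1) binom y (j + 1)`, which completes the
        -- coefficient `m - j` in `a (j + 1)` to `m + 1`. The part `m + 1` supplies the other term
        -- of Pascal's rule.
        have h1 : (H - n + j + 1) = (y - j) + ((m + 1 : ℕ) : A) := by
          rw [hyd]; push_cast; noncomm_ring
        have h2 : (y - j) * binom K y j = (j + 1 : K) • binom K y (j + 1) := by
          rw [← binom_mul_sub]
          exact (((Commute.refl y).sub_left (Nat.cast_commute j y)).binom_right j).eq
        rw [mul_assoc (g (j + 1)) (H - n + j + 1), h1, add_mul, h2, ← nsmul_eq_mul,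
          ← Nat.cast_smul_eq_nsmul K]
        simp only [mul_add, add_mul, smul_add, mul_smul_comm, smul_mul_assoc]
        push_cast
        module
    rw [Finset.sum_congr rfl hl, Finset.smul_sum, Finset.sum_congr rfl hr, Finset.sum_add_distrib,
      Finset.sum_add_distrib, Finset.sum_range_succ a (m + 1), Finset.sum_range_succ' b (m + 1)]
    simp [a, b]

end DividedPowers

/-! ### Straightening words in an algebra with filtered commutation relations -/

section Straightening

variable {R A S : Type*} [CommRing R] [Ring A] [Algebra R A] (f : S → ℕ → A)

/-- The product of the factors `f s n` over a word in pairs `(s, n)`. -/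
def wordProd (l : List (S × ℕ)) : A := (l.map fun p => f p.1 p.2).prod

/-- The degree of a word: the sum of its exponents. -/
def wordDegree (l : List (S × ℕ)) : ℕ := (l.map Prod.snd).sum

/-- The product of the factors `f s (m s)`, in the order of the list `L`. -/
def orderedProd (L : List S) (m : S →₀ ℕ) : A := (L.map fun s => f s (m s)).prod

variable (R) in
/-- The span of the products over all words of degree less than `d`. -/
def wordSpan (d : ℕ) : Submodule R A :=
  Submodule.span R {x | ∃ l : List (S × ℕ), wordDegree l < d ∧ x = wordProd f l}

lemma wordSpan_mono {d e : ℕ} (h : d ≤ e) : wordSpan R f d ≤ wordSpan R f e :=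
  Submodule.span_mono fun _ ⟨l, hl, hx⟩ => ⟨l, hl.trans_le h, hx⟩

/-- The bounds are strict: degrees at most `d - 1` and `e - 1` add up to at most `d + e - 2`, whence
the slack of one in `h`. -/
lemma mul_mem_wordSpan {d e k : ℕ} {x y : A} (hx : x ∈ wordSpan R f d) (hy : y ∈ wordSpan R f e)
    (h : d + e ≤ k + 1) : x * y ∈ wordSpan R f k := by
  refine (?_ : wordSpan R f d * wordSpan R f e ≤ _) (Submodule.mul_mem_mul hx hy)
  rw [wordSpan, wordSpan, Submodule.span_mul_span, Submodule.span_le]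
  rintro _ ⟨_, ⟨l, hl, rfl⟩, _, ⟨l', hl', rfl⟩, rfl⟩
  refine Submodule.subset_span ⟨l ++ l', ?_, ?_⟩
  · simp only [wordDegree, List.map_append, List.sum_append] at *
    omega
  · simp [wordProd]

lemma factor_mem_wordSpan {s : S} {n d : ℕ} (h : n < d) : f s n ∈ wordSpan R f d :=
  Submodule.subset_span ⟨[(s, n)], by simpa [wordDegree] using h, by simp [wordProd]⟩

lemma one_mem_wordSpan {d : ℕ} (h : 0 < d) : (1 : A) ∈ wordSpan R f d :=
  Submodule.subset_span ⟨[], by simpa [wordDegree] using h, by simp [wordProd]⟩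

lemma orderedProd_mem_wordSpan (L : List S) (m : S →₀ ℕ) {d : ℕ} (h : (L.map m).sum < d) :
    orderedProd f L m ∈ wordSpan R f d := by
  refine Submodule.subset_span ⟨L.map fun s => (s, m s), ?_, ?_⟩
  · simpa [wordDegree, Function.comp_def] using h
  · simp [wordProd, orderedProd, Function.comp_def]

lemma orderedProd_congr {L : List S} {m m' : S →₀ ℕ} (h : ∀ s ∈ L, m s = m' s) :
    orderedProd f L m = orderedProd f L m' := by
  rw [orderedProd, orderedProd, List.map_congr_left fun s hs => by rw [h s hs]]

lemma orderedProd_cons (s : S) (L : List S) (m : S →₀ ℕ) :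
    orderedProd f (s :: L) m = f s (m s) * orderedProd f L m := by
  simp [orderedProd]

lemma sum_map_add_single {L : List S} (hL : L.Nodup) {s : S} (hs : s ∈ L) (m : S →₀ ℕ) (n : ℕ) :
    (L.map ⇑(m + Finsupp.single s n)).sum = n + (L.map m).sum := by
  classical
  rw [← List.sum_toFinset _ hL, ← List.sum_toFinset _ hL]
  simp only [Finsupp.coe_add, Pi.add_apply, Finset.sum_add_distrib, Finsupp.single_apply]
  rw [Finset.sum_ite_eq, if_pos (List.mem_toFinset.2 hs), add_comm]

variable {f}

/-- The new factor moves right past the factors with other indices until it meets the one with index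
`s` and merges with it. Each error has smaller degree than the factors it replaces, and stays below
the total degree after multiplication by the remaining ones. -/
lemma exists_mul_orderedProd_sub_mem
    (hswap : ∀ s t m n, s ≠ t → ∃ c : R, f s m * f t n - c • (f t n * f s m) ∈ wordSpan R f (m + n))
    (hmerge : ∀ s m n, ∃ c : R, f s m * f s n - c • f s (m + n) ∈ wordSpan R f (m + n))
    {L : List S} (hL : L.Nodup) {s : S} (hs : s ∈ L) (n : ℕ) (m : S →₀ ℕ) :
    ∃ c : R, f s n * orderedProd f L m - c • orderedProd f L (m + Finsupp.single s n) ∈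
      wordSpan R f (n + (L.map m).sum) := by
  classical
  induction L with
  | nil => simp at hs
  | cons t L ih =>
    obtain ⟨htL, hL'⟩ := List.nodup_cons.1 hL
    simp only [orderedProd_cons, List.map_cons, List.sum_cons]
    by_cases hst : s = t
    · subst hst
      obtain ⟨c, hc⟩ := hmerge s n (m s)
      refine ⟨c, ?_⟩
      have h : orderedProd f L (m + Finsupp.single s n) = orderedProd f L m :=
        orderedProd_congr f fun t ht => by
          rw [Finsupp.add_apply, Finsupp.single_eq_of_ne (by rintro rfl; exact htL ht), add_zero]
      rw [h, Finsupp.add_apply, Finsupp.single_eq_same, add_comm (m s) n, ← mul_assoc,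
        ← smul_mul_assoc, ← sub_mul]
      exact mul_mem_wordSpan f hc (e := (L.map m).sum + 1)
        (orderedProd_mem_wordSpan f L m (Nat.lt_succ_self _)) (by omega)
    · obtain ⟨c, hc⟩ := hswap s t n (m t) hst
      obtain ⟨c', hc'⟩ := ih hL' ((List.mem_cons.1 hs).resolve_left hst)
      refine ⟨c * c', ?_⟩
      rw [Finsupp.add_apply, Finsupp.single_eq_of_ne (Ne.symm hst), add_zero]
      have h1 := mul_mem_wordSpan f hc (orderedProd_mem_wordSpan f L m (Nat.lt_succ_self _))
        (k := n + (m t + (L.map m).sum)) (by omega)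
      have h2 := mul_mem_wordSpan f (factor_mem_wordSpan f (s := t) (Nat.lt_succ_self (m t))) hc'
        (k := n + (m t + (L.map m).sum)) (by omega)
      convert add_mem h1 (Submodule.smul_mem _ c h2) using 1
      simp only [sub_mul, mul_sub, smul_sub, mul_assoc, smul_mul_assoc, mul_smul_comm, smul_smul]
      abel

/-- If the factors commute and multiply up to scalars and terms of lower degree, then every word
of degree less than `d` is a combination of ordered products of degree less than `d`. -/
theorem wordSpan_le_span_orderedProd
    (hswap : ∀ s t m n, s ≠ t → ∃ c : R, f s m * f t n - c • (f t n * f s m) ∈ wordSpan R f (m + n))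
    (hmerge : ∀ s m n, ∃ c : R, f s m * f s n - c • f s (m + n) ∈ wordSpan R f (m + n))
    (h0 : ∀ s, f s 0 = 1)
    {L : List S} (hL : L.Nodup) (hmem : ∀ s, s ∈ L) (d : ℕ) :
    wordSpan R f d ≤ Submodule.span R (Set.range (orderedProd f L)) := by
  -- Modulo smaller degree, a word is a multiple of a single ordered product. The equality of
  -- degrees feeds the induction on the word; the remainder is left to the induction on `d`.
  have key (l : List (S × ℕ)) : ∃ (c : R) (m : S →₀ ℕ), (L.map m).sum = wordDegree l ∧
      wordProd f l - c • orderedProd f L m ∈ wordSpan R f (wordDegree l) := by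
    induction l with
    | nil =>
      refine ⟨1, 0, by simp [wordDegree, Finsupp.coe_zero, Pi.zero_def], ?_⟩
      simp [wordProd, orderedProd, h0]
    | cons p l ih =>
      obtain ⟨c, m, hm, hc⟩ := ih
      obtain ⟨c', hc'⟩ := exists_mul_orderedProd_sub_mem hswap hmerge hL (hmem p.1) p.2 m
      have hd : wordDegree (p :: l) = p.2 + wordDegree l := by simp [wordDegree]
      refine ⟨c * c', m + Finsupp.single p.1 p.2, ?_, ?_⟩
      · rw [sum_map_add_single hL (hmem p.1), hm, hd]
      · have h1 := mul_mem_wordSpan f (factor_mem_wordSpan f (s := p.1) (Nat.lt_succ_self p.2)) hc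
          (k := p.2 + wordDegree l) (by omega)
        rw [hm] at hc'
        rw [hd]
        convert add_mem h1 (Submodule.smul_mem _ c hc') using 1
        simp only [wordProd, List.map_cons, List.prod_cons, mul_sub, smul_sub, mul_smul_comm,
          smul_smul]
        abel
  induction d using Nat.strong_induction_on with
  | _ d ih =>
    refine Submodule.span_le.2 ?_
    rintro _ ⟨l, hl, rfl⟩
    obtain ⟨c, m, -, hc⟩ := key l
    have h := add_mem (ih _ hl hc) (Submodule.smul_mem _ c (Submodule.subset_span ⟨m, rfl⟩))
    simpa using h

end Straightening

/-! ### Maps out of the universal enveloping superalgebra -/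

namespace SuperEnveloping

variable {K L A : Type*} [CommRing K] [AddCommGroup L] [Module K L] [LieSuperalgebra K L]
  [Ring A] [Algebra K A]

/-- The universal property of the universal enveloping superalgebra. -/
def lift (g : L →ₗ[K] A)
    (hg : ∀ {i j : ZMod 2} {x y : L}, x ∈ LieSuperalgebra.part (K := K) (L := L) i →
      y ∈ LieSuperalgebra.part (K := K) (L := L) j →
      g x * g y - (-1 : K) ^ (i.val * j.val) • (g y * g x) =
        g (LieSuperalgebra.bracket (K := K) x y)) :
    SuperEnveloping K L →ₐ[K] A :=
  RingQuot.liftAlgHom K ⟨TensorAlgebra.lift K g, by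
    rintro _ _ ⟨hx, hy⟩
    simpa using hg hx hy⟩

@[simp] lemma lift_ι (g : L →ₗ[K] A) (hg) (x : L) : lift g hg (ι K L x) = g x := by
  have h : lift g hg (mkAlgHom K L (TensorAlgebra.ι K x)) =
      TensorAlgebra.lift K g (TensorAlgebra.ι K x) :=
    RingQuot.liftAlgHom_mkAlgHom_apply _ _ _ _
  rw [TensorAlgebra.lift_ι_apply] at h
  exact h

lemma ι_mul_ι_sub {i j : ZMod 2} {x y : L} (hx : x ∈ LieSuperalgebra.part (K := K) (L := L) i)
    (hy : y ∈ LieSuperalgebra.part (K := K) (L := L) j) :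
    ι K L x * ι K L y - (-1 : K) ^ (i.val * j.val) • (ι K L y * ι K L x) =
      ι K L (LieSuperalgebra.bracket (K := K) x y) := by
  have h := RingQuot.mkAlgHom_rel K (SuperEnvelopingRel.mk hx hy)
  rw [map_sub, map_smul, map_mul, map_mul] at h
  exact h

end SuperEnveloping

/-! ### Counit, parity, adjoint representation and coproduct of `U(𝔤)` -/

namespace D21

open SuperEnveloping

open scoped TensorProduct

variable {K : Type*} [Field K] (a : K)

/-- The projection to the even part. -/
def evenPart : D21 a →ₗ[K] D21 a where
  toFun x := ⟨x.even, 0⟩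
  map_add' _ _ := D21.ext rfl (by simp)
  map_smul' _ _ := D21.ext rfl (by simp)

/-- The projection to the odd part. -/
def oddPart : D21 a →ₗ[K] D21 a where
  toFun x := ⟨0, x.odd⟩
  map_add' _ _ := D21.ext (by simp) rfl
  map_smul' _ _ := D21.ext (by simp) rfl

variable {a}

lemma evenPart_of_mem_zero {x : D21 a} (hx : x ∈ part a 0) : evenPart a x = x :=
  D21.ext rfl (Eq.symm hx)
lemma oddPart_of_mem_zero {x : D21 a} (hx : x ∈ part a 0) : oddPart a x = 0 :=
  D21.ext rfl hx
lemma evenPart_of_mem_one {x : D21 a} (hx : x ∈ part a 1) : evenPart a x = 0 :=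
  D21.ext hx rfl
lemma oddPart_of_mem_one {x : D21 a} (hx : x ∈ part a 1) : oddPart a x = x :=
  D21.ext (Eq.symm hx) rfl

lemma toU_mul_sub_of_even_left {i : ZMod 2} {x y : D21 a} (hx : x ∈ part a 0) (hy : y ∈ part a i) :
    toU a x * toU a y - toU a y * toU a x = toU a (bracket a x y) := by
  have h := ι_mul_ι_sub (K := K) (L := D21 a) (i := 0) (j := i) hx hy
  simp only [ZMod.val_zero, zero_mul, pow_zero, one_smul] at h
  exact h

lemma toU_mul_add_of_odd {x y : D21 a} (hx : x ∈ part a 1) (hy : y ∈ part a 1) :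
    toU a x * toU a y + toU a y * toU a x = toU a (bracket a x y) := by
  have h := ι_mul_ι_sub (K := K) (L := D21 a) (i := 1) (j := 1) hx hy
  simp only [show (1 : ZMod 2).val = 1 from rfl, mul_one, pow_one, neg_smul, one_smul,
    sub_neg_eq_add] at h
  exact h

/-- A linear map that respects the brackets of even and odd elements extends to `U(𝔤)`. -/
def liftU {A : Type*} [Ring A] [Algebra K A] (g : D21 a →ₗ[K] A)
    (h00 : ∀ x ∈ part a 0, ∀ y ∈ part a 0, g x * g y - g y * g x = g (bracket a x y))
    (h01 : ∀ x ∈ part a 0, ∀ y ∈ part a 1, g x * g y - g y * g x = g (bracket a x y))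
    (h11 : ∀ x ∈ part a 1, ∀ y ∈ part a 1, g x * g y + g y * g x = g (bracket a x y)) :
    U a →ₐ[K] A :=
  SuperEnveloping.lift g (by
    intro i j x y hx hy
    rcases parity_cases i with rfl | rfl <;> rcases parity_cases j with rfl | rfl
    · simp only [ZMod.val_zero, mul_zero, pow_zero, one_smul]
      exact h00 x hx y hy
    · simp only [ZMod.val_zero, zero_mul, pow_zero, one_smul]
      exact h01 x hx y hy
    -- The odd–even relation is the even–odd one, up to super antisymmetry.
    · have h := bracket_skew a (i := 1) (j := 0) hx hy
      simp only [ZMod.val_zero, mul_zero, pow_zero, one_smul] at h ⊢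
      rw [← neg_sub, h01 y hy x hx, ← map_neg, ← eq_neg_of_add_eq_zero_left h]
      rfl
    · simp only [show (1 : ZMod 2).val = 1 from rfl, mul_one, pow_one, neg_smul, one_smul,
        sub_neg_eq_add]
      exact h11 x hx y hy)

@[simp] lemma liftU_toU {A : Type*} [Ring A] [Algebra K A] (g : D21 a →ₗ[K] A) (h00) (h01) (h11)
    (x : D21 a) : liftU g h00 h01 h11 (toU a x) = g x :=
  SuperEnveloping.lift_ι _ _ _

lemma bracket_mem_zero_zero {x y : D21 a} (hx : x ∈ part a 0) (hy : y ∈ part a 0) :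
    bracket a x y ∈ part a 0 := bracket_mem a hx hy
lemma bracket_mem_zero_one {x y : D21 a} (hx : x ∈ part a 0) (hy : y ∈ part a 1) :
    bracket a x y ∈ part a 1 := bracket_mem a hx hy
lemma bracket_mem_one_one {x y : D21 a} (hx : x ∈ part a 1) (hy : y ∈ part a 1) :
    bracket a x y ∈ part a 0 := bracket_mem a hx hy

variable (a)

/-- The counit of `U(𝔤)`. -/
def counit : U a →ₐ[K] K := liftU 0 (by simp) (by simp) (by simp)

@[simp] lemma counit_toU (x : D21 a) : counit a (toU a x) = 0 := liftU_toU _ _ _ _ _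

/-- The parity automorphism of `U(𝔤)`. -/
def parityHom : U a →ₐ[K] U a :=
  liftU (toU a ∘ₗ (evenPart a - oddPart a))
    (fun x hx y hy => by
      simp [evenPart_of_mem_zero, oddPart_of_mem_zero, hx, hy, bracket_mem_zero_zero hx hy,
        toU_mul_sub_of_even_left hx hy])
    (fun x hx y hy => by
      simp [evenPart_of_mem_zero, oddPart_of_mem_zero, evenPart_of_mem_one, oddPart_of_mem_one,
        hx, hy, bracket_mem_zero_one hx hy, ← toU_mul_sub_of_even_left hx hy]
      abel)
    (fun x hx y hy => by
      simp [evenPart_of_mem_zero, oddPart_of_mem_zero, evenPart_of_mem_one, oddPart_of_mem_one,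
        hx, hy, bracket_mem_one_one hx hy, ← toU_mul_add_of_odd hx hy])

variable {a}

lemma parityHom_of_even {x : D21 a} (hx : x ∈ part a 0) : parityHom a (toU a x) = toU a x := by
  simp [parityHom, evenPart_of_mem_zero hx, oddPart_of_mem_zero hx]

lemma parityHom_of_odd {x : D21 a} (hx : x ∈ part a 1) : parityHom a (toU a x) = -toU a x := by
  simp [parityHom, evenPart_of_mem_one hx, oddPart_of_mem_one hx]

variable (a)

lemma parityHom_toU (x : D21 a) :
    parityHom a (toU a x) = toU a (evenPart a x) - toU a (oddPart a x) := by
  simp [parityHom]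

lemma evenPart_add_oddPart (x : D21 a) : evenPart a x + oddPart a x = x :=
  D21.ext (by simp [evenPart, oddPart]) (by simp [evenPart, oddPart])

/-- In the odd–odd relation of `tensorRep` parity acts twice on the left tensor factor, and this
must be the identity. -/
lemma parityHom_parityHom (u : U a) : parityHom a (parityHom a u) = u := by
  have h : (parityHom a).comp (parityHom a) = AlgHom.id K (U a) := by
    apply RingQuot.ringQuot_ext'
    apply TensorAlgebra.hom_ext
    ext x
    show parityHom a (parityHom a (toU a x)) = toU a x
    rw [parityHom_toU, map_sub, parityHom_of_even (x := evenPart a x) rfl,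
      parityHom_of_odd (x := oddPart a x) rfl, sub_neg_eq_add, ← map_add]
    rw [evenPart_add_oddPart]
  exact DFunLike.congr_fun h u

variable {a}

/-- The cyclic Jacobi identity, with `z` brought to the right by antisymmetry. In this form it says
that `x ↦ [x, ·]` is a representation. -/
lemma bracket_bracket_sub {i j k : ZMod 2} {x y z : D21 a} (hx : x ∈ part a i) (hy : y ∈ part a j)
    (hz : z ∈ part a k) :
    bracket a x (bracket a y z) - (-1 : K) ^ (i.val * j.val) • bracket a y (bracket a x z) =
      bracket a (bracket a x y) z := by
  have h1 := eq_neg_of_add_eq_zero_left (bracket_skew a hz hx)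
  have h2 := eq_neg_of_add_eq_zero_left (bracket_skew a hz (bracket_mem a hx hy))
  have h := bracket_jacobi a hx hy hz
  rw [h2, h1] at h
  rcases parity_cases i with rfl | rfl <;> rcases parity_cases j with rfl | rfl <;>
    rcases parity_cases k with rfl | rfl <;>
    simp only [show (1 : ZMod 2).val = 1 from rfl, show (1 + 1 : ZMod 2).val = 0 from rfl,
      ZMod.val_zero, add_zero, zero_add, mul_zero, mul_one, pow_zero, pow_one,
      one_smul, neg_smul, map_neg, neg_neg] at h ⊢ <;>
    first
    | rw [← sub_eq_zero, ← h]; abel1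
    | rw [← sub_eq_zero, ← neg_eq_zero, ← h]; abel1

/-- The sign does not involve `z`, so the identity extends to inhomogeneous `z` by linearity. -/
lemma bracket_bracket_sub' {i j : ZMod 2} {x y : D21 a} (hx : x ∈ part a i) (hy : y ∈ part a j)
    (z : D21 a) :
    bracket a x (bracket a y z) - (-1 : K) ^ (i.val * j.val) • bracket a y (bracket a x z) =
      bracket a (bracket a x y) z := by
  have h0 := bracket_bracket_sub hx hy (z := evenPart a z) (k := 0) rfl
  have h1 := bracket_bracket_sub hx hy (z := oddPart a z) (k := 1) rfl
  rw [← evenPart_add_oddPart a z]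
  simp only [map_add, smul_add]
  rw [← h0, ← h1]
  abel

variable (a)

/-- The adjoint representation, extended to `U(𝔤)`. -/
def adjoint : U a →ₐ[K] Module.End K (D21 a) :=
  liftU (bracket a)
    (fun x hx y hy => by
      ext1 z
      simpa using bracket_bracket_sub' hx hy z)
    (fun x hx y hy => by
      ext1 z
      simpa using bracket_bracket_sub' hx hy z)
    (fun x hx y hy => by
      ext1 z
      simpa [show (1 : ZMod 2).val = 1 from rfl] using bracket_bracket_sub' hx hy z)

@[simp] lemma adjoint_toU (x : D21 a) : adjoint a (toU a x) = bracket a x := liftU_toU _ _ _ _ _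

/-- `D(2,1;a)` has trivial centre. -/
lemma eq_zero_of_bracket_eq_zero [NeZero (2 : K)] {x : D21 a} (hx : bracket a x = 0) : x = 0 := by
  have h2 : (2 : K) ≠ 0 := NeZero.ne 2
  have hE (s : Fin 3) := congrArg D21.even (DFunLike.congr_fun hx (evenVec a s 0))
  have hF (s : Fin 3) := congrArg D21.even (DFunLike.congr_fun hx (evenVec a s 1))
  have hH (s : Fin 3) := congrArg D21.odd (DFunLike.congr_fun hx (evenVec a s 2))
  have h0 (s : Fin 3) : x.even s 2 = 0 ∧ x.even s 1 = 0 := by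
    have h := congrFun (hE s) s
    have h0 := congrFun h 0
    have h1 := congrFun h 2
    simp [bracket_even, evenVec, oddBracket_zero_right, evenBracket, sl2Bracket, h2] at h0 h1
    exact ⟨h0, h1⟩
  have h1 (s : Fin 3) : x.even s 0 = 0 := by
    have h1 := congrFun (congrFun (hF s) s) 2
    simpa [bracket_even, evenVec, oddBracket_zero_right, evenBracket, sl2Bracket, h2] using h1
  have he : x.even = 0 := by
    funext s t
    rcases fin3_cases t with rfl | rfl | rfl
    exacts [h1 s, (h0 s).2, (h0 s).1]
  refine D21.ext he ?_
  funext i j k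
  -- The element `H` of one copy of `𝔰𝔩₂` acts on the odd part with eigenvalues `±1`, so it detects
  -- every odd coordinate.
  have h := congrFun (congrFun (congrFun (hH 0) i) j) k
  rcases fin2_cases i with rfl | rfl <;>
    simpa [bracket_odd, he, evenVec, oddAct, sl2Act] using h

/-- As the centre is trivial, `x` is recovered linearly from its adjoint action, which is defined on
all of `U(𝔤)`. This supplies the degree-one functionals for the independence proof. -/
lemma exists_leftInverse_toU [NeZero (2 : K)] : ∃ g : U a →ₗ[K] D21 a, ∀ x, g (toU a x) = x := by
  obtain ⟨g, hg⟩ := LinearMap.exists_leftInverse_of_injective (bracket a)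
    (LinearMap.ker_eq_bot'.2 fun x hx => eq_zero_of_bracket_eq_zero a hx)
  refine ⟨g ∘ₗ (adjoint a).toLinearMap, fun x => ?_⟩
  simpa using DFunLike.congr_fun hg x

/-- The action of `𝔤` on `U(𝔤) ⊗ U(𝔤)`, with the sign rule for odd elements. -/
def tensorAct : D21 a →ₗ[K] Module.End K (U a ⊗[K] U a) :=
  LinearMap.rTensorHom (U a) ∘ₗ LinearMap.mul K (U a) ∘ₗ toU a +
  LinearMap.lTensorHom (U a) ∘ₗ LinearMap.mul K (U a) ∘ₗ toU a ∘ₗ evenPart a +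
  LinearMap.mulRight K (LinearMap.rTensor (U a) (parityHom a).toLinearMap) ∘ₗ
    LinearMap.lTensorHom (U a) ∘ₗ LinearMap.mul K (U a) ∘ₗ toU a ∘ₗ oddPart a

variable {a}

lemma tensorAct_of_even {x : D21 a} (hx : x ∈ part a 0) (u v : U a) :
    tensorAct a x (u ⊗ₜ v) = (toU a x * u) ⊗ₜ v + u ⊗ₜ (toU a x * v) := by
  simp [tensorAct, evenPart_of_mem_zero hx, oddPart_of_mem_zero hx]

lemma tensorAct_of_odd {x : D21 a} (hx : x ∈ part a 1) (u v : U a) :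
    tensorAct a x (u ⊗ₜ v) = (toU a x * u) ⊗ₜ v + parityHom a u ⊗ₜ (toU a x * v) := by
  simp [tensorAct, evenPart_of_mem_one hx, oddPart_of_mem_one hx]

variable (a)

/-- The action of `U(𝔤)` on `U(𝔤) ⊗ U(𝔤)`. -/
def tensorRep : U a →ₐ[K] Module.End K (U a ⊗[K] U a) :=
  liftU (tensorAct a)
    (fun x hx y hy => by
      apply TensorProduct.ext'
      intro u v
      simp only [LinearMap.sub_apply, Module.End.mul_apply, tensorAct_of_even hx,
        tensorAct_of_even hy, tensorAct_of_even (bracket_mem_zero_zero hx hy), map_add,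
        ← toU_mul_sub_of_even_left hx hy, sub_mul, TensorProduct.tmul_sub, TensorProduct.sub_tmul,
        mul_assoc]
      abel)
    (fun x hx y hy => by
      apply TensorProduct.ext'
      intro u v
      simp only [LinearMap.sub_apply, Module.End.mul_apply, tensorAct_of_even hx,
        tensorAct_of_odd hy, tensorAct_of_odd (bracket_mem_zero_one hx hy), map_add, map_mul,
        ← toU_mul_sub_of_even_left hx hy, sub_mul, TensorProduct.tmul_sub, TensorProduct.sub_tmul,
        mul_assoc, parityHom_of_even hx]
      abel)
    -- Parity changes sign when it passes an odd factor, so the mixed terms of the two orders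
    -- cancel.
    (fun x hx y hy => by
      apply TensorProduct.ext'
      intro u v
      simp only [LinearMap.add_apply, Module.End.mul_apply, tensorAct_of_odd hx,
        tensorAct_of_odd hy, tensorAct_of_even (bracket_mem_one_one hx hy), map_add, map_mul,
        ← toU_mul_add_of_odd hx hy, add_mul, TensorProduct.tmul_add, TensorProduct.add_tmul,
        mul_assoc, parityHom_of_odd hx, parityHom_of_odd hy, parityHom_parityHom,
        neg_mul, TensorProduct.neg_tmul]
      abel)

end D21

/-! ### Linear independence of ordered products -/

namespace D21

open Finset.HasAntidiagonal (antidiagonal mem_antidiagonal)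

open scoped TensorProduct

section Independence

variable {K : Type*} [Field K] {a : K} {S : Type*} {f : S → ℕ → U a} {o : S → Prop}

open Classical in
-- A product of parity eigenvectors is a parity eigenvector. Its eigenvalue enters the coproduct
-- when an odd factor passes to the right tensor factor.
lemma exists_parityHom_orderedProd
    (hpar : ∀ s n, parityHom a (f s n) = (if o s then -1 else 1 : K) ^ n • f s n) (L : List S) :
    ∃ c : (S →₀ ℕ) → K, (∀ m, c m ≠ 0) ∧
      ∀ m, parityHom a (orderedProd f L m) = c m • orderedProd f L m := by
  refine ⟨fun m => (L.map fun s => (if o s then -1 else 1 : K) ^ m s).prod, fun m => ?_,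
    fun m => ?_⟩
  · refine List.prod_ne_zero ?_
    simp only [List.mem_map, not_exists, not_and]
    intro s _
    split_ifs <;> simp
  · induction L with
    | nil => simp [orderedProd]
    | cons s L ih =>
      rw [orderedProd_cons, map_mul, hpar, ih, smul_mul_smul_comm]
      simp

open Classical in
-- The first factor acts on the coproduct of the remaining product by the Leibniz rule. A
-- decomposition of `m` is a decomposition of `m s` together with one of `m.erase s`, so no two
-- terms collect and no coefficient can vanish.
lemma exists_tensorRep_orderedProd
    (hpar : ∀ s n, parityHom a (f s n) = (if o s then -1 else 1 : K) ^ n • f s n)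
    (hten : ∀ s n, (o s → n ≤ 1) → ∀ (u v : U a) (c : K), parityHom a u = c • u →
      tensorRep a (f s n) (u ⊗ₜ v) = ∑ p ∈ antidiagonal n, (if o s then c ^ p.2 else 1) •
        ((f s p.1 * u) ⊗ₜ[K] (f s p.2 * v)))
    {L : List S} (hL : L.Nodup) :
    ∃ ε : (S →₀ ℕ) × (S →₀ ℕ) → K, (∀ p, ε p ≠ 0) ∧
      ∀ m : S →₀ ℕ, (∀ s, o s → m s ≤ 1) → (∀ s ∈ m.support, s ∈ L) →
        tensorRep a (orderedProd f L m) (1 ⊗ₜ 1) =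
          ∑ p ∈ antidiagonal m, ε p • (orderedProd f L p.1 ⊗ₜ[K] orderedProd f L p.2) := by
  induction L with
  | nil =>
    refine ⟨1, by simp, fun m _ hm => ?_⟩
    obtain rfl : m = 0 := by
      rw [← Finsupp.support_eq_empty]
      exact Finset.eq_empty_of_forall_notMem fun s hs => by simpa using hm s hs
    simp [orderedProd]
  | cons s L ih =>
    obtain ⟨hsL, hL'⟩ := List.nodup_cons.1 hL
    obtain ⟨ε, hε0, hε⟩ := ih hL'
    obtain ⟨c, hc0, hc⟩ := exists_parityHom_orderedProd hpar L
    refine ⟨fun p => ε (p.1.erase s, p.2.erase s) *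
      (if o s then c (p.1.erase s) ^ p.2 s else 1), fun p => ?_, fun m hm hmL => ?_⟩
    · refine mul_ne_zero (hε0 _) ?_
      split_ifs
      · exact pow_ne_zero _ (hc0 _)
      · exact one_ne_zero
    have herase (m : S →₀ ℕ) : orderedProd f L m = orderedProd f L (m.erase s) :=
      orderedProd_congr f fun t ht => by
        rw [Finsupp.erase_ne]; rintro rfl; exact hsL ht
    have h := hε (m.erase s)
      (fun t ht => (by
        by_cases hts : t = s
        · simp [hts]
        · rw [Finsupp.erase_ne hts]; exact hm t ht))
      (fun t ht => by
        rw [Finsupp.support_erase, Finset.mem_erase] at ht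
        exact (List.mem_cons.1 (hmL t ht.2)).resolve_left ht.1)
    rw [orderedProd_cons, map_mul, Module.End.mul_apply, herase, h, map_sum]
    simp only [map_smul, hten s (m s) (hm s) _ _ _ (hc _), Finset.smul_sum, smul_smul,
      orderedProd_cons]
    rw [← Finset.sum_product']
    refine Finset.sum_nbij'
      (fun q => (q.1.1 + Finsupp.single s q.2.1, q.1.2 + Finsupp.single s q.2.2))
      (fun p => ((p.1.erase s, p.2.erase s), (p.1 s, p.2 s))) ?_ ?_ ?_ ?_ ?_
    · rintro ⟨⟨q₁, q₂⟩, ⟨k₁, k₂⟩⟩ hq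
      simp only [Finset.mem_product, mem_antidiagonal] at hq ⊢
      rw [add_add_add_comm, hq.1, ← Finsupp.single_add, hq.2, Finsupp.erase_add_single]
    · rintro ⟨p₁, p₂⟩ hp
      simp only [Finset.mem_product, mem_antidiagonal] at hp ⊢
      rw [← hp]
      simp
    · rintro ⟨⟨q₁, q₂⟩, ⟨k₁, k₂⟩⟩ hq
      simp only [Finset.mem_product, mem_antidiagonal] at hq
      have h0 := DFunLike.congr_fun hq.1 s
      simp only [Finsupp.add_apply, Finsupp.erase_same, Nat.add_eq_zero_iff] at h0
      simp [Finsupp.erase_add, Finsupp.erase_of_notMem_support, h0.1, h0.2]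
    · rintro ⟨p₁, p₂⟩ hp
      simp [Finsupp.erase_add_single]
    · rintro ⟨⟨q₁, q₂⟩, ⟨k₁, k₂⟩⟩ hq
      simp only [Finset.mem_product, mem_antidiagonal] at hq
      have h0 := DFunLike.congr_fun hq.1 s
      simp only [Finsupp.add_apply, Finsupp.erase_same, Nat.add_eq_zero_iff] at h0
      have e1 : (q₁ + Finsupp.single s k₁).erase s = q₁ := by
        simp [Finsupp.erase_add, Finsupp.erase_of_notMem_support, h0.1]
      have e2 : (q₂ + Finsupp.single s k₂).erase s = q₂ := by
        simp [Finsupp.erase_add, Finsupp.erase_of_notMem_support, h0.2]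
      rw [herase (q₁ + _), herase (q₂ + _), e1, e2]
      simp [h0.1, h0.2]

open Classical in
/-- For each exponent there is a linear form that separates the ordered product with this exponent
from all the others of at most the same degree. -/
lemma exists_separating_form
    (h0 : ∀ s, f s 0 = 1) (hcounit : ∀ s n, n ≠ 0 → counit a (f s n) = 0)
    (hdual : ∀ s, ∃ θ : U a →ₗ[K] K, θ (f s 1) = 1 ∧ ∀ t ≠ s, θ (f t 1) = 0)
    (hpar : ∀ s n, parityHom a (f s n) = (if o s then -1 else 1 : K) ^ n • f s n)
    (hten : ∀ s n, (o s → n ≤ 1) → ∀ (u v : U a) (c : K), parityHom a u = c • u →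
      tensorRep a (f s n) (u ⊗ₜ v) = ∑ p ∈ antidiagonal n, (if o s then c ^ p.2 else 1) •
        ((f s p.1 * u) ⊗ₜ[K] (f s p.2 * v)))
    {L : List S} (hL : L.Nodup) (hmem : ∀ s, s ∈ L) (d : ℕ) :
    ∀ i : S →₀ ℕ, i.degree = d → (∀ s, o s → i s ≤ 1) →
      ∃ φ : U a →ₗ[K] K, φ (orderedProd f L i) ≠ 0 ∧
        ∀ j : S →₀ ℕ, (∀ s, o s → j s ≤ 1) → j.degree ≤ d → j ≠ i → φ (orderedProd f L j) = 0 := by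
  have hzero : orderedProd f L 0 = 1 := by simp [orderedProd, h0]
  have hone (s : S) : orderedProd f L (Finsupp.single s 1) = f s 1 := by
    rw [orderedProd, List.prod_map_eq_pow_single s, List.count_eq_one_of_mem hL (hmem s), pow_one,
      Finsupp.single_eq_same]
    intro t hts _
    rw [Finsupp.single_eq_of_ne hts, h0]
  have hcu (m : S →₀ ℕ) (hm : m ≠ 0) : counit a (orderedProd f L m) = 0 := by
    obtain ⟨s, hs⟩ := Finsupp.ne_iff.1 hm
    rw [orderedProd, map_list_prod]
    refine List.prod_eq_zero ?_
    simp only [List.map_map, List.mem_map]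
    exact ⟨s, hmem s, hcounit s _ hs⟩
  induction d using Nat.strong_induction_on with
  | _ d ih =>
    intro i hi hio
    rcases Nat.lt_or_ge d 2 with hd | hd
    · have hsmall (j : S →₀ ℕ) (hj : j.degree ≤ 1) : j = 0 ∨ ∃ s, j = Finsupp.single s 1 := by
        rcases Nat.le_one_iff_eq_zero_or_eq_one.1 hj with hj | hj
        · exact Or.inl ((Finsupp.degree_eq_zero_iff j).1 hj)
        · have : j ∈ Set.range fun s : S => Finsupp.single s 1 := by
            rw [Finsupp.range_single_one]; exact hj
          obtain ⟨s, hs⟩ := this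
          exact Or.inr ⟨s, hs.symm⟩
      rcases hsmall i (by omega) with rfl | ⟨s, rfl⟩
      · refine ⟨(counit a).toLinearMap, by simp [hzero], fun j _ _ hj0 => hcu j hj0⟩
      · obtain ⟨θ, hθ, hθ'⟩ := hdual s
        -- The correction by the counit kills the empty product and changes nothing in degree one.
        refine ⟨θ - θ 1 • (counit a).toLinearMap, ?_, fun j _ hj hjs => ?_⟩
        · simp [hone, hθ, hcounit]
        · rcases hsmall j (by omega) with rfl | ⟨t, rfl⟩
          · simp [hzero]
          · have : t ≠ s := by rintro rfl; exact hjs rfl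
            simp [hone, hθ' t this, hcounit]
    -- In degree at least two, one unit at an index `s` is split off, and the separating forms of
    -- `single s 1` and of the remainder `k` are convolved along the coproduct.
    · obtain ⟨s, hs⟩ : ∃ s, i s ≠ 0 := by
        by_contra! hcon
        have : i = 0 := Finsupp.ext hcon
        simp [this] at hi
        omega
      set k := i - Finsupp.single s 1 with hk
      have hik : Finsupp.single s 1 + k = i := by
        rw [hk, add_comm]
        exact tsub_add_cancel_of_le (by simpa using Nat.one_le_iff_ne_zero.2 hs)
      have hdeg : 1 + k.degree = d := by
        rw [← hi, ← hik, map_add, Finsupp.degree_single]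
      have hle (t : S) : Finsupp.single s 1 t ≤ i t ∧ k t ≤ i t := by
        rw [← hik, Finsupp.add_apply]; omega
      obtain ⟨φ, hφ1, hφ⟩ := ih 1 (by omega) (Finsupp.single s 1) (Finsupp.degree_single _ _)
        (fun t ht => (hle t).1.trans (hio t ht))
      obtain ⟨ψ, hψ1, hψ⟩ := ih k.degree (by omega) k rfl (fun t ht => (hle t).2.trans (hio t ht))
      obtain ⟨ε, hε0, hε⟩ := exists_tensorRep_orderedProd hpar hten hL
      let Φ : U a →ₗ[K] K := LinearMap.mul' K K ∘ₗ TensorProduct.map φ ψ ∘ₗ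
        LinearMap.applyₗ (1 ⊗ₜ[K] 1) ∘ₗ (tensorRep a).toLinearMap
      have hΦ (m : S →₀ ℕ) (hm : ∀ s, o s → m s ≤ 1) : Φ (orderedProd f L m) =
          ∑ p ∈ antidiagonal m, ε p * (φ (orderedProd f L p.1) * ψ (orderedProd f L p.2)) := by
        simp [Φ, hε m hm (fun s _ => hmem s)]
      -- Only the decomposition `(single s 1, k)` survives. If `p.1` has degree at least two, then
      -- `p.2` has smaller degree than `k` and `ψ` kills it; if `p.1` has degree at most one and
      -- differs from `single s 1`, then `φ` kills it; if `p.1 = single s 1`, then `p.2 ≠ k` and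
      -- again `ψ` does.
      have hvan (m : S →₀ ℕ) (hm : ∀ s, o s → m s ≤ 1) (hmd : m.degree ≤ d)
          (p : (S →₀ ℕ) × (S →₀ ℕ)) (hp : p ∈ antidiagonal m)
          (hpk : p ≠ (Finsupp.single s 1, k)) :
          ε p * (φ (orderedProd f L p.1) * ψ (orderedProd f L p.2)) = 0 := by
        rw [mem_antidiagonal] at hp
        have hpd : p.1.degree + p.2.degree ≤ d := by rw [← map_add, hp]; exact hmd
        have hp1 (t : S) (ht : o t) : p.1 t ≤ 1 := by
          have := hm t ht; rw [← hp, Finsupp.add_apply] at this; omega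
        have hp2 (t : S) (ht : o t) : p.2 t ≤ 1 := by
          have := hm t ht; rw [← hp, Finsupp.add_apply] at this; omega
        by_cases h1 : p.1 = Finsupp.single s 1
        · have h2 : p.2 ≠ k := fun h2 => hpk (Prod.ext h1 h2)
          have : p.1.degree = 1 := by rw [h1, Finsupp.degree_single]
          rw [hψ _ hp2 (by omega) h2]; simp
        · by_cases hd1 : p.1.degree ≤ 1
          · rw [hφ _ hp1 hd1 h1]; simp
          · rw [hψ _ hp2 (by omega) (fun h => by rw [h] at hpd; omega)]; simp
      refine ⟨Φ, ?_, fun j hj hjd hji => ?_⟩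
      · rw [hΦ i hio, Finset.sum_eq_single_of_mem (Finsupp.single s 1, k)
          (mem_antidiagonal.2 hik) (hvan i hio hi.le)]
        exact mul_ne_zero (hε0 _) (mul_ne_zero hφ1 hψ1)
      · rw [hΦ j hj]
        refine Finset.sum_eq_zero fun p hp => hvan j hj hjd p hp ?_
        rintro rfl
        exact hji ((mem_antidiagonal.1 hp).symm.trans hik)

open Classical in
-- In a linear relation, the form that separates a term of maximal degree kills all the other terms.
theorem linearIndependent_orderedProd
    (h0 : ∀ s, f s 0 = 1) (hcounit : ∀ s n, n ≠ 0 → counit a (f s n) = 0)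
    (hdual : ∀ s, ∃ θ : U a →ₗ[K] K, θ (f s 1) = 1 ∧ ∀ t ≠ s, θ (f t 1) = 0)
    (hpar : ∀ s n, parityHom a (f s n) = (if o s then -1 else 1 : K) ^ n • f s n)
    (hten : ∀ s n, (o s → n ≤ 1) → ∀ (u v : U a) (c : K), parityHom a u = c • u →
      tensorRep a (f s n) (u ⊗ₜ v) = ∑ p ∈ antidiagonal n, (if o s then c ^ p.2 else 1) •
        ((f s p.1 * u) ⊗ₜ[K] (f s p.2 * v)))
    {L : List S} (hL : L.Nodup) (hmem : ∀ s, s ∈ L) :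
    LinearIndependent K fun m : {m : S →₀ ℕ // ∀ s, o s → m s ≤ 1} => orderedProd f L m := by
  rw [linearIndependent_iff]
  intro c hc
  by_contra hne
  obtain ⟨i, hi, hmax⟩ := c.support.exists_max_image (fun m => m.1.degree)
    (Finsupp.support_nonempty_iff.2 hne)
  obtain ⟨φ, hφ1, hφ⟩ := exists_separating_form h0 hcounit hdual hpar hten hL hmem _ i.1 rfl i.2
  have h := congrArg φ hc
  rw [Finsupp.linearCombination_apply, Finsupp.sum, map_sum, map_zero,
    Finset.sum_eq_single_of_mem i hi] at h
  · rw [map_smul, smul_eq_mul] at h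
    exact (mul_ne_zero (Finsupp.mem_support_iff.1 hi) hφ1) h
  · intro j hj hji
    rw [map_smul, hφ j.1 j.2 (hmax j hj) (fun h => hji (Subtype.ext h)), smul_zero]

end Independence

end D21

/-! ### The root system in coordinates -/

namespace D21

variable {K : Type*} [Field K] {a : K}

lemma mem_oddRoots_iff_coord (α : Module.Dual K (cartan a)) :
    α ∈ oddRoots a ↔ ∀ s, α (cartanVec a s) = 1 ∨ α (cartanVec a s) = -1 := by
  rw [mem_oddRoots_iff]
  constructor
  · rintro ⟨i, j, k, rfl⟩ s
    rcases fin3_cases s with rfl | rfl | rfl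
    · rcases fin2_cases i with rfl | rfl <;> simp [eps_cartanVec]
    · rcases fin2_cases j with rfl | rfl <;> simp [eps_cartanVec]
    · rcases fin2_cases k with rfl | rfl <;> simp [eps_cartanVec]
  · intro h
    have h' (s : Fin 3) : ∃ i : Fin 2, α (cartanVec a s) = (![1, -1] i : K) := by
      rcases h s with h | h
      · exact ⟨0, by simpa using h⟩
      · exact ⟨1, by simpa using h⟩
    choose i hi using h'
    refine ⟨i 0, i 1, i 2, dual_ext a fun s => ?_⟩
    rcases fin3_cases s with rfl | rfl | rfl <;> simp [eps_cartanVec, hi]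

lemma self_mem_intRing : a ∈ intRing a := Subring.subset_closure rfl

section CharZero

variable [CharZero K]

lemma mem_evenRoots_iff_coord (α : Module.Dual K (cartan a)) :
    α ∈ evenRoots a ↔ ∃ (s : Fin 3) (e : K), (e = 1 ∨ e = -1) ∧
      ∀ t, α (cartanVec a t) = if t = s then 2 * e else 0 := by
  rw [mem_evenRoots_iff]
  constructor
  · rintro ⟨s, rfl | rfl⟩
    · exact ⟨s, 1, Or.inl rfl, fun t => by simp [eps_cartanVec, eq_comm]⟩
    · exact ⟨s, -1, Or.inr rfl, fun t => by
        by_cases h : t = s <;> simp [eps_cartanVec, h, eq_comm (a := s) (b := t)]⟩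
  · rintro ⟨s, e, rfl | rfl, h⟩
    · exact ⟨s, Or.inl (dual_ext a fun t => by simp [eps_cartanVec, h, eq_comm])⟩
    · exact ⟨s, Or.inr (dual_ext a fun t => by
        by_cases hts : t = s <;> simp [eps_cartanVec, h, hts, eq_comm (a := s) (b := t)])⟩

lemma exists_ne_ne (s t : Fin 3) : ∃ u, u ≠ s ∧ u ≠ t := by
  revert s t; decide

lemma notMem_oddRoots_of_coord_zero {α : Module.Dual K (cartan a)} {s : Fin 3}
    (h : α (cartanVec a s) = 0) : α ∉ oddRoots a := by
  intro hα
  rcases (mem_oddRoots_iff_coord α).1 hα s with h' | h' <;> simp [h] at h'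

lemma notMem_evenRoots_of_coord_ne_zero {α : Module.Dual K (cartan a)} {s t : Fin 3} (hst : s ≠ t)
    (hs : α (cartanVec a s) ≠ 0) (ht : α (cartanVec a t) ≠ 0) : α ∉ evenRoots a := by
  intro hα
  obtain ⟨u, e, -, h⟩ := (mem_evenRoots_iff_coord α).1 hα
  rw [h] at hs ht
  by_cases hsu : s = u
  · by_cases htu : t = u
    · exact hst (hsu.trans htu.symm)
    · simp [htu] at ht
  · simp [hsu] at hs

lemma oddRoots_coord_ne_zero {α : Module.Dual K (cartan a)} (hα : α ∈ oddRoots a) (s : Fin 3) :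
    α (cartanVec a s) ≠ 0 := fun h => notMem_oddRoots_of_coord_zero h hα

lemma notMem_oddRoots_of_mem_evenRoots {α : Module.Dual K (cartan a)} (hα : α ∈ evenRoots a) :
    α ∉ oddRoots a := fun h =>
  notMem_evenRoots_of_coord_ne_zero (s := 0) (t := 1) (by decide) (oddRoots_coord_ne_zero h 0)
    (oddRoots_coord_ne_zero h 1) hα

lemma neg_mem_evenRoots {α : Module.Dual K (cartan a)} (hα : α ∈ evenRoots a) :
    -α ∈ evenRoots a := by
  obtain ⟨s, e, he, h⟩ := (mem_evenRoots_iff_coord α).1 hα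
  refine (mem_evenRoots_iff_coord _).2 ⟨s, -e, by rcases he with rfl | rfl <;> simp, fun t => ?_⟩
  by_cases hts : t = s <;> simp [h, hts]

/-- In coordinates the sum has an entry `±4`, or two entries `±2` and one `0`; neither is the
pattern of a root. -/
lemma even_add_even_notMem_roots {α β : Module.Dual K (cartan a)} (hα : α ∈ evenRoots a)
    (hβ : β ∈ evenRoots a) (h : α + β ≠ 0) : α + β ∉ roots a := by
  obtain ⟨s, e, he, hs⟩ := (mem_evenRoots_iff_coord α).1 hα
  obtain ⟨t, e', he', ht⟩ := (mem_evenRoots_iff_coord β).1 hβ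
  have hne {e : K} (he : e = 1 ∨ e = -1) : 2 * e ≠ 0 := by rcases he with rfl | rfl <;> simp
  rintro (h' | h')
  · by_cases hst : s = t
    · subst hst
      have hee : e = e' := by
        by_contra hne
        have : e' = -e := by rcases he with rfl | rfl <;> rcases he' with rfl | rfl <;> simp_all
        refine h (dual_ext a fun u => ?_)
        by_cases hu : u = s <;> simp [hs, ht, this, hu]
      obtain ⟨u, e'', he'', hu⟩ := (mem_evenRoots_iff_coord _).1 h'
      have := hu s
      by_cases hsu : s = u
      · simp only [LinearMap.add_apply, hs, ht, ← hee, hsu, if_true] at this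
        rcases he with rfl | rfl <;> rcases he'' with rfl | rfl <;> norm_num at this
      · simp only [LinearMap.add_apply, hs, ht, ← hee, if_true, hsu, if_false] at this
        rcases he with rfl | rfl <;> norm_num at this
    · refine notMem_evenRoots_of_coord_ne_zero hst ?_ ?_ h'
      · simpa [hs, ht, hst] using hne he
      · simpa [hs, ht, Ne.symm hst] using hne he'
  · obtain ⟨u, hu, hu'⟩ := exists_ne_ne s t
    exact notMem_oddRoots_of_coord_zero (s := u) (by simp [hs, ht, hu, hu']) h'

lemma odd_add_self_ne_zero {γ : Module.Dual K (cartan a)} (hγ : γ ∈ oddRoots a) : γ + γ ≠ 0 := by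
  intro h
  have := DFunLike.congr_fun h (cartanVec a 0)
  rw [LinearMap.add_apply, LinearMap.zero_apply, add_self_eq_zero] at this
  exact oddRoots_coord_ne_zero hγ 0 this

/-- All three coordinates are `±2`. Hence odd root vectors square to zero in `U(𝔤)`. -/
lemma odd_add_self_notMem_roots {γ : Module.Dual K (cartan a)} (hγ : γ ∈ oddRoots a) :
    γ + γ ∉ roots a := by
  rintro (h | h)
  · refine notMem_evenRoots_of_coord_ne_zero (s := 0) (t := 1) (by decide) ?_ ?_ h <;>
      simpa using oddRoots_coord_ne_zero hγ _
  · have h1 := (mem_oddRoots_iff_coord _).1 hγ 0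
    have h2 := (mem_oddRoots_iff_coord _).1 h 0
    rw [LinearMap.add_apply] at h2
    rcases h1 with h1 | h1 <;> rw [h1] at h2 <;> norm_num at h2

/-! ### Strings of an even root through an odd root -/

section EvenOdd

variable {α γ : Module.Dual K (cartan a)}

/-- The multiples of an even root that can be added to an odd root. -/
lemma odd_add_zsmul_even (hα : α ∈ evenRoots a) (hγ : γ ∈ oddRoots a) :
    (∀ k : ℤ, γ + k • α ≠ 0 ∧ γ + k • α ∉ evenRoots a) ∧
      ((∀ k : ℤ, γ + k • α ∈ oddRoots a ↔ k = 0 ∨ k = 1) ∨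
        (∀ k : ℤ, γ + k • α ∈ oddRoots a ↔ k = 0 ∨ k = -1)) := by
  obtain ⟨s, e, he, hs⟩ := (mem_evenRoots_iff_coord α).1 hα
  have hoff (k : ℤ) (t : Fin 3) (ht : t ≠ s) :
      (γ + k • α) (cartanVec a t) = γ (cartanVec a t) := by simp [hs, ht]
  have hon (k : ℤ) : (γ + k • α) (cartanVec a s) = γ (cartanVec a s) + k * (2 * e) := by simp [hs]
  have hmem (k : ℤ) : γ + k • α ∈ oddRoots a ↔
      γ (cartanVec a s) + k * (2 * e) = 1 ∨ γ (cartanVec a s) + k * (2 * e) = -1 := by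
    rw [mem_oddRoots_iff_coord, ← hon]
    refine ⟨fun h => h s, fun h t => ?_⟩
    by_cases ht : t = s
    · rw [ht]; exact h
    · rw [hoff k t ht]; exact (mem_oddRoots_iff_coord γ).1 hγ t
  constructor
  · intro k
    obtain ⟨u, hus, -⟩ := exists_ne_ne s s
    obtain ⟨u', hus', huu'⟩ := exists_ne_ne s u
    have h1 := oddRoots_coord_ne_zero hγ u
    have h2 := oddRoots_coord_ne_zero hγ u'
    rw [← hoff k u hus] at h1
    rw [← hoff k u' hus'] at h2
    exact ⟨fun h => h1 (by rw [h]; rfl), notMem_evenRoots_of_coord_ne_zero (Ne.symm huu') h1 h2⟩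
  -- In characteristic zero the condition on the coordinate at `s` is one between integers.
  · have cast (k : ℤ) (x y : ℤ) : ((x : K) + k * (2 * (y : K)) = 1 ∨
        (x : K) + k * (2 * (y : K)) = -1) ↔ (x + k * (2 * y) = 1 ∨ x + k * (2 * y) = -1) := by
      norm_cast
    rcases (mem_oddRoots_iff_coord γ).1 hγ s with h | h <;> rcases he with rfl | rfl
    · right; intro k; rw [hmem, h]
      have := cast k 1 1
      push_cast at this; rw [this]; omega
    · left; intro k; rw [hmem, h]
      have := cast k 1 (-1)
      push_cast at this; rw [this]; omega
    · left; intro k; rw [hmem, h]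
      have := cast k (-1) 1
      push_cast at this; rw [this]; omega
    · right; intro k; rw [hmem, h]
      have := cast k (-1) (-1)
      push_cast at this; rw [this]; omega

lemma even_add_odd_ne_zero (hα : α ∈ evenRoots a) (hγ : γ ∈ oddRoots a) : α + γ ≠ 0 := by
  simpa [add_comm] using ((odd_add_zsmul_even hα hγ).1 1).1

lemma even_add_odd_notMem_evenRoots (hα : α ∈ evenRoots a) (hγ : γ ∈ oddRoots a) :
    α + γ ∉ evenRoots a := by
  simpa [add_comm] using ((odd_add_zsmul_even hα hγ).1 1).2

/-- A string through an odd root has at most two members. Therefore `X_α` commutes with `X_{α+γ}`,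
and the commutator of a divided power of `X_α` with `X_γ` has a single term. -/
lemma even_add_even_add_odd_notMem_roots (hα : α ∈ evenRoots a) (hγ : γ ∈ oddRoots a) :
    α + (α + γ) ∉ roots a := by
  have e : α + (α + γ) = γ + (2 : ℤ) • α := by rw [two_smul]; abel
  rw [e]
  rintro (h | h)
  · exact ((odd_add_zsmul_even hα hγ).1 2).2 h
  · rcases (odd_add_zsmul_even hα hγ).2 with h' | h' <;> simp [h'] at h

/-- The string begins at `γ`, that is `r = 0`, so the structure constant is `±1`. -/
lemma isString_of_even_add_odd (hα : α ∈ evenRoots a) (hγ : γ ∈ oddRoots a)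
    (h : α + γ ∈ roots a) : IsString a α γ 0 1 := by
  obtain ⟨h1, h2⟩ := odd_add_zsmul_even hα hγ
  have h3 : ∀ k : ℤ, γ + k • α ∈ oddRoots a ↔ k = 0 ∨ k = 1 := by
    rcases h2 with h2 | h2
    · exact h2
    · have := (h2 1).1 (by
        rw [one_smul, add_comm]; exact h.resolve_left (even_add_odd_notMem_evenRoots hα hγ))
      simp at this
  ext δ
  constructor
  · rintro ⟨hδ, k, rfl⟩
    refine ⟨k, ?_⟩
    rcases hδ with (hδ | hδ) | hδ
    · exact absurd hδ (h1 k).2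
    · rcases (h3 k).1 hδ with rfl | rfl <;> simp
    · exact absurd hδ (h1 k).1
  · rintro ⟨k, hk, hk', rfl⟩
    refine ⟨Or.inl (Or.inr ((h3 k).2 ?_)), k, rfl⟩
    push_cast at hk hk'
    omega

end EvenOdd

/-! ### Norms of roots and their values on coroots -/

lemma sigma_ne_zero (ha0 : a ≠ 0) (ha1 : a ≠ -1) (s : Fin 3) : sigma a s ≠ 0 := by
  have ha' : 1 + a ≠ 0 := fun h => ha1 (by linear_combination h)
  rcases fin3_cases s with rfl | rfl | rfl
  · simpa [sigma, ← neg_add_rev, add_comm a] using ha'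
  · simp [sigma]
  · simpa [sigma] using ha0

/-- The coordinates have square `1` and the three scalars `sigma` add up to zero. -/
lemma form_self_of_odd {γ : Module.Dual K (cartan a)} (hγ : γ ∈ oddRoots a) : form a γ γ = 0 := by
  have h (s : Fin 3) : γ (cartanVec a s) * γ (cartanVec a s) = 1 := by
    rcases (mem_oddRoots_iff_coord γ).1 hγ s with h | h <;> simp [h]
  simp only [form, mul_assoc, h, Fin.sum_univ_three, sigma, Matrix.cons_val]
  ring

lemma form_self_of_even (ha0 : a ≠ 0) (ha1 : a ≠ -1) {α : Module.Dual K (cartan a)}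
    (hα : α ∈ evenRoots a) : form a α α ≠ 0 := by
  obtain ⟨s, e, he, hs⟩ := (mem_evenRoots_iff_coord α).1 hα
  have : form a α α = sigma a s * 4 := by
    simp only [form, hs, mul_ite, mul_zero, ite_mul, zero_mul, Finset.sum_ite_eq',
      Finset.mem_univ, if_true]
    rcases he with rfl | rfl <;> simp <;> ring
  rw [this]
  exact mul_ne_zero (sigma_ne_zero ha0 ha1 s) (by norm_num)

lemma coroot_of_even (ha0 : a ≠ 0) (ha1 : a ≠ -1) {α : Module.Dual K (cartan a)}
    (hα : α ∈ evenRoots a) : ∃ (s : Fin 3) (e : K), (e = 1 ∨ e = -1) ∧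
      (∀ t, α (cartanVec a t) = if t = s then 2 * e else 0) ∧ coroot a α = e • cartanVec a s := by
  obtain ⟨s, h⟩ := (mem_evenRoots_iff a α).1 hα
  have hc := coroot_two_eps a s (sigma_ne_zero ha0 ha1 s)
  rcases h with rfl | rfl
  · exact ⟨s, 1, Or.inl rfl, fun t => by simp [eps_cartanVec, eq_comm], by rw [hc, one_smul]⟩
  · exact ⟨s, -1, Or.inr rfl, fun t => by
      by_cases h : t = s <;> simp [eps_cartanVec, h, eq_comm (a := s) (b := t)],
      by rw [coroot_neg, hc]; simp⟩

lemma root_apply_self_coroot (ha0 : a ≠ 0) (ha1 : a ≠ -1) {α : Module.Dual K (cartan a)}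
    (hα : α ∈ evenRoots a) : α (coroot a α) = 2 := by
  obtain ⟨s, e, he, hs, hc⟩ := coroot_of_even ha0 ha1 hα
  rw [hc, map_smul, hs]
  rcases he with rfl | rfl <;> simp

/-- The halves in `sigma` disappear. For `β` even, the coroot is `±cartanVec`; for `β` odd and `α`
even, the coordinate `±2` of `α` cancels the half. For two odd roots, the vanishing sum of `sigma`
leaves only half differences of signs. -/
lemma root_apply_coroot_mem (ha0 : a ≠ 0) (ha1 : a ≠ -1) {α β : Module.Dual K (cartan a)}
    (hα : α ∈ roots a) (hβ : β ∈ roots a) : α (coroot a β) ∈ intRing a := by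
  have hsign {e : K} (he : e = 1 ∨ e = -1) : e ∈ intRing a := by
    rcases he with rfl | rfl
    exacts [one_mem _, neg_mem (one_mem _)]
  have h2 : (2 : K) ∈ intRing a := ofNat_mem _ 2
  have ha : a ∈ intRing a := self_mem_intRing
  rcases hβ with hβ | hβ
  · obtain ⟨s, e, he, -, hc⟩ := coroot_of_even ha0 ha1 hβ
    rw [hc, map_smul, smul_eq_mul]
    refine mul_mem (hsign he) ?_
    rcases hα with hα | hα
    · obtain ⟨t, e', he', ht⟩ := (mem_evenRoots_iff_coord α).1 hα
      rw [ht]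
      split_ifs
      exacts [mul_mem h2 (hsign he'), zero_mem _]
    · exact hsign ((mem_oddRoots_iff_coord α).1 hα s)
  · rw [coroot, if_pos (form_self_of_odd hβ), map_neg]
    refine neg_mem ?_
    have hb := (mem_oddRoots_iff_coord β).1 hβ
    simp only [dualVec, map_sum, map_smul, smul_eq_mul]
    rcases hα with hα | hα
    · obtain ⟨t, e', he', ht⟩ := (mem_evenRoots_iff_coord α).1 hα
      simp only [ht, mul_ite, mul_zero, Finset.sum_ite_eq', Finset.mem_univ, if_true]
      have : sigma a t * β (cartanVec a t) * (2 * e') =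
          (2 * sigma a t) * (β (cartanVec a t) * e') := by ring
      rw [this]
      refine mul_mem ?_ (mul_mem (hsign (hb t)) (hsign he'))
      rcases fin3_cases t with rfl | rfl | rfl
      · have : 2 * sigma a 0 = -(1 + a) := by simp [sigma]; ring
        rw [this]; exact neg_mem (add_mem (one_mem _) ha)
      · simp [sigma]
      · have : 2 * sigma a 2 = a := by simp [sigma]; ring
        rw [this]; exact ha
    · have hα' := (mem_oddRoots_iff_coord α).1 hα
      have hprod (s : Fin 3) : β (cartanVec a s) * α (cartanVec a s) = 1 ∨
          β (cartanVec a s) * α (cartanVec a s) = -1 := by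
        rcases hb s with h | h <;> rcases hα' s with h' | h' <;> simp [h, h']
      simp only [mul_assoc, Fin.sum_univ_three, sigma, Matrix.cons_val]
      have key (x y z : K) : -(1 + a) / 2 * x + (1 / 2 * y + a / 2 * z) =
        (y - x) / 2 + a * ((z - x) / 2) := by ring
      rw [add_assoc, key]
      have hhalf {x y : K} (hx : x = 1 ∨ x = -1) (hy : y = 1 ∨ y = -1) :
          (y - x) / 2 ∈ intRing a := by
        rcases hx with rfl | rfl <;> rcases hy with rfl | rfl <;> norm_num
      exact add_mem (hhalf (hprod 0) (hprod 1)) (mul_mem ha (hhalf (hprod 0) (hprod 2)))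

instance finite_roots : Finite (roots a) := by
  refine Set.Finite.subset (Set.Finite.union
    (Set.finite_range fun s : Fin 3 => 2 • eps a s) (Set.Finite.union
    (Set.finite_range fun s : Fin 3 => -(2 • eps a s))
    (Set.finite_range fun p : Fin 2 × Fin 2 × Fin 2 => (![1, -1] p.1 : K) • eps a 0 +
      (![1, -1] p.2.1 : K) • eps a 1 + (![1, -1] p.2.2 : K) • eps a 2))) ?_
  rintro α (h | h)
  · obtain ⟨s, rfl | rfl⟩ := (mem_evenRoots_iff a α).1 h
    exacts [Or.inl ⟨s, rfl⟩, Or.inr (Or.inl ⟨s, rfl⟩)]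
  · obtain ⟨i, j, k, rfl⟩ := (mem_oddRoots_iff a α).1 h
    exact Or.inr (Or.inr ⟨(i, j, k), rfl⟩)

end CharZero

end D21

/-! ### Commutation relations in the Kostant superalgebra -/

section

variable {K A : Type*} [Field K] [Ring A] [Algebra K A]

lemma natDegree_binom_X_le (n : ℕ) : (binom K (Polynomial.X : Polynomial K) n).natDegree ≤ n := by
  rw [binom]
  refine (Polynomial.natDegree_smul_le _ _).trans ?_
  rw [Polynomial.aeval_X_left_apply, descPochhammer_natDegree]

variable [CharZero K]

/-- As `x` commutes with `z`, each of the `n + 1` terms of the Leibniz expansion is `z * x ^ n`, and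
`n + 1` cancels against the factorial. -/
lemma dividedPow_succ_mul_sub {x y z : A} (h : x * y - y * x = z) (hz : Commute x z) (n : ℕ) :
    dividedPow K x (n + 1) * y - y * dividedPow K x (n + 1) = z * dividedPow K x n := by
  have key (n : ℕ) : x ^ (n + 1) * y - y * x ^ (n + 1) = (n + 1) • (z * x ^ n) := by
    induction n with
    | zero => simp [h]
    | succ n ih =>
      have e : x ^ (n + 1 + 1) * y - y * x ^ (n + 1 + 1) =
          x * (x ^ (n + 1) * y - y * x ^ (n + 1)) + (x * y - y * x) * x ^ (n + 1) := by
        rw [pow_succ' x (n + 1)]; noncomm_ring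
      rw [e, ih, h, mul_smul_comm, ← mul_assoc, hz.eq, mul_assoc, ← pow_succ', ← succ_nsmul]
  have h0 : (n + 1 : K) ≠ 0 := by exact_mod_cast n.succ_ne_zero
  rw [dividedPow, dividedPow, smul_mul_assoc, mul_smul_comm, ← smul_sub, key,
    ← Nat.cast_smul_eq_nsmul K, smul_smul, mul_smul_comm, Nat.factorial_succ]
  congr 1
  push_cast
  field_simp

end

namespace D21

variable {K : Type*} [Field K] {a : K}

lemma intRing_le_binomRing : intRing a ≤ binomRing a := fun p hp =>
  Subring.subset_closure ⟨p, hp, 1, by simp⟩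

lemma binom_mem_binomRing {p : K} (hp : p ∈ intRing a) (n : ℕ) : binom K p n ∈ binomRing a :=
  Subring.subset_closure ⟨p, hp, n, rfl⟩

/-- The span over `ℤ_a` of the products of factors of total degree less than `d`. -/
noncomputable abbrev filt (H : Fin 3 → cartan a) (X : roots a → D21 a) (d : ℕ) :
    Submodule (binomRing a) (U a) :=
  wordSpan (binomRing a) (factor a H X) d

variable {H : Fin 3 → cartan a} {X : roots a → D21 a}

lemma smul_mem_filt {c : K} (hc : c ∈ binomRing a) {d : ℕ} {u : U a} (hu : u ∈ filt H X d) :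
    c • u ∈ filt H X d := Submodule.smul_mem _ (⟨c, hc⟩ : binomRing a) hu

lemma toU_X_mem_filt (α : roots a) {d : ℕ} (hd : 2 ≤ d) : toU a (X α) ∈ filt H X d := by
  have h := factor_mem_wordSpan (R := binomRing a) (factor a H X) (s := Sum.inl α) (n := 1) hd
  simpa [factor] using h

/-! ### Binomial coefficients of Cartan elements, with coefficients in `ℤ_a` -/

section CharZero

variable [CharZero K]

/-- If all binomial coefficients of `y` lie in the filtration, then so do the values at `y` of
the polynomials that are `ℤ_a`-valued on the natural numbers. -/
lemma aeval_mem_filt {y : U a} (hy : ∀ n, binom K y n ∈ filt H X (n + 1)) {p : Polynomial K}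
    {n : ℕ} (hp : p.natDegree ≤ n) (hv : ∀ j : ℕ, p.eval (j : K) ∈ binomRing a) :
    Polynomial.aeval y p ∈ filt H X (n + 1) := by
  obtain ⟨c, hc⟩ := exists_aeval_eq_sum_binom (A := U a) (binomRing a) hp hv
  rw [hc]
  refine sum_mem fun k hk => smul_mem_filt (c k).2 ?_
  exact wordSpan_mono _ (by simpa using hk) (hy k)

/-- In Vandermonde's expansion the constant contributes `binom K c k`, an element of `ℤ_a` because
`c ∈ ℤ[a]`; only `k = 0` has full degree. -/
lemma binom_add_algebraMap_sub_mem {y : U a} (hy : ∀ n, binom K y n ∈ filt H X (n + 1)) {c : K}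
    (hc : c ∈ intRing a) (n : ℕ) :
    binom K (y + algebraMap K (U a) c) n - binom K y n ∈ filt H X n := by
  have hcomm : Commute y (algebraMap K (U a) c) := (Algebra.commutes c y).symm
  rw [hcomm.binom_add]
  have hb (k : ℕ) : binom K (algebraMap K (U a) c) k = algebraMap K (U a) (binom K c k) :=
    (map_binom (Algebra.ofId K (U a)) c k).symm
  rw [← Finset.add_sum_erase _ _ (Finset.HasAntidiagonal.mem_antidiagonal.2
    (show (n, 0).1 + (n, 0).2 = n from add_zero n))]
  simp only [binom_zero, mul_one, add_sub_cancel_left]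
  refine sum_mem fun p hp => ?_
  rw [Finset.mem_erase, Finset.HasAntidiagonal.mem_antidiagonal] at hp
  rw [hb, ← Algebra.commutes, ← Algebra.smul_def]
  refine smul_mem_filt (binom_mem_binomRing hc _) (wordSpan_mono _ ?_ (hy _))
  have : p.2 ≠ 0 := fun h => hp.1 (Prod.ext (by simpa [h] using hp.2) h)
  omega

lemma binom_add_algebraMap_mem {y : U a} (hy : ∀ n, binom K y n ∈ filt H X (n + 1)) {c : K}
    (hc : c ∈ intRing a) (n : ℕ) :
    binom K (y + algebraMap K (U a) c) n ∈ filt H X (n + 1) := by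
  have h := add_mem (wordSpan_mono _ n.le_succ (binom_add_algebraMap_sub_mem hy hc n)) (hy n)
  simpa using h

/-- As a polynomial in `y` it has degree at most `n` and the value `binom K (c * j) n ∈ ℤ_a` at a
natural number `j`, so Newton interpolation applies. -/
lemma binom_smul_mem_filt {y : U a} (hy : ∀ n, binom K y n ∈ filt H X (n + 1)) {c : K}
    (hc : c ∈ intRing a) (n : ℕ) : binom K (c • y) n ∈ filt H X (n + 1) := by
  have h := aeval_mem_filt hy (n := n)
    (p := (binom K (Polynomial.X : Polynomial K) n).comp (c • Polynomial.X)) ?_ ?_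
  · rwa [Polynomial.aeval_comp, map_smul, Polynomial.aeval_X, aeval_binom_X] at h
  · refine Polynomial.natDegree_comp_le.trans ?_
    calc _ ≤ n * 1 := Nat.mul_le_mul (natDegree_binom_X_le n)
            ((Polynomial.natDegree_smul_le _ _).trans Polynomial.natDegree_X_le)
      _ = n := mul_one n
  · intro j
    rw [Polynomial.eval_comp, ← Polynomial.coe_aeval_eq_eval, aeval_binom_X]
    refine binom_mem_binomRing ?_ n
    simpa using mul_mem hc (natCast_mem _ j)

end CharZero

lemma cartan_mem_part_zero (h : cartan a) : (h : D21 a) ∈ part a 0 :=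
  ((mem_cartan_iff a _).1 h.2).1

lemma commute_toU_cartan (h h' : cartan a) : Commute (toU a (h : D21 a)) (toU a (h' : D21 a)) := by
  have e := toU_mul_sub_of_even_left (cartan_mem_part_zero h) (cartan_mem_part_zero h')
  rw [bracket_cartan_cartan a h.2 h'.2, map_zero] at e
  exact sub_eq_zero.1 e

/-- The binomial coefficients of the elements of the `ℤ[a]`-span of the `H_i` have the expected
degree. -/
lemma binom_mem_filt [CharZero K] {h : cartan a}
    (hh : h ∈ Submodule.span (intRing a) (Set.range H)) :
    ∀ n, binom K (toU a (h : D21 a)) n ∈ filt H X (n + 1) := by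
  have hH (i : Fin 3) (n : ℕ) : binom K (toU a (H i : D21 a)) n ∈ filt H X (n + 1) :=
    factor_mem_wordSpan (factor a H X) (s := Sum.inr i) n.lt_succ_self
  induction hh using Submodule.span_induction with
  | mem x hx => obtain ⟨i, rfl⟩ := hx; exact hH i
  | zero =>
    intro n
    -- Zero is treated as `0 • H 0`.
    have := binom_smul_mem_filt (hH 0) (zero_mem _) n
    simpa using this
  | add x y _ _ hx hy =>
    intro n
    rw [Submodule.coe_add, map_add, (commute_toU_cartan x y).binom_add]
    refine sum_mem fun p hp => mul_mem_wordSpan _ (hx p.1) (hy p.2) ?_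
    rw [Finset.HasAntidiagonal.mem_antidiagonal] at hp
    omega
  | smul c x _ hx =>
    intro n
    have := binom_smul_mem_filt hx c.2 n
    rwa [← map_smul] at this

/-- For root vectors the product formula is exact. For `H i`, the product of two binomial
polynomials is integer-valued on `ℕ`; the last term of its Newton expansion is the merged factor and
the others have smaller degree. -/
lemma exists_merge [CharZero K] (s : roots a ⊕ Fin 3) (m n : ℕ) : ∃ c : binomRing a,
    factor a H X s m * factor a H X s n - c • factor a H X s (m + n) ∈ filt H X (m + n) := by
  rcases s with α | i
  · refine ⟨((m + n).choose m : binomRing a), ?_⟩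
    have h := dividedPow_mul_dividedPow (K := K) (toU a (X α)) m n
    have e : (((m + n).choose m : binomRing a) : K) = ((m + n).choose m : K) := by simp
    simp only [factor, Sum.elim_inl, Subring.smul_def, e]
    rw [h, sub_self]
    exact zero_mem _
  · have hs : H i ∈ Submodule.span (intRing a) (Set.range H) := Submodule.subset_span ⟨i, rfl⟩
    obtain ⟨c, hc⟩ := exists_aeval_eq_sum_binom (A := U a) (binomRing a)
      (p := binom K (Polynomial.X : Polynomial K) m * binom K (Polynomial.X : Polynomial K) n)
      (d := m + n) (Polynomial.natDegree_mul_le.trans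
        (add_le_add (natDegree_binom_X_le m) (natDegree_binom_X_le n)))
      (fun j => by
        rw [Polynomial.eval_mul, ← Polynomial.coe_aeval_eq_eval, aeval_binom_X, aeval_binom_X]
        exact mul_mem (binom_mem_binomRing (natCast_mem _ j) m)
          (binom_mem_binomRing (natCast_mem _ j) n))
    refine ⟨c (m + n), ?_⟩
    have h := hc (toU a (H i : D21 a))
    rw [map_mul, aeval_binom_X, aeval_binom_X, Finset.sum_range_succ] at h
    simp only [factor, Sum.elim_inr, Subring.smul_def]
    rw [h, add_sub_cancel_right]
    refine sum_mem fun k hk => smul_mem_filt (c k).2 ?_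
    exact wordSpan_mono _ (Nat.succ_le_of_lt (Finset.mem_range.1 hk)) (binom_mem_filt hs k)

/-! ### Commutation of the factors modulo lower degree -/

namespace IsChevalleyBasis

lemma bracket_cartan (hB : IsChevalleyBasis a H X)
    (h : cartan a) (α : roots a) : bracket a h (X α) = α.1 h • X α := by
  have hh : h ∈ Submodule.span K (Set.range H) := by rw [hB.span_H]; trivial
  induction hh using Submodule.span_induction with
  | mem x hx => obtain ⟨i, rfl⟩ := hx; exact hB.bracket_H_X i α
  | zero => simp
  | add x y _ _ hx hy => simp [hx, hy, add_smul]
  | smul c x _ hx => simp [hx, mul_smul]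

lemma X_ne_zero (hB : IsChevalleyBasis a H X)
    (α : roots a) : X α ≠ 0 := hB.linearIndependent.ne_zero (Sum.inr α)

lemma toU_cartan_mul_sub (hB : IsChevalleyBasis a H X) (h : cartan a) (α : roots a) :
    toU a (h : D21 a) * toU a (X α) - toU a (X α) * toU a (h : D21 a) = α.1 h • toU a (X α) := by
  rw [← map_smul, ← hB.bracket_cartan]
  rcases hB.homogeneous α with hα | hα
  · exact toU_mul_sub_of_even_left (cartan_mem_part_zero h) hα
  · exact toU_mul_sub_of_even_left (cartan_mem_part_zero h) hα

lemma coroot_mem_span (hB : IsChevalleyBasis a H X) (α : roots a) :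
    coroot a α.1 ∈ Submodule.span (intRing a) (Set.range H) := by
  rw [hB.span_coroot]
  exact Submodule.subset_span ⟨α.1, α.2, rfl⟩

section CharZero

variable [CharZero K]

/-- If `X α` were odd, it would exhibit `α` as an odd root, and no root is both even and odd. -/
lemma X_mem_part_zero (hB : IsChevalleyBasis a H X)
    {α : roots a} (hα : α.1 ∈ evenRoots a) : X α ∈ part a 0 :=
  (hB.homogeneous α).resolve_right fun h => notMem_oddRoots_of_mem_evenRoots hα
    ⟨X α, h, hB.X_ne_zero α, fun h => hB.bracket_cartan h α⟩

lemma X_mem_part_one (hB : IsChevalleyBasis a H X)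
    {α : roots a} (hα : α.1 ∈ oddRoots a) : X α ∈ part a 1 :=
  (hB.homogeneous α).resolve_left fun h => notMem_oddRoots_of_mem_evenRoots
    ⟨fun h0 => oddRoots_coord_ne_zero hα 0 (by rw [h0]; rfl), X α, h, hB.X_ne_zero α,
      fun h => hB.bracket_cartan h α⟩ hα

/-- Each factor `X α` shifts `h` by `α(h)`. As a semiconjugation the rule carries over to `binom`.
-/
lemma semiconjBy_dividedPow (hB : IsChevalleyBasis a H X) (h : cartan a) (α : roots a) (n : ℕ) :
    SemiconjBy (dividedPow K (toU a (X α)) n)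
      (toU a (h : D21 a) + algebraMap K (U a) (n * α.1 h)) (toU a (h : D21 a)) := by
  have key (n : ℕ) : SemiconjBy (toU a (X α) ^ n)
      (toU a (h : D21 a) + algebraMap K (U a) (n * α.1 h)) (toU a (h : D21 a)) := by
    induction n with
    | zero => simp
    | succ n ih =>
      have e := hB.toU_cartan_mul_sub h α
      rw [sub_eq_iff_eq_add] at e
      have e' : SemiconjBy (toU a (X α)) (toU a (h : D21 a) + algebraMap K (U a) (α.1 h))
          (toU a (h : D21 a)) := by
        rw [SemiconjBy, e, mul_add, Algebra.smul_def, Algebra.commutes, add_comm]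
      have h1 := e'.add_right (Algebra.commutes (n * α.1 h) (toU a (X α))).symm
      have h2 := ih.mul_left h1
      rw [← pow_succ] at h2
      rw [add_assoc, ← map_add] at h2
      have e'' : α.1 h + n * α.1 h = (n + 1 : ℕ) * α.1 h := by push_cast; ring
      rwa [e''] at h2
  rw [dividedPow, SemiconjBy, smul_mul_assoc, mul_smul_comm, (key n).eq]

/-- The super bracket of `X γ` with itself is `2 X_γ²`, and it is zero because `2γ` is not a root.
-/
lemma odd_sq (hB : IsChevalleyBasis a H X)
    {γ : roots a} (hγ : γ.1 ∈ oddRoots a) : toU a (X γ) * toU a (X γ) = 0 := by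
  have h := toU_mul_add_of_odd (hB.X_mem_part_one hγ) (hB.X_mem_part_one hγ)
  rw [hB.bracket_of_not_root γ γ (odd_add_self_ne_zero hγ) (odd_add_self_notMem_roots hγ),
    map_zero, ← two_smul K] at h
  exact (smul_eq_zero.1 h).resolve_left two_ne_zero

/-- Words carry arbitrary exponents. Since those from `2` on contribute zero at an odd index, even
and odd roots can share one kind of factor. -/
lemma factor_odd (hB : IsChevalleyBasis a H X)
    {γ : roots a} (hγ : γ.1 ∈ oddRoots a) {n : ℕ} (hn : 2 ≤ n) :
    factor a H X (Sum.inl γ) n = 0 := by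
  obtain ⟨k, rfl⟩ := Nat.exists_eq_add_of_le hn
  simp [factor, dividedPow, pow_add, pow_two, hB.odd_sq hγ]

lemma toU_coroot_mem_filt (hB : IsChevalleyBasis a H X) (α : roots a) {d : ℕ} (hd : 2 ≤ d) :
    toU a (coroot a α.1 : D21 a) ∈ filt H X d := by
  have h := binom_mem_filt (X := X) (hB.coroot_mem_span α) 1
  rw [binom_one] at h
  exact wordSpan_mono _ hd h

lemma commute_even_even (hB : IsChevalleyBasis a H X)
    {α β : roots a} (hα : α.1 ∈ evenRoots a) (hβ : β.1 ∈ evenRoots a)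
    (h : β.1 ≠ -α.1) : Commute (toU a (X α)) (toU a (X β)) := by
  have h0 : α.1 + β.1 ≠ 0 := fun h0 => h (eq_neg_of_add_eq_zero_right h0)
  have e := toU_mul_sub_of_even_left (hB.X_mem_part_zero hα) (hB.X_mem_part_zero hβ)
  rw [hB.bracket_of_not_root α β h0 (even_add_even_notMem_roots hα hβ h0), map_zero] at e
  exact sub_eq_zero.1 e

/-- The `H i` need not be coroots, but they lie in the `ℤ[a]`-span of the coroots. -/
lemma root_apply_H_mem (hB : IsChevalleyBasis a H X) (ha0 : a ≠ 0) (ha1 : a ≠ -1)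
    (α : roots a) (i : Fin 3) : α.1 (H i) ∈ intRing a := by
  have h : H i ∈ Submodule.span (intRing a) (coroot a '' roots a) := by
    rw [← hB.span_coroot]; exact Submodule.subset_span ⟨i, rfl⟩
  generalize H i = x at h
  induction h using Submodule.span_induction with
  | mem x hx => obtain ⟨β, hβ, rfl⟩ := hx; exact root_apply_coroot_mem ha0 ha1 α.2 hβ
  | zero => simp
  | add x y _ _ hx hy => rw [map_add]; exact add_mem hx hy
  | smul c x _ hx =>
    have : α.1 (c • x) = c * α.1 x := map_smul α.1 (c : K) x
    rw [this]; exact mul_mem c.2 hx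

/-- `X α`, `X β` and the coroot form an `𝔰𝔩₂`-triple. In Kostant's formula the summand `k = 0` is
the reversed product, and the `k`-th one has degree at most `m + n - k`; its binomial is that of the
coroot shifted by an integer. -/
lemma swap_even_neg (hB : IsChevalleyBasis a H X) (ha0 : a ≠ 0) (ha1 : a ≠ -1)
    {α β : roots a} (hα : α.1 ∈ evenRoots a) (h : β.1 = -α.1) (m n : ℕ) :
    dividedPow K (toU a (X α)) m * dividedPow K (toU a (X β)) n -
      dividedPow K (toU a (X β)) n * dividedPow K (toU a (X α)) m ∈ filt H X (m + n) := by
  have hβ : β.1 ∈ evenRoots a := h ▸ neg_mem_evenRoots hα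
  have h2 := root_apply_self_coroot ha0 ha1 hα
  have hEF := toU_mul_sub_of_even_left (hB.X_mem_part_zero hα) (hB.X_mem_part_zero hβ)
  rw [hB.bracket_neg α β h, rootSign,
    if_neg fun h => notMem_oddRoots_of_mem_evenRoots hα h.1, one_smul] at hEF
  have hHE := hB.toU_cartan_mul_sub (coroot a α.1) α
  have hHF := hB.toU_cartan_mul_sub (coroot a α.1) β
  rw [h2, Algebra.smul_def, map_ofNat] at hHE
  rw [h, LinearMap.neg_apply, h2, Algebra.smul_def, map_neg, map_ofNat] at hHF
  rw [dividedPow_mul_dividedPow_of_sl2 hEF hHE hHF, Finset.sum_range_succ']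
  simp only [zero_le, if_true, Nat.sub_zero, binom_zero, mul_one, add_sub_cancel_right]
  refine sum_mem fun k hk => ?_
  have hk : k < m := Finset.mem_range.1 hk
  by_cases hkn : k + 1 ≤ n
  · rw [if_pos hkn]
    have e : toU a (coroot a α.1 : D21 a) - m - n + 2 * (k + 1 : ℕ) =
        toU a (coroot a α.1 : D21 a) + algebraMap K (U a) (-m - n + 2 * (k + 1 : ℕ)) := by
      simp only [map_add, map_sub, map_neg, map_mul, map_natCast, map_ofNat]
      abel
    rw [e]
    have hb := binom_add_algebraMap_mem (binom_mem_filt (X := X) (hB.coroot_mem_span α))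
      (c := -m - n + 2 * (k + 1 : ℕ)) (add_mem (sub_mem (neg_mem (natCast_mem _ m))
        (natCast_mem _ n)) (mul_mem (ofNat_mem _ 2) (natCast_mem _ _))) (k + 1)
    have hF : dividedPow K (toU a (X β)) (n - (k + 1)) ∈ filt H X (n - (k + 1) + 1) :=
      factor_mem_wordSpan (factor a H X) (s := Sum.inl β) (Nat.lt_succ_self _)
    have hE : dividedPow K (toU a (X α)) (m - (k + 1)) ∈ filt H X (m - (k + 1) + 1) :=
      factor_mem_wordSpan (factor a H X) (s := Sum.inl α) (Nat.lt_succ_self _)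
    exact mul_mem_wordSpan _ (mul_mem_wordSpan _ hF hb (k := n + 1) (by omega)) hE (by omega)
  · simp [hkn]

lemma swap_even_even (hB : IsChevalleyBasis a H X) (ha0 : a ≠ 0) (ha1 : a ≠ -1)
    {α β : roots a} (hα : α.1 ∈ evenRoots a) (hβ : β.1 ∈ evenRoots a) (m n : ℕ) :
    dividedPow K (toU a (X α)) m * dividedPow K (toU a (X β)) n -
      dividedPow K (toU a (X β)) n * dividedPow K (toU a (X α)) m ∈ filt H X (m + n) := by
  by_cases h : β.1 = -α.1
  · exact hB.swap_even_neg ha0 ha1 hα h m n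
  · rw [(((hB.commute_even_even hα hβ h).dividedPow_right n).dividedPow_left m).eq, sub_self]
    exact zero_mem _

/-- The commutator is zero or a single term `±X_{α+γ} X_α^{(m-1)}`, whose degree is `m`. -/
lemma swap_even_odd (hB : IsChevalleyBasis a H X) (ha0 : a ≠ 0) (ha1 : a ≠ -1)
    {α γ : roots a} (hα : α.1 ∈ evenRoots a) (hγ : γ.1 ∈ oddRoots a) (m : ℕ) :
    dividedPow K (toU a (X α)) m * toU a (X γ) - toU a (X γ) * dividedPow K (toU a (X α)) m ∈
      filt H X (m + 1) := by
  have e := toU_mul_sub_of_even_left (hB.X_mem_part_zero hα) (hB.X_mem_part_one hγ)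
  cases m with
  | zero => simp
  | succ m =>
    by_cases h : α.1 + γ.1 ∈ roots a
    · have hδo : α.1 + γ.1 ∈ oddRoots a := h.resolve_left (even_add_odd_notMem_evenRoots hα hγ)
      obtain ⟨c, hc, hcb⟩ := hB.bracket_of_string α γ ⟨_, h⟩ rfl
        (Or.inl (form_self_of_even ha0 ha1 hα)) 0 1 (isString_of_even_add_odd hα hγ h)
      have hcR : c ∈ binomRing a := by
        rcases hc with rfl | rfl <;> simp
      have e' := toU_mul_sub_of_even_left (hB.X_mem_part_zero hα)
        (hB.X_mem_part_one (α := ⟨_, h⟩) hδo)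
      rw [hB.bracket_of_not_root α ⟨_, h⟩ (even_add_odd_ne_zero hα hδo)
        (even_add_even_add_odd_notMem_roots hα hγ), map_zero] at e'
      rw [hcb, map_smul] at e
      rw [dividedPow_succ_mul_sub e (Commute.smul_right (sub_eq_zero.1 e') c), smul_mul_assoc]
      refine smul_mem_filt hcR (mul_mem_wordSpan _ (toU_X_mem_filt _ le_rfl)
        (factor_mem_wordSpan (factor a H X) (s := Sum.inl α) (Nat.lt_succ_self m)) (by omega))
    · rw [hB.bracket_of_not_root α γ (even_add_odd_ne_zero hα hγ) h, map_zero] at e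
      have : Commute (toU a (X α)) (toU a (X γ)) := sub_eq_zero.1 e
      rw [(this.dividedPow_left _).eq, sub_self]
      exact zero_mem _

/-- The anticommutator lies in `𝔤`: it is `±` a coroot, a multiple of a root vector by `±δ(H_γ) ∈
ℤ[a]`, or zero. -/
lemma swap_odd_odd (hB : IsChevalleyBasis a H X) (ha0 : a ≠ 0) (ha1 : a ≠ -1)
    {γ δ : roots a} (hγ : γ.1 ∈ oddRoots a) (hδ : δ.1 ∈ oddRoots a) :
    toU a (X γ) * toU a (X δ) + toU a (X δ) * toU a (X γ) ∈ filt H X 2 := by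
  rw [toU_mul_add_of_odd (hB.X_mem_part_one hγ) (hB.X_mem_part_one hδ)]
  by_cases h0 : γ.1 + δ.1 = 0
  · rw [hB.bracket_neg γ δ (eq_neg_of_add_eq_zero_right h0), map_smul]
    refine smul_mem_filt ?_ (hB.toU_coroot_mem_filt γ le_rfl)
    rw [rootSign]
    split_ifs
    exacts [neg_mem (one_mem _), one_mem _]
  · by_cases h : γ.1 + δ.1 ∈ roots a
    · obtain ⟨c, hc, hcb⟩ := hB.bracket_of_isotropic γ δ ⟨_, h⟩ rfl (form_self_of_odd hγ)
        (form_self_of_odd hδ)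
      have hcR : c ∈ binomRing a := by
        have := intRing_le_binomRing (root_apply_coroot_mem ha0 ha1 δ.2 γ.2)
        rcases hc with rfl | rfl
        exacts [this, neg_mem this]
      rw [hcb, map_smul]
      exact smul_mem_filt hcR (toU_X_mem_filt _ le_rfl)
    · rw [hB.bracket_of_not_root γ δ h0 h, map_zero]
      exact zero_mem _

/-- Passing the divided power shifts `H i` by `n α(H i) ∈ ℤ[a]`, which changes `binom` only in lower
degree. -/
lemma swap_cartan_root (hB : IsChevalleyBasis a H X) (ha0 : a ≠ 0) (ha1 : a ≠ -1)
    (i : Fin 3) (α : roots a) (m n : ℕ) :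
    binom K (toU a (H i : D21 a)) m * dividedPow K (toU a (X α)) n -
      dividedPow K (toU a (X α)) n * binom K (toU a (H i : D21 a)) m ∈ filt H X (m + n) := by
  have hs : H i ∈ Submodule.span (intRing a) (Set.range H) := Submodule.subset_span ⟨i, rfl⟩
  rw [← ((hB.semiconjBy_dividedPow (H i) α n).binom m).eq, ← mul_sub]
  refine mul_mem_wordSpan _
    (factor_mem_wordSpan (factor a H X) (s := Sum.inl α) (Nat.lt_succ_self n))
    (binom_add_algebraMap_sub_mem (binom_mem_filt hs) ?_ m) (by omega)
  exact mul_mem (natCast_mem _ n) (hB.root_apply_H_mem ha0 ha1 α i)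

/-- The scalar is `-1` for two odd root vectors, both with exponent one, and `1` otherwise. -/
lemma exists_swap (hB : IsChevalleyBasis a H X) (ha0 : a ≠ 0) (ha1 : a ≠ -1)
    (s t : roots a ⊕ Fin 3) (m n : ℕ) : ∃ c : binomRing a,
    factor a H X s m * factor a H X t n - c • (factor a H X t n * factor a H X s m) ∈
      filt H X (m + n) := by
  have symm {x y : U a} {m n : ℕ} (h : x * y - y * x ∈ filt H X (m + n)) :
      ∃ c : binomRing a, y * x - c • (x * y) ∈ filt H X (n + m) :=
    ⟨1, by rw [one_smul, ← neg_sub, add_comm]; exact neg_mem h⟩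
  have one {x y : U a} {m n : ℕ} (h : x * y - y * x ∈ filt H X (m + n)) :
      ∃ c : binomRing a, x * y - c • (y * x) ∈ filt H X (m + n) := ⟨1, by rwa [one_smul]⟩
  have even_odd {α γ : roots a} (hα : α.1 ∈ evenRoots a) (hγ : γ.1 ∈ oddRoots a) (m n : ℕ) :
      factor a H X (Sum.inl α) m * factor a H X (Sum.inl γ) n -
        factor a H X (Sum.inl γ) n * factor a H X (Sum.inl α) m ∈ filt H X (m + n) := by
    rcases n with _ | _ | n
    · simp [factor]
    · simpa [factor] using hB.swap_even_odd ha0 ha1 hα hγ m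
    · simp [hB.factor_odd hγ (show 2 ≤ n + 1 + 1 by omega)]
  rcases s with α | i <;> rcases t with β | j
  · rcases α.2 with hα | hα <;> rcases β.2 with hβ | hβ
    · exact one (hB.swap_even_even ha0 ha1 hα hβ m n)
    · exact one (even_odd hα hβ m n)
    · exact symm (even_odd hβ hα n m)
    · rcases m with _ | _ | m
      · exact one (by simp [factor])
      · rcases n with _ | _ | n
        · exact one (by simp [factor])
        · refine ⟨-1, ?_⟩
          simpa [factor] using hB.swap_odd_odd ha0 ha1 hα hβ
        · exact one (by simp [hB.factor_odd hβ (show 2 ≤ n + 1 + 1 by omega)])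
      · exact one (by simp [hB.factor_odd hα (show 2 ≤ m + 1 + 1 by omega)])
  · exact symm (hB.swap_cartan_root ha0 ha1 j α n m)
  · exact one (hB.swap_cartan_root ha0 ha1 i β m n)
  · refine one ?_
    have := ((commute_toU_cartan (H i) (H j)).binom_right (K := K) n).binom_left (K := K) m
    simp [factor, this.eq]

end CharZero

end IsChevalleyBasis

end D21

/-! ### The basis of the Kostant superalgebra -/

lemma dividedPow_neg {K A : Type*} [Field K] [Ring A] [Algebra K A] (y : A) (n : ℕ) :
    dividedPow K (-y) n = (-1 : K) ^ n • dividedPow K y n := by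
  rcases n.even_or_odd with h | h <;> simp [dividedPow, h.neg_pow]

lemma List.prod_map_filter_eq {α M : Type*} [Monoid M] (p : α → Bool) (g : α → M) (l : List α)
    (h : ∀ x ∈ l, p x = false → g x = 1) : ((l.filter p).map g).prod = (l.map g).prod := by
  induction l with
  | nil => rfl
  | cons x l ih =>
    have ih := ih fun y hy => h y (List.mem_cons_of_mem _ hy)
    cases hx : p x
    · rw [List.filter_cons_of_neg (by simp [hx]), ih, List.map_cons, List.prod_cons,
        h x List.mem_cons_self hx, one_mul]
    · rw [List.filter_cons_of_pos hx, List.map_cons, List.prod_cons, ih, List.map_cons,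
        List.prod_cons]

lemma Finset.sort_eq_filter_sort {α : Type*} (r : α → α → Prop) [DecidableRel r] [IsTrans α r]
    [Std.Antisymm r] [Std.Total r] [DecidableEq α] {s t : Finset α} (h : s ⊆ t) :
    s.sort r = (t.sort r).filter (fun x => decide (x ∈ s)) := by
  refine List.Perm.eq_of_pairwise' (r := r) (s.pairwise_sort r)
    ((t.pairwise_sort r).sublist List.filter_sublist) ?_
  refine (List.perm_ext_iff_of_nodup (s.sort_nodup r) ((t.sort_nodup r).filter _)).2 fun x => ?_
  simp only [Finset.mem_sort, List.mem_filter, decide_eq_true_eq]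
  exact ⟨fun hx => ⟨h hx, hx⟩, fun hx => hx.2⟩

namespace D21

open Finset.HasAntidiagonal (antidiagonal mem_antidiagonal)

open scoped TensorProduct

variable {K : Type*} [Field K] {a : K} {H : Fin 3 → cartan a} {X : roots a → D21 a}

/-- The indices of the odd root vectors. -/
def IsOddIndex (s : roots a ⊕ Fin 3) : Prop :=
  Sum.elim (fun γ => γ.1 ∈ oddRoots a) (fun _ => False) s

lemma factor_zero (s : roots a ⊕ Fin 3) : factor a H X s 0 = 1 := by
  rcases s with α | i <;> simp [factor]

open Classical in
-- Factors with exponent zero are `1`, so the sorted support may be replaced by one sorted list of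
-- all indices, the same for every exponent.
lemma monomial_eq_orderedProd [Fintype (roots a ⊕ Fin 3)]
    (r : roots a ⊕ Fin 3 → roots a ⊕ Fin 3 → Prop) [IsLinearOrder (roots a ⊕ Fin 3) r]
    (n : Exponent a) :
    monomial a H X r n = orderedProd (factor a H X) (Finset.univ.sort r) n.1 := by
  rw [monomial, orderedProd, Finset.sort_eq_filter_sort r (Finset.subset_univ n.1.support)]
  refine List.prod_map_filter_eq _ _ _ fun s _ hs => ?_
  have : n.1 s = 0 := by simpa using hs
  rw [this, factor_zero]

/-- The action of `U(𝔤)` on the left factor of `U(𝔤) ⊗ U(𝔤)`. -/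
noncomputable def leftAct (a : K) : U a →ₐ[K] Module.End K (U a ⊗[K] U a) :=
  (Module.End.rTensorAlgHom K (U a) (U a)).comp (Algebra.lmul K (U a))

/-- The action of `U(𝔤)` on the right factor of `U(𝔤) ⊗ U(𝔤)`. -/
noncomputable def rightAct (a : K) : U a →ₐ[K] Module.End K (U a ⊗[K] U a) :=
  (Module.End.lTensorAlgHom K (U a) (U a)).comp (Algebra.lmul K (U a))

lemma leftAct_tmul (y u v : U a) : leftAct a y (u ⊗ₜ v) = (y * u) ⊗ₜ v := rfl

lemma rightAct_tmul (y u v : U a) : rightAct a y (u ⊗ₜ v) = u ⊗ₜ (y * v) := rfl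

lemma commute_leftAct_rightAct (y z : U a) : Commute (leftAct a y) (rightAct a z) := by
  apply TensorProduct.ext'
  intro u v
  simp [leftAct_tmul, rightAct_tmul]

lemma tensorRep_toU (x : D21 a) : tensorRep a (toU a x) = tensorAct a x := liftU_toU _ _ _ _ _

lemma tensorRep_of_even {x : D21 a} (hx : x ∈ part a 0) :
    tensorRep a (toU a x) = leftAct a (toU a x) + rightAct a (toU a x) := by
  rw [tensorRep_toU]
  apply TensorProduct.ext'
  intro u v
  simp [tensorAct_of_even hx, leftAct_tmul, rightAct_tmul]

/-! ### Coproducts of the factors, and the basis -/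

section CharZero

variable [CharZero K]

/-- The actions on the two tensor factors commute, so the binomial theorem for divided powers holds
for their sum, without coefficients. -/
lemma tensorRep_dividedPow_of_even {x : D21 a} (hx : x ∈ part a 0) (n : ℕ) (u v : U a) :
    tensorRep a (dividedPow K (toU a x) n) (u ⊗ₜ v) = ∑ p ∈ antidiagonal n,
      (dividedPow K (toU a x) p.1 * u) ⊗ₜ[K] (dividedPow K (toU a x) p.2 * v) := by
  rw [map_dividedPow, tensorRep_of_even hx, (commute_leftAct_rightAct _ _).dividedPow_add]
  simp [← map_dividedPow, leftAct_tmul, rightAct_tmul]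

lemma tensorRep_binom_of_even {x : D21 a} (hx : x ∈ part a 0) (n : ℕ) (u v : U a) :
    tensorRep a (binom K (toU a x) n) (u ⊗ₜ v) = ∑ p ∈ antidiagonal n,
      (binom K (toU a x) p.1 * u) ⊗ₜ[K] (binom K (toU a x) p.2 * v) := by
  rw [map_binom, tensorRep_of_even hx, (commute_leftAct_rightAct _ _).binom_add]
  simp [← map_binom, leftAct_tmul, rightAct_tmul]

/-- The filtration contains the generators and is multiplicative, so its union is closed under the
algebra operations. -/
lemma exists_mem_filt {u : U a} (hu : u ∈ kostant a H X) : ∃ d, u ∈ filt H X d := by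
  induction hu using Algebra.adjoin_induction with
  | mem x hx =>
    rcases hx with (⟨α, -, n, rfl⟩ | ⟨γ, -, rfl⟩) | ⟨h, hh, n, rfl⟩
    · exact ⟨n + 1, factor_mem_wordSpan (factor a H X) (s := Sum.inl α) n.lt_succ_self⟩
    · exact ⟨2, toU_X_mem_filt γ le_rfl⟩
    · exact ⟨n + 1, binom_mem_filt hh n⟩
  | algebraMap c =>
    refine ⟨1, ?_⟩
    rw [Algebra.algebraMap_eq_smul_one]
    exact Submodule.smul_mem _ c (one_mem_wordSpan _ one_pos)
  | add x y _ _ hx hy =>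
    obtain ⟨d, hd⟩ := hx
    obtain ⟨e, he⟩ := hy
    exact ⟨max d e, add_mem (wordSpan_mono _ (le_max_left _ _) hd)
      (wordSpan_mono _ (le_max_right _ _) he)⟩
  | mul x y _ _ hx hy =>
    obtain ⟨d, hd⟩ := hx
    obtain ⟨e, he⟩ := hy
    exact ⟨d + e, mul_mem_wordSpan _ hd he (Nat.le_succ _)⟩

namespace IsChevalleyBasis

open Classical in
lemma parityHom_factor (hB : IsChevalleyBasis a H X)
    (s : roots a ⊕ Fin 3) (n : ℕ) : parityHom a (factor a H X s n) =
    (if IsOddIndex s then -1 else 1 : K) ^ n • factor a H X s n := by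
  rcases s with α | i
  · simp only [factor, Sum.elim_inl, map_dividedPow]
    by_cases h : α.1 ∈ oddRoots a
    · have hs : IsOddIndex (Sum.inl α : roots a ⊕ Fin 3) := h
      rw [parityHom_of_odd (hB.X_mem_part_one h), dividedPow_neg, if_pos hs]
    · have hs : ¬IsOddIndex (Sum.inl α : roots a ⊕ Fin 3) := h
      rw [parityHom_of_even (hB.X_mem_part_zero (α.2.resolve_right h)), if_neg hs, one_pow,
        one_smul]
  · simp only [factor, Sum.elim_inr, map_binom]
    have hs : ¬IsOddIndex (Sum.inr i : roots a ⊕ Fin 3) := id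
    rw [parityHom_of_even (cartan_mem_part_zero (H i)), if_neg hs, one_pow, one_smul]

open Classical in
lemma tensorRep_factor (hB : IsChevalleyBasis a H X)
    (s : roots a ⊕ Fin 3) (n : ℕ) (hn : IsOddIndex s → n ≤ 1) (u v : U a)
    (c : K) (hu : parityHom a u = c • u) :
    tensorRep a (factor a H X s n) (u ⊗ₜ v) = ∑ p ∈ antidiagonal n,
      (if IsOddIndex s then c ^ p.2 else 1) •
        ((factor a H X s p.1 * u) ⊗ₜ[K] (factor a H X s p.2 * v)) := by
  rcases s with α | i
  · by_cases h : α.1 ∈ oddRoots a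
    · have hs : IsOddIndex (Sum.inl α : roots a ⊕ Fin 3) := h
      simp only [if_pos hs]
      have := hn hs
      interval_cases n
      · simp [factor]
      · simp only [factor, Sum.elim_inl, dividedPow_one]
        rw [tensorRep_toU, tensorAct_of_odd (hB.X_mem_part_one h), hu]
        simp [Finset.Nat.antidiagonal_succ, TensorProduct.smul_tmul', add_comm]
    · have hs : ¬IsOddIndex (Sum.inl α : roots a ⊕ Fin 3) := h
      simp only [if_neg hs, one_smul]
      exact tensorRep_dividedPow_of_even (hB.X_mem_part_zero (α.2.resolve_right h)) n u v
  · have hs : ¬IsOddIndex (Sum.inr i : roots a ⊕ Fin 3) := id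
    simp only [if_neg hs, one_smul]
    exact tensorRep_binom_of_even (cartan_mem_part_zero (H i)) n u v

/-- These are the coordinates with respect to the Chevalley basis, pulled back to `U(𝔤)` by a left
inverse of `toU`. `Sum.swap` occurs because the basis lists the `H i` first and `factor` lists the
roots first. -/
lemma exists_dual (hB : IsChevalleyBasis a H X) (s : roots a ⊕ Fin 3) : ∃ θ : U a →ₗ[K] K,
    θ (factor a H X s 1) = 1 ∧ ∀ t ≠ s, θ (factor a H X t 1) = 0 := by
  obtain ⟨g, hg⟩ := exists_leftInverse_toU a
  obtain ⟨G, hG⟩ := LinearMap.exists_leftInverse_of_injective _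
    (LinearMap.ker_eq_bot.2 hB.linearIndependent)
  have key (t : roots a ⊕ Fin 3) : G (g (factor a H X t 1)) = Finsupp.single t.swap 1 := by
    have h1 : factor a H X t 1 = toU a (Sum.elim (fun i => (H i : D21 a)) X t.swap) := by
      rcases t with α | i <;> simp [factor]
    have h2 := DFunLike.congr_fun hG (Finsupp.single t.swap 1)
    rw [h1, hg]
    simpa using h2
  refine ⟨Finsupp.lapply s.swap ∘ₗ G ∘ₗ g, ?_, fun t hts => ?_⟩
  · simp [key]
  · have : s.swap ≠ t.swap := fun h => hts (Sum.swap_leftInverse.injective h).symm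
    simp [key, Finsupp.single_eq_of_ne this]

lemma linearIndependent_orderedProd_factor (hB : IsChevalleyBasis a H X)
    {L : List (roots a ⊕ Fin 3)} (hL : L.Nodup)
    (hmem : ∀ s, s ∈ L) :
    LinearIndependent K fun n : Exponent a => orderedProd (factor a H X) L n.1 := by
  have h := linearIndependent_orderedProd (f := factor a H X) (o := IsOddIndex) factor_zero
    (fun s n hn => by
      rcases s with α | i
      · simp [factor, dividedPow, hn]
      · obtain ⟨k, rfl⟩ := Nat.exists_eq_succ_of_ne_zero hn
        -- The descending factorial of positive degree has the factor `X`, hence vanishes at the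
        -- counit of `H i`, which is `0`.
        simp [factor, binom, descPochhammer_succ_left])
    hB.exists_dual hB.parityHom_factor hB.tensorRep_factor hL hmem
  refine h.comp (fun n : Exponent a => ⟨n.1, fun s hs => ?_⟩) fun n n' hnn => ?_
  · rcases s with γ | i
    · exact n.2 γ hs
    · exact hs.elim
  · exact Subtype.ext (Subtype.mk.inj hnn)

lemma factor_mem_kostant (hB : IsChevalleyBasis a H X)
    (s : roots a ⊕ Fin 3) (n : ℕ) : factor a H X s n ∈ kostant a H X := by
  rcases s with α | i
  · rcases α.2 with hα | hα
    · exact Algebra.subset_adjoin (Or.inl (Or.inl ⟨α, hα, n, rfl⟩))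
    · rcases n with _ | _ | n
      · rw [factor_zero]; exact one_mem _
      · refine Algebra.subset_adjoin (Or.inl (Or.inr ⟨α, hα, ?_⟩))
        simp [factor]
      · rw [hB.factor_odd hα (by omega)]; exact zero_mem _
  · exact Algebra.subset_adjoin (Or.inr ⟨H i, Submodule.subset_span ⟨i, rfl⟩, n, rfl⟩)

lemma orderedProd_mem_kostant (hB : IsChevalleyBasis a H X)
    (L : List (roots a ⊕ Fin 3)) (m : (roots a ⊕ Fin 3) →₀ ℕ) :
    orderedProd (factor a H X) L m ∈ kostant a H X := by
  refine list_prod_mem fun x hx => ?_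
  obtain ⟨s, -, rfl⟩ := List.mem_map.1 hx
  exact hB.factor_mem_kostant s _

/-- Straightening yields ordered products with arbitrary exponents; those with an exponent of at
least two at an odd root vanish. -/
lemma mem_span_of_mem_kostant (hB : IsChevalleyBasis a H X)
    (ha0 : a ≠ 0) (ha1 : a ≠ -1) {L : List (roots a ⊕ Fin 3)}
    (hL : L.Nodup) (hmem : ∀ s, s ∈ L) {u : U a} (hu : u ∈ kostant a H X) :
    u ∈ Submodule.span (binomRing a)
      (Set.range fun n : Exponent a => orderedProd (factor a H X) L n.1) := by
  obtain ⟨d, hd⟩ := exists_mem_filt hu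
  have h := wordSpan_le_span_orderedProd (fun s t m n _ => hB.exists_swap ha0 ha1 s t m n)
    exists_merge factor_zero hL hmem d hd
  refine Submodule.span_le.2 ?_ h
  rintro _ ⟨m, rfl⟩
  by_cases hm : ∀ γ : roots a, γ.1 ∈ oddRoots a → m (Sum.inl γ) ≤ 1
  · exact Submodule.subset_span ⟨⟨m, hm⟩, rfl⟩
  · push Not at hm
    obtain ⟨γ, hγ, hγm⟩ := hm
    have : orderedProd (factor a H X) L m = 0 :=
      List.prod_eq_zero (List.mem_map.2 ⟨Sum.inl γ, hmem _, hB.factor_odd hγ hγm⟩)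
    rw [this]
    exact zero_mem _

open Classical in
/-- The ordered monomials form a `ℤ_a`-basis of the Kostant superalgebra. -/
theorem exists_basis_monomial (hB : IsChevalleyBasis a H X) (ha0 : a ≠ 0) (ha1 : a ≠ -1)
    (r : roots a ⊕ Fin 3 → roots a ⊕ Fin 3 → Prop) [IsLinearOrder (roots a ⊕ Fin 3) r] :
    ∃ b : Module.Basis (Exponent a) (binomRing a) (kostant a H X),
      ∀ n : Exponent a, (b n : U a) = monomial a H X r n := by
  have := Fintype.ofFinite (roots a ⊕ Fin 3)
  set L : List (roots a ⊕ Fin 3) := Finset.univ.sort r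
  have hL : L.Nodup := Finset.sort_nodup _ r
  have hmem (s : roots a ⊕ Fin 3) : s ∈ L := (Finset.mem_sort r).2 (Finset.mem_univ s)
  let v : Exponent a → kostant a H X := fun n =>
    ⟨orderedProd (factor a H X) L n.1, hB.orderedProd_mem_kostant L n.1⟩
  have hli : LinearIndependent (binomRing a) v := by
    have h : LinearIndependent (binomRing a)
        fun n : Exponent a => orderedProd (factor a H X) L n.1 := by
      refine (hB.linearIndependent_orderedProd_factor hL hmem).restrict_scalars ?_
      intro x y hxy
      simpa [Subring.smul_def] using hxy
    exact LinearIndependent.of_comp (kostant a H X).val.toLinearMap h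
  have hspan : ⊤ ≤ Submodule.span (binomRing a) (Set.range v) := by
    intro u _
    have h := hB.mem_span_of_mem_kostant ha0 ha1 hL hmem u.2
    have e : (Set.range fun n : Exponent a => orderedProd (factor a H X) L n.1) =
        (kostant a H X).val.toLinearMap '' Set.range v := by
      rw [← Set.range_comp]; rfl
    rw [e, Submodule.span_image] at h
    obtain ⟨w, hw, hwu⟩ := h
    rwa [← Subtype.ext hwu]
  refine ⟨Module.Basis.mk hli hspan, fun n => ?_⟩
  rw [Module.Basis.mk_apply, monomial_eq_orderedProd]

end IsChevalleyBasis

end CharZero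

end D21

theorem mainTheorem3 {K : Type*} [Field K] [IsAlgClosed K] [CharZero K] (a : K)
    (ha0 : a ≠ 0) (ha1 : a ≠ -1)
    (H : Fin 3 → D21.cartan a) (X : D21.roots a → D21 a) (hB : D21.IsChevalleyBasis a H X) :
    Module.Free (D21.binomRing a) (D21.kostant a H X) ∧
    ∀ (r : D21.roots a ⊕ Fin 3 → D21.roots a ⊕ Fin 3 → Prop)
      [IsLinearOrder (D21.roots a ⊕ Fin 3) r],
      ∃ b : Module.Basis (D21.Exponent a) (D21.binomRing a) (D21.kostant a H X),
        ∀ n : D21.Exponent a, (b n : D21.U a) = D21.monomial a H X r n := by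
  classical
  refine ⟨?_, fun r _ => hB.exists_basis_monomial ha0 ha1 r⟩
  -- Freeness requires only one total order, and any well-ordering of the index set will do.
  let : LinearOrder (D21.roots a ⊕ Fin 3) := linearOrderOfSTO WellOrderingRel
  obtain ⟨b, -⟩ := hB.exists_basis_monomial ha0 ha1 (· ≤ ·)
  exact Module.Free.of_basis b
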